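/- An allocation instance consists of a set $\mathcal{M}$ of $m$ indivisible items and $n$ agents, where agent $i$ has an entitlement $b_i>0$ with $\sum_i b_i=1$, and a valuation $v_i:2^{\mathcal{M}}\to\mathbb{R}_{\ge 0}$ that is normalized ($v_i(\emptyset)=0$), monotone and submodular ($v_i(S\cup T)+v_i(S\cap T)\le v_i(S)+v_i(T)$). The AnyPrice share of agent $i$ is $$\mathrm{APS}_i=\min_{p\ge 0,\ \sum_j p_j=1}\ \max\Big\{v_i(S)\ :\ S\subseteq\mathcal{M},\ \sum_{j\in S}p_j\le b_i\Big\}$$ (and $0$ if $m=0$), and her maximin share is $\mathrm{MMS}_i=\max_{(A_1,\dots,A_n)}\min_k v_i(A_k)$, over all partitions of $\mathcal{M}$ into $n$ pairwise disjoint, possibly empty, bundles. Algorithms have access to the valuations only through value queries (given $i$ and $S$, the answer is $v_i(S)$), each of which takes unit time. An algorithm runs in polynomial time if its number of operations (arithmetic operations and comparisons on numbers, elementary steps, and value queries) is polynomial in $n$, $m$ and $\log K$, where $K$ is an upper bound on $v_i(\mathcal{M})/v_i(S)$ over all $i$ and all $S$ with $v_i(S)>0$ ($K$ is not part of the input), and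 if moreover, whenever all entitlements and values are rational, its running time with every operation on numbers charged by the bit lengths of its operands is polynomial in $n$, $m$ and the maximal bit length of the entitlements and values. (1) There is a polynomial-time algorithm that, on every such instance (with arbitrary entitlements), outputs an allocation $(A_1,\dots,A_n)$ of all items with $v_i(A_i)\ge\frac13\,\mathrm{APS}_i$ for every agent $i$. (2) There is a polynomial-time algorithm that, on every such instance with equal entitlements $b_i=\frac1n$, outputs an allocation $(A_1,\dots,A_n)$ of all items with $v_i(A_i)\ge\frac{10}{27}\,\mathrm{MMS}_i$ for every agent $i$. -/

import Mathlib

namespace FairAllocation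

/-! ### Valuations, shares, allocation instances -/

/-- A normalized, monotone, submodular valuation on the finite set `M` of items
(it is nonnegative, because it is monotone and vanishes on the empty bundle). -/
structure IsSubmodularValuation {M : Type*} [DecidableEq M] (v : Finset M → ℝ) : Prop where
  normalized : v ∅ = 0
  monotone : Monotone v
  submodular : ∀ S T : Finset M, v (S ∪ T) + v (S ∩ T) ≤ v S + v T

/-- The AnyPrice share of an agent with entitlement `b` and valuation `v`: the minimum over all
nonnegative prices that sum up to `1`, of the maximum value of a bundle of total price at most `b`.
(When there are no items, there are no prices, and the value is `0`.) -/
noncomputable def anyPriceShare {M : Type*} [Fintype M] (b : ℝ) (v : Finset M → ℝ) : ℝ :=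
  ⨅ p : stdSimplex ℝ M, ⨆ S : {S : Finset M // ∑ j ∈ S, p.1 j ≤ b}, v S.1

/-- The bundle of agent `i`, when `A` maps every item to the agent that receives it. -/
def bundle {M N : Type*} [Fintype M] [DecidableEq N] (A : M → N) (i : N) : Finset M :=
  Finset.univ.filter fun j => A j = i

/-- The maximin share, for `n` agents: the maximum over all partitions of the items into `n`
(possibly empty) bundles, of the minimum value of a bundle. -/
noncomputable def maximinShare {M : Type*} [Fintype M] (n : ℕ) (v : Finset M → ℝ) : ℝ :=
  ⨆ A : M → Fin n, ⨅ k : Fin n, v (bundle A k)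

/-- The data of an allocation instance with `n` agents and `m` items. -/
structure Instance (n m : ℕ) where
  entitlement : Fin n → ℝ
  value : Fin n → Finset (Fin m) → ℝ

/-- An allocation instance with arbitrary entitlements in which all agents have submodular
valuations. -/
structure Instance.IsSubmodular {n m : ℕ} (I : Instance n m) : Prop where
  entitlement_pos : ∀ i, 0 < I.entitlement i
  sum_entitlement : ∑ i, I.entitlement i = 1
  value_submodular : ∀ i, IsSubmodularValuation (I.value i)

/-- All agents have the same entitlement. -/
def Instance.EqualEntitlements {n m : ℕ} (I : Instance n m) : Prop :=
  ∀ i, I.entitlement i = 1 / (n : ℝ)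

/-- `K` bounds the ratio between the value of the set of all items and the value of any bundle of
positive value, for every agent. (For integer valuations, the largest value of a bundle is such
a bound.) -/
def Instance.IsRatioBound {n m : ℕ} (I : Instance n m) (K : ℕ) : Prop :=
  ∀ i S, 0 < I.value i S → I.value i Finset.univ ≤ K * I.value i S

/-! ### The machine model: while programs with a value oracle

A program works on finitely many integer arrays and finitely many arrays of numbers; the arrays
are of unlimited length and arrays and scalar variables are not distinguished (a scalar is
an entry with a constant index). Integers can only be added, subtracted and compared (so that
the bit length of an integer grows by at most one per step). Numbers can be added, subtracted,
multiplied, divided and compared; they cannot be rounded or turned into integers. -/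

/-- The memory: `nat a i` and `num a i` are the entries with index `i` of the integer array and
of the number array with name `a`. -/
structure Memory where
  nat : ℕ → ℕ → ℕ
  num : ℕ → ℕ → ℝ

/-- Write an entry of an integer array. -/
def Memory.setNat (s : Memory) (a i x : ℕ) : Memory :=
  { s with nat := Function.update s.nat a (Function.update (s.nat a) i x) }

/-- Write an entry of a number array. -/
noncomputable def Memory.setNum (s : Memory) (a i : ℕ) (x : ℝ) : Memory :=
  { s with num := Function.update s.num a (Function.update (s.num a) i x) }

/-- Integer expressions. -/
inductive NatExpr where
  | const (k : ℕ)
  | get (a : ℕ) (i : NatExpr)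
  | add (e f : NatExpr)
  | sub (e f : NatExpr)

/-- The value of an integer expression (subtraction is truncated at `0`). -/
def NatExpr.eval (s : Memory) : NatExpr → ℕ
  | .const k => k
  | .get a i => s.nat a (i.eval s)
  | .add e f => e.eval s + f.eval s
  | .sub e f => e.eval s - f.eval s

/-- The number of operations in an integer expression. -/
def NatExpr.cost : NatExpr → ℕ
  | .const _ => 1
  | .get _ i => 1 + i.cost
  | .add e f => 1 + e.cost + f.cost
  | .sub e f => 1 + e.cost + f.cost

/-- Number expressions; the constants of a program are rational. -/
inductive NumExpr where
  | const (q : ℚ)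
  | get (a : ℕ) (i : NatExpr)
  | add (e f : NumExpr)
  | sub (e f : NumExpr)
  | mul (e f : NumExpr)
  | div (e f : NumExpr)

/-- The value of a number expression (division by `0` gives `0`). -/
noncomputable def NumExpr.eval (s : Memory) : NumExpr → ℝ
  | .const q => q
  | .get a i => s.num a (i.eval s)
  | .add e f => e.eval s + f.eval s
  | .sub e f => e.eval s - f.eval s
  | .mul e f => e.eval s * f.eval s
  | .div e f => e.eval s / f.eval s

/-- The cost of evaluating a number expression: one for every operation, plus the size `w x` of
every operand `x`. -/
noncomputable def NumExpr.cost (w : ℝ → ℕ) (s : Memory) : NumExpr → ℕ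
  | .const q => 1 + w q
  | .get a i => 1 + i.cost + w (s.num a (i.eval s))
  | .add e f => 1 + e.cost w s + f.cost w s + w (e.eval s) + w (f.eval s)
  | .sub e f => 1 + e.cost w s + f.cost w s + w (e.eval s) + w (f.eval s)
  | .mul e f => 1 + e.cost w s + f.cost w s + w (e.eval s) + w (f.eval s)
  | .div e f => 1 + e.cost w s + f.cost w s + w (e.eval s) + w (f.eval s)

/-- Tests. -/
inductive Test where
  | natLe (e f : NatExpr)
  | numLe (e f : NumExpr)
  | not (t : Test)
  | and (t u : Test)

/-- The truth of a test. -/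
def Test.Holds (s : Memory) : Test → Prop
  | .natLe e f => e.eval s ≤ f.eval s
  | .numLe e f => e.eval s ≤ f.eval s
  | .not t => ¬ t.Holds s
  | .and t u => t.Holds s ∧ u.Holds s

/-- The cost of a test. -/
noncomputable def Test.cost (w : ℝ → ℕ) (s : Memory) : Test → ℕ
  | .natLe e f => 1 + e.cost + f.cost
  | .numLe e f => 1 + e.cost w s + f.cost w s + w (e.eval s) + w (f.eval s)
  | .not t => 1 + t.cost w s
  | .and t u => 1 + t.cost w s + u.cost w s

/-- Programs. `query a i g c` writes into `num a i` the value that agent `g` gives to the set of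
the items `j` for which entry `j` of the integer array `c` is not `0`. -/
inductive Program where
  | skip
  | setNat (a : ℕ) (i e : NatExpr)
  | setNum (a : ℕ) (i : NatExpr) (e : NumExpr)
  | query (a : ℕ) (i g : NatExpr) (c : ℕ)
  | seq (p q : Program)
  | ite (t : Test) (p q : Program)
  | loop (t : Test) (p : Program)

/-- The answer of the value oracle of the instance `I` to the query of the value, for agent `g`, of
the set of items with indicator function `c` (`0` if there is no such agent). -/
noncomputable def Instance.oracle {n m : ℕ} (I : Instance n m) (g : ℕ) (c : ℕ → ℕ) : ℝ :=
  if h : g < n then I.value ⟨g, h⟩ (Finset.univ.filter fun j : Fin m => c j ≠ 0) else 0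

/-- `Exec I w p s t s'`: with oracle access to the valuations in `I`, the program `p`, started in
memory `s`, terminates in memory `s'` after time `t`, where `w x` is the extra cost of
an operation for an operand `x`. A value query takes unit time (after its arguments are
evaluated). `loop t p` repeats `p` while `t` holds. -/
inductive Exec {n m : ℕ} (I : Instance n m) (w : ℝ → ℕ) :
    Program → Memory → ℕ → Memory → Prop where
  | skip (s : Memory) : Exec I w .skip s 1 s
  | setNat (s : Memory) (a : ℕ) (i e : NatExpr) :
      Exec I w (.setNat a i e) s (1 + i.cost + e.cost) (s.setNat a (i.eval s) (e.eval s))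
  | setNum (s : Memory) (a : ℕ) (i : NatExpr) (e : NumExpr) :
      Exec I w (.setNum a i e) s (1 + i.cost + e.cost w s) (s.setNum a (i.eval s) (e.eval s))
  | query (s : Memory) (a : ℕ) (i g : NatExpr) (c : ℕ) :
      Exec I w (.query a i g c) s (1 + i.cost + g.cost)
        (s.setNum a (i.eval s) (I.oracle (g.eval s) (s.nat c)))
  | seq {p q : Program} {s s' s'' : Memory} {k l : ℕ}
      (hp : Exec I w p s k s') (hq : Exec I w q s' l s'') : Exec I w (.seq p q) s (k + l) s''
  | ite_true {t : Test} {p q : Program} {s s' : Memory} {k : ℕ}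
      (ht : t.Holds s) (hp : Exec I w p s k s') : Exec I w (.ite t p q) s (1 + t.cost w s + k) s'
  | ite_false {t : Test} {p q : Program} {s s' : Memory} {k : ℕ}
      (ht : ¬ t.Holds s) (hq : Exec I w q s k s') : Exec I w (.ite t p q) s (1 + t.cost w s + k) s'
  | loop_true {t : Test} {p : Program} {s s' s'' : Memory} {k l : ℕ}
      (ht : t.Holds s) (hp : Exec I w p s k s') (hl : Exec I w (.loop t p) s' l s'') :
      Exec I w (.loop t p) s (1 + t.cost w s + k + l) s''
  | loop_false {t : Test} {p : Program} {s : Memory}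
      (ht : ¬ t.Holds s) : Exec I w (.loop t p) s (1 + t.cost w s) s

/-- The initial memory: `n` and `m` are the entries `0` and `1` of the integer array `0`, the
entitlements are the entries of the number array `0`, and everything else is `0`. The valuations
are accessible only through queries. -/
noncomputable def Instance.input {n m : ℕ} (I : Instance n m) : Memory where
  nat a i := if a = 0 ∧ i = 0 then n else if a = 0 ∧ i = 1 then m else 0
  num a i := if h : a = 0 ∧ i < n then I.entitlement ⟨i, h.2⟩ else 0

/-- The memory `s` holds the allocation `A`: entry `j` of the integer array `1` is the agent that
receives item `j`. -/
def Memory.Outputs {n m : ℕ} (s : Memory) (A : Fin m → Fin n) : Prop :=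
  ∀ j : Fin m, s.nat 1 j = A j

/-- Unit cost: operands have no extra cost, so that the time is the number of operations. -/
def unitCost : ℝ → ℕ := fun _ => 0

/-- The bit length of a rational number. -/
def ratBitLength (q : ℚ) : ℕ := q.num.natAbs.size + q.den.size

open Classical in
/-- Bit cost: the extra cost of a rational operand is its bit length. (Real numbers that are not
rational get `0`; they do not occur in an execution in which all inputs and all answers of
the oracle are rational.) -/
noncomputable def bitCost (x : ℝ) : ℕ :=
  if h : ∃ q : ℚ, (q : ℝ) = x then ratBitLength h.choose else 0

theorem bitCost_ratCast (q : ℚ) : bitCost (q : ℝ) = ratBitLength q := by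
  have h : ∃ r : ℚ, (r : ℝ) = (q : ℝ) := ⟨q, rfl⟩
  have h' : h.choose = q := by exact_mod_cast h.choose_spec
  rw [bitCost, dif_pos h, h']

/-- All entitlements and all values of bundles are rational numbers of bit length at most `L`. -/
def Instance.RationalOfBitLength {n m : ℕ} (I : Instance n m) (L : ℕ) : Prop :=
  (∀ i, ∃ q : ℚ, I.entitlement i = q ∧ ratBitLength q ≤ L) ∧
    ∀ i S, ∃ q : ℚ, I.value i S = q ∧ ratBitLength q ≤ L

/-- There is a polynomial-time algorithm in the value-oracle model that outputs, for every
allocation instance in the class `C`, an allocation that is good for it. This is one program and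
one polynomial for all instances such that
* on every instance (with real data), the number of operations, including the value queries, is
  at most polynomial in the number of agents, the number of items and `log K`;
* if the data of the instance is rational, then the running time with bit cost is
  at most polynomial in the number of agents, the number of items and the bit length of
  the entitlements and of the values. -/
def HasPolyTimeAlgorithm (C : ∀ {n m : ℕ}, Instance n m → Prop)
    (Good : ∀ {n m : ℕ}, Instance n m → (Fin m → Fin n) → Prop) : Prop :=
  ∃ (prog : Program) (P : Polynomial ℕ), ∀ (n m : ℕ) (I : Instance n m), C I →
    ∃ (s : Memory) (A : Fin m → Fin n), s.Outputs A ∧ Good I A ∧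
      (∀ K : ℕ, I.IsRatioBound K →
        ∃ t : ℕ, Exec I unitCost prog I.input t s ∧ t ≤ P.eval (n + m + Nat.log 2 K)) ∧
      (∀ L : ℕ, I.RationalOfBitLength L →
        ∃ t : ℕ, Exec I bitCost prog I.input t s ∧ t ≤ P.eval (n + m + L))

/-- The allocation `A` gives every agent at least a `ρ` fraction of her AnyPrice share. -/
def Instance.IsAPSFair {n m : ℕ} (ρ : ℝ) (I : Instance n m) (A : Fin m → Fin n) : Prop :=
  ∀ i, ρ * anyPriceShare (I.entitlement i) (I.value i) ≤ I.value i (bundle A i)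

/-- The allocation `A` gives every agent at least a `ρ` fraction of her maximin share. -/
def Instance.IsMMSFair {n m : ℕ} (ρ : ℝ) (I : Instance n m) (A : Fin m → Fin n) : Prop :=
  ∀ i, ρ * maximinShare n (I.value i) ≤ I.value i (bundle A i)

end FairAllocation

namespace FairAllocation

/-! ### A program logic with time bounds -/

/-! Both algorithms auction the items one at a time. An agent whose bundle is worth less than her
target `θ i` bids on every free item: her entitlement times a function `φ` of the item's marginal
value divided by the target. The highest bid wins and becomes the payment. The proof rests on two
facts. No agent pays more than her entitlement in total, even though her last item may overshoot the
target. And an item lost by an unsatisfied agent was paid at least her own bid for it, a bound that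
survives later because marginals only decrease. `IsAgentInvariant.of_reachable` reduces such facts
to the view of a single agent.

Suppose that everything is allocated and an agent with entitlement `b` misses her target, normalised
to 1. For the AnyPrice share the bid is `r / 2`, or 1 if `r ≥ 1`. Price her own items at 0 and the
others in proportion to their payments, whose total `W` is at most `1 - b`. An affordable bundle
then has payments at most `b * W < b`, so every item in it outside her own bundle was lost at the
linear rate and these marginals sum to at most `2 * W`. By `le_add_sum_marginal` the bundle is worth
at most `1 + 2 * (1 - b)`, strictly less than 3 (`anyPriceShare_le_of_lt`).

For the maximin share the bids are step functions that change once the agent owns an item of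
relative marginal at least `7 / 10`. If all `n` bundles of a partition were worth about `27 / 10`,
their marginals over her bundle would sum to about `17 / 10` each, forcing each bundle to carry a
payment of almost one entitlement. That exceeds the `n - 1` entitlements available to the others
(`maximinShare_le_of_lt`). For an agent with raised flag, payments are first rounded by `roundHalf`,
which still leaves every agent at most 1.

So a missed target certifies `share ≤ c * (θ i * (1 - ε))` with `c = 3` or `27 / 10` and `ε = 1 / (4
* (n + m))`. The algorithm starts from the value of all items, replays the game, multiplies each
missed target by `1 - ε`, and stops when nobody misses. Throughout, `share ≤ c * target`, so the
final allocation is good (`allocate_spec`). A target so small that three times it lies below the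
least positive item value is replaced by 0, which is sound because the share is 0 or the value of a
bundle; this limits the decreases to `O((n + m) * log K)` per agent (`targetSeq_maxDecreases`).

For the running time, `Triple` separates the number of operations from the size of operands. Numbers
stay short because a nonzero target is the initial value times a power of a fixed rate and nothing
else is accumulated; payments belong to the analysis and are not kept by the program.
`hasPolyTimeAlgorithm_of_bids` combines all this for both families of bids. -/

@[simp] theorem Memory.setNat_nat (s : Memory) (a i x b j : ℕ) :
    (s.setNat a i x).nat b j = if b = a ∧ j = i then x else s.nat b j := by
  by_cases h : b = a
  · subst h; by_cases h' : j = i <;> simp [Memory.setNat, h']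
  · simp [Memory.setNat, h]

@[simp] theorem Memory.setNat_num (s : Memory) (a i x : ℕ) : (s.setNat a i x).num = s.num := rfl

@[simp] theorem Memory.setNum_num (s : Memory) (a i : ℕ) (x : ℝ) (b j : ℕ) :
    (s.setNum a i x).num b j = if b = a ∧ j = i then x else s.num b j := by
  by_cases h : b = a
  · subst h; by_cases h' : j = i <;> simp [Memory.setNum, h']
  · simp [Memory.setNum, h]

@[simp] theorem Memory.setNum_nat (s : Memory) (a i : ℕ) (x : ℝ) : (s.setNum a i x).nat = s.nat :=
  rfl

/-- The number of operations in a number expression. -/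
def NumExpr.size : NumExpr → ℕ
  | .const _ => 1
  | .get _ i => 1 + i.cost
  | .add e f => 1 + e.size + f.size
  | .sub e f => 1 + e.size + f.size
  | .mul e f => 1 + e.size + f.size
  | .div e f => 1 + e.size + f.size

/-- All numbers that occur in the evaluation of an expression satisfy `P`. -/
def NumExpr.All (P : ℝ → Prop) (s : Memory) : NumExpr → Prop
  | .const q => P q
  | .get a i => P (s.num a (i.eval s))
  | .add e f => e.All P s ∧ f.All P s ∧ P (e.eval s + f.eval s)
  | .sub e f => e.All P s ∧ f.All P s ∧ P (e.eval s - f.eval s)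
  | .mul e f => e.All P s ∧ f.All P s ∧ P (e.eval s * f.eval s)
  | .div e f => e.All P s ∧ f.All P s ∧ P (e.eval s / f.eval s)

theorem NumExpr.All.eval {P : ℝ → Prop} {s : Memory} {e : NumExpr} (h : e.All P s) :
    P (e.eval s) := by
  cases e <;> simp only [NumExpr.All] at h <;> first | exact h | exact h.2.2

/-- Every operation is charged one plus the sizes of at most two operands, hence at most `1 + 2 *
W`. The same factor separates operation count and operand size in all time bounds below. -/
theorem NumExpr.All.cost_le {P : ℝ → Prop} {s : Memory} {w : ℝ → ℕ} {W : ℕ}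
    (hw : ∀ x, P x → w x ≤ W) {e : NumExpr} (h : e.All P s) :
    e.cost w s ≤ e.size * (1 + 2 * W) := by
  induction e with
  | const q =>
    have := hw _ h
    simp only [NumExpr.cost, NumExpr.size]; linarith
  | get a i =>
    have := hw _ h
    simp only [NumExpr.cost, NumExpr.size]; nlinarith
  | add e f he hf | sub e f he hf | mul e f he hf | div e f he hf =>
    have h1 := he h.1
    have h2 := hf h.2.1
    have h3 := hw _ h.1.eval
    have h4 := hw _ h.2.1.eval
    simp only [NumExpr.cost, NumExpr.size]; nlinarith

/-- The number of operations in a test. -/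
def Test.size : Test → ℕ
  | .natLe e f => 1 + e.cost + f.cost
  | .numLe e f => 1 + e.size + f.size
  | .not t => 1 + t.size
  | .and t u => 1 + t.size + u.size

/-- All numbers that occur in the evaluation of a test satisfy `P`. -/
def Test.All (P : ℝ → Prop) (s : Memory) : Test → Prop
  | .natLe _ _ => True
  | .numLe e f => e.All P s ∧ f.All P s
  | .not t => t.All P s
  | .and t u => t.All P s ∧ u.All P s

theorem Test.All.cost_le {P : ℝ → Prop} {s : Memory} {w : ℝ → ℕ} {W : ℕ}
    (hw : ∀ x, P x → w x ≤ W) {t : Test} (h : t.All P s) :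
    t.cost w s ≤ t.size * (1 + 2 * W) := by
  induction t with
  | natLe e f => simp only [Test.cost, Test.size]; nlinarith
  | numLe e f =>
    have h1 := h.1.cost_le hw
    have h2 := h.2.cost_le hw
    have h3 := hw _ h.1.eval
    have h4 := hw _ h.2.eval
    simp only [Test.cost, Test.size]; nlinarith
  | not t ht =>
    have := ht h
    simp only [Test.cost, Test.size]; nlinarith
  | and t u ht hu =>
    have h1 := ht h.1
    have h2 := hu h.2
    simp only [Test.cost, Test.size]; nlinarith

/-- A bound for the number of operations of a program all of whose loops have at most `X`
iterations, as a polynomial in `X`. -/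
noncomputable def Program.bound : Program → Polynomial ℕ
  | .skip => 1
  | .setNat _ i e => .C (1 + i.cost + e.cost)
  | .setNum _ i e => .C (1 + i.cost + e.size)
  | .query _ i g _ => .C (1 + i.cost + g.cost)
  | .seq p q => p.bound + q.bound
  | .ite t p q => .C (1 + t.size) + p.bound + q.bound
  | .loop t p => (.X + 1) * (.C (1 + t.size) + p.bound)

theorem polynomial_eval_mono (p : Polynomial ℕ) {a b : ℕ} (h : a ≤ b) : p.eval a ≤ p.eval b := by
  rw [Polynomial.eval_eq_sum, Polynomial.eval_eq_sum]
  exact Finset.sum_le_sum fun i _ => Nat.mul_le_mul_left _ (Nat.pow_le_pow_left h i)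

variable {n m : ℕ}

/-- Started in memory `s`, the program `p` terminates in a memory that satisfies `Q`. All loops
have at most `M` iterations, and all numbers in the execution satisfy `P`, so that
the running time is bounded accordingly. -/
def Triple (I : Instance n m) (P : ℝ → Prop) (M : ℕ) (p : Program) (s : Memory)
    (Q : Memory → Prop) : Prop :=
  -- The final memory is chosen before the cost function, so that a single correctness proof serves
  -- both unit cost and bit cost with the same output.
  ∃ s', Q s' ∧ ∀ (w : ℝ → ℕ) (W : ℕ), (∀ x, P x → w x ≤ W) →
    ∃ t, Exec I w p s t s' ∧ t ≤ p.bound.eval M * (1 + 2 * W)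

namespace Triple

variable {I : Instance n m} {P : ℝ → Prop} {M : ℕ} {s : Memory} {Q : Memory → Prop}

theorem mono {p : Program} {Q' : Memory → Prop} (h : Triple I P M p s Q)
    (hQ : ∀ s', Q s' → Q' s') : Triple I P M p s Q' := by
  obtain ⟨s', h1, h2⟩ := h
  exact ⟨s', hQ _ h1, h2⟩

theorem skip (h : Q s) : Triple I P M .skip s Q :=
  ⟨s, h, fun _ W _ => ⟨1, .skip s, by simp [Program.bound]⟩⟩

theorem setNat {a : ℕ} {i e : NatExpr} (h : Q (s.setNat a (i.eval s) (e.eval s))) :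
    Triple I P M (.setNat a i e) s Q :=
  ⟨_, h, fun _ W _ => ⟨_, .setNat s a i e, by simp only [Program.bound, Polynomial.eval_C]; nlinarith⟩⟩

theorem setNum {a : ℕ} {i : NatExpr} {e : NumExpr} (he : e.All P s)
    (h : Q (s.setNum a (i.eval s) (e.eval s))) : Triple I P M (.setNum a i e) s Q :=
  ⟨_, h, fun _ W hw => ⟨_, .setNum s a i e, by
    have := he.cost_le hw
    simp only [Program.bound, Polynomial.eval_C]; nlinarith⟩⟩

theorem query {a : ℕ} {i g : NatExpr} {c : ℕ}
    (h : Q (s.setNum a (i.eval s) (I.oracle (g.eval s) (s.nat c)))) :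
    Triple I P M (.query a i g c) s Q :=
  ⟨_, h, fun _ W _ => ⟨_, .query s a i g c, by
    simp only [Program.bound, Polynomial.eval_C]; nlinarith⟩⟩

theorem seq {p q : Program} (h : Triple I P M p s fun s' => Triple I P M q s' Q) :
    Triple I P M (.seq p q) s Q := by
  obtain ⟨s', ⟨s'', h1, h2⟩, h3⟩ := h
  refine ⟨s'', h1, fun w W hw => ?_⟩
  obtain ⟨t, ht, ht'⟩ := h3 w W hw
  obtain ⟨u, hu, hu'⟩ := h2 w W hw
  refine ⟨_, .seq ht hu, ?_⟩
  simp only [Program.bound, Polynomial.eval_add]; linarith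

theorem ite {t : Test} {p q : Program} (ht : t.All P s)
    (hp : t.Holds s → Triple I P M p s Q) (hq : ¬ t.Holds s → Triple I P M q s Q) :
    Triple I P M (.ite t p q) s Q := by
  by_cases h : t.Holds s
  · obtain ⟨s', h1, h2⟩ := hp h
    refine ⟨s', h1, fun w W hw => ?_⟩
    obtain ⟨k, hk, hk'⟩ := h2 w W hw
    refine ⟨_, .ite_true h hk, ?_⟩
    have := ht.cost_le hw
    simp only [Program.bound, Polynomial.eval_add, Polynomial.eval_C]
    nlinarith [Nat.zero_le (q.bound.eval M * (1 + 2 * W))]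
  · obtain ⟨s', h1, h2⟩ := hq h
    refine ⟨s', h1, fun w W hw => ?_⟩
    obtain ⟨k, hk, hk'⟩ := h2 w W hw
    refine ⟨_, .ite_false h hk, ?_⟩
    have := ht.cost_le hw
    simp only [Program.bound, Polynomial.eval_add, Polynomial.eval_C]
    nlinarith [Nat.zero_le (p.bound.eval M * (1 + 2 * W))]

/-- The rule for a loop with the invariant `V r`, where `r` bounds the number of iterations that
are still to come. -/
theorem loop {t : Test} {p : Program} (V : ℕ → Memory → Prop) {r : ℕ} (hr : r ≤ M) (h0 : V r s)
    (hall : ∀ r s, V r s → t.All P s)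
    (step : ∀ r s, V r s → t.Holds s → Triple I P M p s fun s' => ∃ r' < r, V r' s')
    (exit : ∀ r s, V r s → ¬ t.Holds s → Q s) :
    Triple I P M (.loop t p) s Q := by
  -- The induction needs the time bound in terms of the remaining iterations `r`; the summand 1 pays
  -- for the final failing test.
  suffices h : ∀ r s, V r s → ∃ s', Q s' ∧ ∀ (w : ℝ → ℕ) (W : ℕ), (∀ x, P x → w x ≤ W) →
      ∃ k, Exec I w (.loop t p) s k s' ∧
        k ≤ (r + 1) * (1 + t.size + p.bound.eval M) * (1 + 2 * W) by
    obtain ⟨s', h1, h2⟩ := h r s h0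
    refine ⟨s', h1, fun w W hw => ?_⟩
    obtain ⟨k, hk, hk'⟩ := h2 w W hw
    refine ⟨k, hk, hk'.trans ?_⟩
    simp only [Program.bound, Polynomial.eval_mul, Polynomial.eval_add, Polynomial.eval_X,
      Polynomial.eval_one, Polynomial.eval_C]
    gcongr
  intro r
  induction r using Nat.strong_induction_on with
  | _ r ih =>
    intro s hV
    by_cases h : t.Holds s
    · obtain ⟨s', ⟨r', hr', hV'⟩, h2⟩ := step r s hV h
      obtain ⟨s'', h3, h4⟩ := ih r' hr' s' hV'
      refine ⟨s'', h3, fun w W hw => ?_⟩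
      obtain ⟨k, hk, hk'⟩ := h2 w W hw
      obtain ⟨l, hl, hl'⟩ := h4 w W hw
      refine ⟨_, .loop_true h hk hl, ?_⟩
      have h5 := (hall r s hV).cost_le hw
      have h6 : (r' + 1) * (1 + t.size + p.bound.eval M) * (1 + 2 * W) ≤
          r * (1 + t.size + p.bound.eval M) * (1 + 2 * W) := by gcongr; omega
      nlinarith
    · refine ⟨s, exit r s hV h, fun w W hw => ⟨_, .loop_false h, ?_⟩⟩
      have h5 := (hall r s hV).cost_le hw
      calc 1 + t.cost w s ≤ 1 + t.size * (1 + 2 * W) := by omega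
        _ ≤ 1 * (1 + t.size + p.bound.eval M) * (1 + 2 * W) := by
          nlinarith [Nat.zero_le (p.bound.eval M * (1 + 2 * W))]
        _ ≤ _ := by gcongr; omega

end Triple

/-! ### Scalar variables and counted loops -/

/-- The integer variable `a`. -/
def NatExpr.var (a : ℕ) : NatExpr := .get a (.const 0)

@[simp] theorem NatExpr.eval_var (s : Memory) (a : ℕ) : (NatExpr.var a).eval s = s.nat a 0 := rfl

/-- `for a = 0, …, e - 1 do p`. -/
def Program.forLoop (a : ℕ) (e : NatExpr) (p : Program) : Program :=
  .seq (.setNat a (.const 0) (.const 0))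
    (.loop (.not (.natLe e (.var a)))
      (.seq p (.setNat a (.const 0) (.add (.var a) (.const 1)))))

/-- The rule for a loop over `a = 0, …, B - 1`. -/
theorem Triple.forLoop {I : Instance n m} {P : ℝ → Prop} {M : ℕ} {s : Memory}
    {Q : Memory → Prop} {a : ℕ} {e : NatExpr} {p : Program} (V : ℕ → Memory → Prop) {B : ℕ}
    (hB : B ≤ M) (h0 : V 0 (s.setNat a 0 0))
    (hV : ∀ k s, V k s → s.nat a 0 = k ∧ e.eval s = B)
    (step : ∀ k s, k < B → V k s → Triple I P M p s fun s' =>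
      s'.nat a 0 = k ∧ V (k + 1) (s'.setNat a 0 (k + 1)))
    (exit : ∀ s, V B s → Q s) :
    Triple I P M (.forLoop a e p) s Q := by
  refine Triple.seq (Triple.setNat ?_)
  refine Triple.loop (fun r s => ∃ k, k ≤ B ∧ r = B - k ∧ V k s) (r := B) hB ⟨0, by simp, by simp, h0⟩
    (fun r s _ => trivial) ?_ ?_
  · rintro r s ⟨k, hk, rfl, hk'⟩ ht
    have h1 := hV k s hk'
    have hlt : k < B := by
      simpa [Test.Holds, h1.1, h1.2] using ht
    refine Triple.seq ((step k s hlt hk').mono ?_)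
    rintro s' ⟨h2, h3⟩
    refine Triple.setNat ⟨B - (k + 1), by omega, k + 1, hlt, rfl, ?_⟩
    simpa [NatExpr.eval, h2] using h3
  · rintro r s ⟨k, hk, rfl, hk'⟩ ht
    have h1 := hV k s hk'
    have : B ≤ k := by simpa [Test.Holds, h1.1, h1.2] using ht
    obtain rfl : k = B := le_antisymm hk this
    exact exit s hk'

/-! ### Marginal values -/

/-- The marginal value of the item `j` for the owner of the bundle `T`. -/
def marginal {M : Type*} [DecidableEq M] (g : Finset M → ℝ) (T : Finset M) (j : M) : ℝ :=
  g (insert j T) - g T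

section Marginal

variable {M : Type*} [DecidableEq M] {g : Finset M → ℝ}

theorem IsSubmodularValuation.nonneg (hg : IsSubmodularValuation g) (S : Finset M) : 0 ≤ g S := by
  rw [← hg.normalized]; exact hg.monotone (Finset.empty_subset S)

theorem IsSubmodularValuation.marginal_nonneg (hg : IsSubmodularValuation g) (T : Finset M)
    (j : M) : 0 ≤ marginal g T j :=
  sub_nonneg.2 (hg.monotone (Finset.subset_insert j T))

/-- Diminishing returns: for `j` outside `T'` this is submodularity for the pair `insert j T`, `T'`;
for `j` inside, the left side vanishes. -/
theorem IsSubmodularValuation.marginal_anti (hg : IsSubmodularValuation g) {T T' : Finset M}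
    (h : T ⊆ T') (j : M) : marginal g T' j ≤ marginal g T j := by
  by_cases hj : j ∈ T'
  · have : marginal g T' j = 0 := by simp [marginal, hj]
    rw [this]; exact hg.marginal_nonneg T j
  · have h1 := hg.submodular (insert j T) T'
    have h2 : insert j T ∪ T' = insert j T' := by
      rw [Finset.insert_union, Finset.union_eq_right.2 h]
    have h3 : insert j T ∩ T' = T := by
      rw [Finset.insert_inter_of_notMem hj, Finset.inter_eq_left.2 h]
    rw [h2, h3] at h1
    unfold marginal; linarith

/-- The inequality that turns payments into values: lower bounds on what others paid for the items
of `S \ T` become an upper bound on the value of `S`. -/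
theorem IsSubmodularValuation.le_add_sum_marginal (hg : IsSubmodularValuation g)
    (S T : Finset M) : g S ≤ g T + ∑ j ∈ S \ T, marginal g T j := by
  suffices h : ∀ U : Finset M, g (T ∪ U) ≤ g T + ∑ j ∈ U, marginal g T j by
    refine le_trans (hg.monotone ?_) (h (S \ T))
    rw [Finset.union_sdiff_self_eq_union]; exact Finset.subset_union_right
  intro U
  induction U using Finset.induction_on with
  | empty => simp
  | insert j U hj ih =>
    rw [Finset.sum_insert hj, Finset.union_insert]
    have h1 := hg.marginal_anti (T := T) (T' := T ∪ U) Finset.subset_union_left j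
    unfold marginal at h1 ih ⊢
    linarith

theorem IsSubmodularValuation.div_const (hg : IsSubmodularValuation g) {c : ℝ} (hc : 0 < c) :
    IsSubmodularValuation fun S => g S / c where
  normalized := by simp [hg.normalized]
  monotone S T h := div_le_div_of_nonneg_right (hg.monotone h) hc.le
  submodular S T := by
    rw [← add_div, ← add_div]; exact div_le_div_of_nonneg_right (hg.submodular S T) hc.le

theorem IsSubmodularValuation.marginal_empty (hg : IsSubmodularValuation g) (j : M) :
    marginal g ∅ j = g {j} := by simp [marginal, hg.normalized]

end Marginal

/-! ### The bidding game -/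

/-- The items of agent `i`. -/
def held (o : Fin m → ℕ) (i : Fin n) : Finset (Fin m) := Finset.univ.filter fun j => o j = i

/-- The items that are not yet allocated. -/
def free (n : ℕ) (o : Fin m → ℕ) : Finset (Fin m) := Finset.univ.filter fun j => n ≤ o j

/-- A state of the bidding game: the owners of the items (`n` for an item that is not yet allocated),
a flag for every agent, and the payments for the items. -/
structure GameState (n m : ℕ) where
  owner : Fin m → ℕ
  flag : Fin n → ℕ
  pay : Fin m → ℝ

/-- The marginal value of an item for an agent, relative to the target of the agent. -/
noncomputable def Instance.relMarginal (I : Instance n m) (θ : Fin n → ℝ) (o : Fin m → ℕ)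
    (i : Fin n) (j : Fin m) : ℝ :=
  marginal (I.value i) (held o i) j / θ i

/-- The bid of an agent for an item. -/
noncomputable def Instance.bid (I : Instance n m) (φ : ℕ → ℝ → ℝ) (θ : Fin n → ℝ)
    (o : Fin m → ℕ) (f : Fin n → ℕ) (i : Fin n) (j : Fin m) : ℝ :=
  I.entitlement i * φ (f i) (I.relMarginal θ o i j)

/-- The state after agent `i` has won item `j`. -/
noncomputable def Instance.award (I : Instance n m) (φ : ℕ → ℝ → ℝ) (θ : Fin n → ℝ)
    (st : GameState n m) (i : Fin n) (j : Fin m) : GameState n m where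
  owner := Function.update st.owner j i
  flag := if 7 / 10 ≤ I.relMarginal θ st.owner i j then Function.update st.flag i 1 else st.flag
  pay := Function.update st.pay j (I.bid φ θ st.owner st.flag i j)

/-- The states that can be reached in the bidding game, in which an unsatisfied agent with the highest
bid wins. -/
inductive Reachable (I : Instance n m) (φ : ℕ → ℝ → ℝ) (θ : Fin n → ℝ) : GameState n m → Prop where
  | init : Reachable I φ θ ⟨fun _ => n, fun _ => 0, fun _ => 0⟩
  | step {st : GameState n m} {i : Fin n} {j : Fin m} (hst : Reachable I φ θ st)
      (hj : n ≤ st.owner j) (hi : I.value i (held st.owner i) < θ i)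
      (hmax : ∀ i' j', n ≤ st.owner j' → I.value i' (held st.owner i') < θ i' →
        I.bid φ θ st.owner st.flag i' j' ≤ I.bid φ θ st.owner st.flag i j) :
      Reachable I φ θ (I.award φ θ st i j)

/-! ### How bundles change when an item is awarded -/

theorem held_update_self {o : Fin m → ℕ} {i : Fin n} {j : Fin m} :
    held (Function.update o j i) i = insert j (held o i) := by
  ext k; by_cases h : k = j <;> simp [held, h]

theorem held_update_of_ne {o : Fin m → ℕ} {i k : Fin n} {j : Fin m} (hj : n ≤ o j) (hk : k ≠ i) :
    held (Function.update o j i) k = held o k := by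
  ext l
  by_cases h : l = j
  · subst h
    have h1 : (i : ℕ) ≠ k := fun h => hk (Fin.ext h.symm)
    have h2 : o l ≠ k := by have := k.2; omega
    simp [held, h1, h2]
  · simp [held, h]

theorem free_update {o : Fin m → ℕ} {i : Fin n} {j : Fin m} :
    free n (Function.update o j i) = (free n o).erase j := by
  ext l
  by_cases h : l = j
  · subst h; simp [free]
  · simp [free, h]

theorem mem_free {o : Fin m → ℕ} {j : Fin m} : j ∈ free n o ↔ n ≤ o j := by simp [free]

theorem mem_held {o : Fin m → ℕ} {i : Fin n} {j : Fin m} : j ∈ held o i ↔ o j = i := by simp [held]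

theorem held_const (k : Fin n) : held (fun _ : Fin m => n) k = ∅ :=
  Finset.filter_eq_empty_iff.2 fun _ _ => k.2.ne'

/-- A property of the view of a single agent that is preserved in the bidding game. The agent has the
valuation `g` with target `1`, the bundle `T`, and the flag `f`, the items in `F` are
not yet allocated, and `p` are the payments, relative to the entitlement of the agent. -/
structure IsAgentInvariant (φ : ℕ → ℝ → ℝ) (R : (Finset (Fin m) → ℝ) → Finset (Fin m) → ℕ →
    Finset (Fin m) → (Fin m → ℝ) → Prop) : Prop where
  init : ∀ g, IsSubmodularValuation g → R g ∅ 0 Finset.univ fun _ => 0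
  own : ∀ g T f F p j, IsSubmodularValuation g → R g T f F p → g T < 1 → j ∈ F → j ∉ T →
    (∀ k ∈ F, φ f (marginal g T k) ≤ φ f (marginal g T j)) →
    R g (insert j T) (if 7 / 10 ≤ marginal g T j then 1 else f) (F.erase j)
      (Function.update p j (φ f (marginal g T j)))
  other : ∀ g T f F p j q, IsSubmodularValuation g → R g T f F p → j ∈ F → j ∉ T →
    (g T < 1 → ∀ k ∈ F, φ f (marginal g T k) ≤ q) → R g T f (F.erase j) (Function.update p j q)

/-- Dividing values by the target and payments by the entitlement leaves an agent with target 1 who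
sees two kinds of moves. When she wins, the item maximises her own bid; when another agent wins, the
payment is at least each of her bids, provided that she is still unsatisfied. -/
theorem IsAgentInvariant.of_reachable {I : Instance n m} (hI : I.IsSubmodular)
    {φ : ℕ → ℝ → ℝ} {θ : Fin n → ℝ} {st : GameState n m} (hst : Reachable I φ θ st)
    {R : (Finset (Fin m) → ℝ) → Finset (Fin m) → ℕ → Finset (Fin m) → (Fin m → ℝ) → Prop}
    (hR : IsAgentInvariant φ R) (k : Fin n) (hk : 0 < θ k) :
    R (fun S => I.value k S / θ k) (held st.owner k) (st.flag k) (free n st.owner)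
      fun j => st.pay j / I.entitlement k := by
  have hg := (hI.value_submodular k).div_const hk
  have hb := hI.entitlement_pos k
  induction hst with
  | init =>
    have h1 : held (fun _ : Fin m => n) k = ∅ := held_const k
    have h2 : free n (fun _ : Fin m => n) = Finset.univ := by simp [free]
    simpa [h1, h2] using hR.init _ hg
  | @step st i j hst hj hi hmax ih =>
    have hm : ∀ l, marginal (fun S => I.value k S / θ k) (held st.owner k) l =
        I.relMarginal θ st.owner k l := fun l => by
      simp [marginal, Instance.relMarginal, sub_div]
    have hjk : j ∉ held st.owner k := by rw [mem_held]; have := k.2; omega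
    have hp : ∀ q, (fun l => Function.update st.pay j q l / I.entitlement k) =
        Function.update (fun l => st.pay l / I.entitlement k) j (q / I.entitlement k) := by
      intro q; funext l; by_cases h : l = j <;> simp [h]
    simp only [Instance.award, hp, free_update]
    by_cases hik : k = i
    · subst hik
      rw [held_update_self]
      have := hR.own _ _ _ _ _ j hg ih ((div_lt_one hk).2 hi) (mem_free.2 hj) hjk (fun l hl => by
        have h := hmax k l (mem_free.1 hl) hi
        rw [hm, hm]
        exact le_of_mul_le_mul_left h hb)
      rw [hm] at this
      rw [Instance.bid, mul_div_cancel_left₀ _ hb.ne']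
      convert this using 1
      split_ifs <;> simp
    · rw [held_update_of_ne hj hik]
      have := hR.other _ _ _ _ _ j (I.bid φ θ st.owner st.flag i j / I.entitlement k) hg ih
        (mem_free.2 hj) hjk (fun h l hl => by
          rw [hm, le_div_iff₀ hb, mul_comm]
          exact hmax k l (mem_free.1 hl) ((div_lt_one hk).1 h))
      convert this using 1
      split_ifs <;> simp [hik]

theorem Reachable.pay_nonneg {I : Instance n m} (hI : I.IsSubmodular) {φ : ℕ → ℝ → ℝ}
    (hφ : ∀ f r, 0 ≤ r → 0 ≤ φ f r) {θ : Fin n → ℝ} {st : GameState n m}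
    (hst : Reachable I φ θ st) (j : Fin m) : 0 ≤ st.pay j := by
  induction hst generalizing j with
  | init => exact le_rfl
  | @step st i l hst hl hi hmax ih =>
    by_cases h : j = l
    · subst h
      simp only [Instance.award, Function.update_self]
      refine mul_nonneg (hI.entitlement_pos i).le (hφ _ _ (div_nonneg ?_ ?_))
      · exact (hI.value_submodular i).marginal_nonneg _ _
      · exact ((hI.value_submodular i).nonneg _).trans hi.le
    · simpa [Instance.award, h] using ih j

/-- Values are nonnegative, so such an agent counts as satisfied from the start and never bids. This
covers targets that have been set to 0, where dividing by the target would be meaningless. -/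
theorem Reachable.held_eq_empty {I : Instance n m} (hI : I.IsSubmodular) {φ : ℕ → ℝ → ℝ}
    {θ : Fin n → ℝ} {st : GameState n m} (hst : Reachable I φ θ st) {k : Fin n} (hk : θ k ≤ 0) :
    held st.owner k = ∅ := by
  induction hst with
  | init => exact held_const k
  | @step st i l hst hl hi hmax ih =>
    have : k ≠ i := by
      rintro rfl
      have := (hI.value_submodular k).nonneg (held st.owner k)
      linarith
    simp only [Instance.award]
    rw [held_update_of_ne hl this, ih]

/-- When all items are allocated, a sum over the items that agent `i` does not hold is
a sum over the items of the other agents. -/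
theorem sum_compl_held {o : Fin m → ℕ} (ho : ∀ j, o j < n) (i : Fin n) (p : Fin m → ℝ) :
    ∑ j ∈ (held o i)ᶜ, p j = ∑ k ∈ Finset.univ.erase i, ∑ j ∈ held o k, p j := by
  have h : ∑ j, p j = ∑ k : Fin n, ∑ j ∈ held o k, p j := by
    rw [← Finset.sum_fiberwise (s := Finset.univ) (g := fun j => (⟨o j, ho j⟩ : Fin n))]
    refine Finset.sum_congr rfl fun k _ => Finset.sum_congr ?_ fun _ _ => rfl
    ext j; simp [held, Fin.ext_iff]
  rw [← Finset.sum_add_sum_compl (held o i), ← Finset.add_sum_erase _ _ (Finset.mem_univ i)] at h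
  linarith

/-! ### The bids for the AnyPrice share -/

/-- The bids for the AnyPrice share. -/
noncomputable def apsBid (_ : ℕ) (r : ℝ) : ℝ := if 1 ≤ r then 1 else 1 / 2 * r

/-- The invariant of the view of a single agent, for the bids for the AnyPrice share. -/
structure ApsInvariant (g : Finset (Fin m) → ℝ) (T : Finset (Fin m)) (f : ℕ)
    (F : Finset (Fin m)) (p : Fin m → ℝ) : Prop where
  sum_le_one : ∑ j ∈ T, p j ≤ 1
  sum_le : g T < 1 → ∑ j ∈ T, p j ≤ g T / 2
  lt_one : g T < 1 → T = ∅ ∨ ∀ j ∈ F, marginal g T j < 1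
  lost : g T < 1 → ∀ j ∉ T, j ∉ F → 1 ≤ p j ∨ 1 / 2 * marginal g T j ≤ p j

/-- An item of relative marginal at least 1 outbids all her other items. It can therefore only be
her first win, it costs 1 and it satisfies her. Otherwise she has spent less than `1 / 2` before her
last win, which costs less than `1 / 2`. Lost items keep their bound because marginals decrease. -/
theorem isAgentInvariant_aps : IsAgentInvariant apsBid (ApsInvariant (m := m)) where
  init g hg := ⟨by simp, by simp [hg.normalized], fun _ => .inl rfl, by simp⟩
  own g T f F p j hg h h1 hj hjT hmax := by
    have hsum : ∑ l ∈ insert j T, Function.update p j (apsBid f (marginal g T j)) l =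
        apsBid f (marginal g T j) + ∑ l ∈ T, p l := by
      rw [Finset.sum_insert hjT, Finset.sum_update_of_notMem hjT, Function.update_self]
    have hval : g (insert j T) = g T + marginal g T j := by simp [marginal]
    have hT := hg.nonneg T
    have hu := hg.marginal_nonneg T j
    have hs := h.sum_le h1
    by_cases hbig : 1 ≤ marginal g T j
    · have hT0 : T = ∅ := (h.lt_one h1).resolve_right fun h' => (h' j hj).not_ge hbig
      have hns : ¬ g (insert j T) < 1 := by linarith
      refine ⟨?_, fun h' => absurd h' hns, fun h' => absurd h' hns, fun h' => absurd h' hns⟩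
      rw [hsum, apsBid, if_pos hbig, hT0]; simp
    · have hb : apsBid f (marginal g T j) = 1 / 2 * marginal g T j := if_neg hbig
      push Not at hbig
      refine ⟨by rw [hsum, hb]; linarith, fun _ => by rw [hsum, hb, hval]; linarith,
        fun _ => .inr fun k hk => ?_, fun hlt k hk hkF => ?_⟩
      · refine (hg.marginal_anti (Finset.subset_insert j T) k).trans_lt ?_
        by_contra! hk'
        have := hmax k (Finset.mem_of_mem_erase hk)
        rw [hb, apsBid, if_pos hk'] at this
        linarith
      · have hkj : k ≠ j := fun e => hk (e ▸ Finset.mem_insert_self j T)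
        have h3 := h.lost h1 k (fun e => hk (Finset.mem_insert_of_mem e))
          (fun e => hkF (Finset.mem_erase.2 ⟨hkj, e⟩))
        have h4 := hg.marginal_anti (Finset.subset_insert j T) k
        rw [Function.update_of_ne hkj]
        exact h3.imp_right fun h3 => by linarith
  other g T f F p j q hg h hj hjT hq := by
    have hsum : ∑ l ∈ T, Function.update p j q l = ∑ l ∈ T, p l :=
      Finset.sum_update_of_notMem hjT _ _
    refine ⟨by rw [hsum]; exact h.sum_le_one, by rw [hsum]; exact h.sum_le, fun h1 =>
      (h.lt_one h1).imp_right fun h' k hk => h' k (Finset.mem_of_mem_erase hk), fun h1 k hk hkF => ?_⟩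
    by_cases hkj : k = j
    · subst hkj
      have := hq h1 k hj
      rw [apsBid] at this
      rw [Function.update_self]
      split_ifs at this
      · exact .inl this
      · exact .inr this
    · rw [Function.update_of_ne hkj]
      exact h.lost h1 k hk fun e => hkF (Finset.mem_erase.2 ⟨hkj, e⟩)

/-! ### The AnyPrice share -/

section AnyPriceShare

variable {b : ℝ} {v : Finset (Fin m) → ℝ}

/-- A single price vector suffices for an upper bound. The empty bundle is affordable since `b ≥ 0`,
which keeps the inner suprema over nonempty sets. -/
theorem anyPriceShare_le (hv : IsSubmodularValuation v) (hb : 0 ≤ b) {c : ℝ} (p : Fin m → ℝ)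
    (hp : p ∈ stdSimplex ℝ (Fin m)) (h : ∀ S : Finset (Fin m), ∑ j ∈ S, p j ≤ b → v S ≤ c) :
    anyPriceShare b v ≤ c := by
  have hne : ∀ p : stdSimplex ℝ (Fin m), Nonempty {S : Finset (Fin m) // ∑ j ∈ S, p.1 j ≤ b} :=
    fun p => ⟨⟨∅, by simpa using hb⟩⟩
  refine (ciInf_le ⟨0, ?_⟩ ⟨p, hp⟩).trans ?_
  · rintro _ ⟨p, rfl⟩
    have := hne p
    refine le_ciSup_of_le (Set.finite_range _).bddAbove ⟨∅, by simpa using hb⟩ ?_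
    exact hv.nonneg _
  · have := hne ⟨p, hp⟩
    exact ciSup_le fun S => h S.1 S.2

/-- There are finitely many bundles, so the extrema are attained. Without items the simplex is empty
and the infimum takes its default value 0. The dichotomy is what later justifies replacing a tiny
target by 0. -/
theorem anyPriceShare_eq (hb : 0 ≤ b) :
    anyPriceShare b v = 0 ∨ ∃ S, anyPriceShare b v = v S := by
  rcases isEmpty_or_nonempty (stdSimplex ℝ (Fin m)) with h | h
  · left; simp [anyPriceShare]
  · right
    have hmax : ∀ p : stdSimplex ℝ (Fin m),
        ∃ S, (⨆ S : {S : Finset (Fin m) // ∑ j ∈ S, p.1 j ≤ b}, v S.1) = v S := by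
      intro p
      have : Nonempty {S : Finset (Fin m) // ∑ j ∈ S, p.1 j ≤ b} := ⟨⟨∅, by simpa using hb⟩⟩
      obtain ⟨S, hS⟩ := exists_eq_ciSup_of_finite
        (f := fun S : {S : Finset (Fin m) // ∑ j ∈ S, p.1 j ≤ b} => v S.1)
      exact ⟨S.1, hS.symm⟩
    have hfin : (Set.range fun p : stdSimplex ℝ (Fin m) =>
        ⨆ S : {S : Finset (Fin m) // ∑ j ∈ S, p.1 j ≤ b}, v S.1).Finite := by
      refine (Set.finite_range v).subset ?_
      rintro _ ⟨p, rfl⟩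
      obtain ⟨S, hS⟩ := hmax p
      exact ⟨S, hS.symm⟩
    obtain ⟨p, hp⟩ := (Set.range_nonempty _).csInf_mem hfin
    obtain ⟨S, hS⟩ := hmax p
    exact ⟨S, hp.symm.trans hS⟩

theorem uniform_mem_stdSimplex (hm : 0 < m) :
    (fun _ : Fin m => 1 / (m : ℝ)) ∈ stdSimplex ℝ (Fin m) := by
  refine ⟨fun _ => by positivity, ?_⟩
  simp; field_simp

theorem anyPriceShare_le_univ (hv : IsSubmodularValuation v) (hb : 0 ≤ b) :
    anyPriceShare b v ≤ v Finset.univ := by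
  rcases anyPriceShare_eq (v := v) hb with h | ⟨S, hS⟩
  · rw [h]; exact hv.nonneg _
  · rw [hS]; exact hv.monotone (Finset.subset_univ S)

end AnyPriceShare

/-- An agent who misses her target, with the bids for the AnyPrice share, has an AnyPrice share of at
most three times the target, and less. -/
theorem anyPriceShare_le_of_lt {I : Instance n m} (hI : I.IsSubmodular) {θ : Fin n → ℝ}
    {st : GameState n m} (hst : Reachable I apsBid θ st) (hall : ∀ j, st.owner j < n) {i : Fin n}
    (hi : I.value i (held st.owner i) < θ i) {ε : ℝ} (hε : ε ≤ 1 / 2) (hεm : m * ε ≤ 1 / 2) :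
    anyPriceShare (I.entitlement i) (I.value i) ≤ 3 * (θ i * (1 - ε)) := by
  have hb := hI.entitlement_pos i
  have hv := hI.value_submodular i
  have hθ : 0 < θ i := (hv.nonneg _).trans_lt hi
  rcases Nat.eq_zero_or_pos m with hm | hm
  · subst hm
    have : anyPriceShare (I.entitlement i) (I.value i) ≤ 0 := by
      refine (anyPriceShare_le_univ hv hb.le).trans ?_
      rw [Finset.univ_eq_empty, hv.normalized]
    nlinarith
  have hm' : (0 : ℝ) < m := by exact_mod_cast hm
  -- At uniform prices such an agent can afford no item. Otherwise `ε` is at most half of her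
  -- entitlement.
  by_cases hbm : I.entitlement i < 1 / m
  · refine (anyPriceShare_le hv hb.le _ (uniform_mem_stdSimplex hm) (c := 0) fun S hS => ?_).trans
      (by nlinarith)
    rcases S.eq_empty_or_nonempty with rfl | hne
    · exact hv.normalized.le
    · have h1 : (1 : ℝ) ≤ S.card := by exact_mod_cast hne.card_pos
      have h2 : 0 < 1 / (m : ℝ) := by positivity
      rw [Finset.sum_const, nsmul_eq_mul] at hS
      nlinarith
  push Not at hbm
  have hbε : ε ≤ I.entitlement i / 2 := by
    have : ε ≤ 1 / m / 2 := by rw [div_div, le_div_iff₀ (by positivity)]; linarith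
    linarith
  -- the payments of the other agents
  set T := held st.owner i with hT
  set W : ℝ := ∑ j ∈ Tᶜ, st.pay j with hW
  have hpay := hst.pay_nonneg hI (fun f r hr => by unfold apsBid; split_ifs <;> linarith)
  have hW0 : 0 ≤ W := Finset.sum_nonneg fun j _ => hpay j
  have hW1 : W ≤ 1 - I.entitlement i := by
    rw [hW, hT, sum_compl_held hall, ← hI.sum_entitlement,
      ← Finset.add_sum_erase _ _ (Finset.mem_univ i), add_sub_cancel_left]
    refine Finset.sum_le_sum fun k _ => ?_
    have hbk := hI.entitlement_pos k
    rcases le_or_gt (θ k) 0 with h | h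
    · rw [hst.held_eq_empty hI h]; simpa using hbk.le
    · have := (isAgentInvariant_aps.of_reachable hI hst k h).sum_le_one
      rw [← Finset.sum_div, div_le_one hbk] at this
      exact this
  have hg := hv.div_const hθ
  have hinv := isAgentInvariant_aps.of_reachable hI hst i hθ
  have hT1 : I.value i T / θ i < 1 := (div_lt_one hθ).2 hi
  -- a bundle of small payment has small value
  have key : ∀ S : Finset (Fin m), ∑ j ∈ S \ T, st.pay j ≤ I.entitlement i * W →
      I.value i S ≤ 3 * (θ i * (1 - ε)) := by
    intro S hS
    have h1 : ∀ j ∈ S \ T, 1 / 2 * marginal (fun S => I.value i S / θ i) T j ≤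
        st.pay j / I.entitlement i := by
      intro j hj
      -- An item paid at least the full entitlement would by itself exceed the budget `I.entitlement
      -- i * W`, as `W < 1`.
      refine (hinv.lost hT1 j (Finset.mem_sdiff.1 hj).2 ?_).resolve_left ?_
      · rw [mem_free, not_le]; exact hall j
      · rw [le_div_iff₀ hb, one_mul, not_le]
        have := Finset.single_le_sum (fun j _ => hpay j) hj
        nlinarith
    have h2 := Finset.sum_le_sum h1
    rw [← Finset.mul_sum, ← Finset.sum_div] at h2
    have h3 : (∑ j ∈ S \ T, st.pay j) / I.entitlement i ≤ W := by
      rw [div_le_iff₀ hb]; linarith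
    have h4 := hg.le_add_sum_marginal S T
    -- The bound is `1 + 2 * W ≤ 3 - 2 * I.entitlement i`, and `3 * ε ≤ 2 * I.entitlement i`.
    have h5 : I.value i S / θ i ≤ 3 * (1 - ε) := by linarith
    rw [div_le_iff₀ hθ] at h5
    linarith
  -- If the others paid nothing, payments cannot be normalised to prices, but then even the set of
  -- all items meets the bound.
  rcases hW0.eq_or_lt with hW00 | hWpos
  · refine (anyPriceShare_le_univ hv hb.le).trans (key _ ?_)
    rw [← hW00, mul_zero]
    refine le_of_eq_of_le ?_ hW00.ge
    rw [hW, Finset.compl_eq_univ_sdiff]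
  · refine anyPriceShare_le hv hb.le (fun j => if j ∈ T then 0 else st.pay j / W) ⟨fun j => ?_, ?_⟩
      fun S hS => key S ?_
    · dsimp only; split_ifs; exacts [le_rfl, div_nonneg (hpay j) hW0]
    · rw [← Finset.sum_add_sum_compl T, Finset.sum_ite_of_true (fun _ h => h),
        Finset.sum_ite_of_false (fun _ h => Finset.mem_compl.1 h), ← Finset.sum_div, ← hW]
      simp [hWpos.ne']
    · rw [Finset.sum_ite, Finset.sum_const_zero, zero_add, ← Finset.sdiff_eq_filter, ← Finset.sum_div,
        div_le_iff₀ hWpos] at hS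
      exact hS

/-! ### The bids for the maximin share -/

/-- The bids for the maximin share. -/
noncomputable def mmsBid (f : ℕ) (r : ℝ) : ℝ :=
  -- The constants fit together: `2 / 3 * (7 / 10) = 7 / 15` is where `roundHalf` starts, `8 / 15 +
  -- 7 / 15 = 1` pays for two step bids, and `7 / 9 * (3 / 10 + 3 / 10) = 7 / 15`. The step `8 / 15`
  -- also equals `1 - 2 / 3 * (7 / 10)`, which is exactly what the count over a partition requires.
  if f = 0 then if 1 ≤ r then 1 else if 7 / 10 ≤ r then 8 / 15 else 2 / 3 * r
  else if 3 / 10 ≤ r then 7 / 15 else 7 / 9 * r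

/-- Payments from `7 / 15` up to `1` are counted as `1 / 2`. -/
noncomputable def roundHalf (x : ℝ) : ℝ := if 7 / 15 ≤ x ∧ x < 1 then 1 / 2 else x

theorem mmsBid_nonneg (f : ℕ) (r : ℝ) (hr : 0 ≤ r) : 0 ≤ mmsBid f r := by
  unfold mmsBid; split_ifs <;> linarith

theorem mmsBid_mono (f : ℕ) {r r' : ℝ} (h : r ≤ r') : mmsBid f r ≤ mmsBid f r' := by
  unfold mmsBid; split_ifs <;> linarith

/-- The invariant of the view of a single agent, for the bids for the maximin share. -/
structure MmsInvariant (g : Finset (Fin m) → ℝ) (T : Finset (Fin m)) (f : ℕ)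
    (F : Finset (Fin m)) (p : Fin m → ℝ) : Prop where
  sum_le_one : ∑ j ∈ T, p j ≤ 1
  sum_round_le_one : ∑ j ∈ T, roundHalf (p j) ≤ 1
  sum_le : g T < 1 → f = 0 → ∑ j ∈ T, p j ≤ 2 / 3 * g T ∧ ∑ j ∈ T, roundHalf (p j) ≤ 2 / 3 * g T
  small : g T < 1 → f = 0 → T = ∅ ∨ ∀ j ∈ F,
    marginal g T j ≤ g T ∧ g T + marginal g T j ≤ 3 / 2 ∧ marginal g T j < 7 / 10
  sum_le' : g T < 1 → f ≠ 0 → 7 / 10 ≤ g T ∧ ∑ j ∈ T, p j ≤ 8 / 15 + 7 / 9 * (g T - 7 / 10) ∧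
    ∑ j ∈ T, roundHalf (p j) ≤ 1 / 2 + 7 / 9 * (g T - 7 / 10)
  small' : g T < 1 → f ≠ 0 → (∀ j ∈ F, marginal g T j < 1) ∧
    ((∑ j ∈ T, p j ≤ 8 / 15 ∧ ∑ j ∈ T, roundHalf (p j) ≤ 1 / 2) ∨ ∀ j ∈ F, marginal g T j < 3 / 10)
  bid_le : g T < 1 → ∀ j ∉ T, j ∉ F → ∀ k ∈ F, mmsBid f (marginal g T k) ≤ p j
  lost : g T < 1 → f = 0 → ∀ j ∉ T, j ∉ F → 1 ≤ p j ∨ (8 / 15 ≤ p j ∧ marginal g T j < 1) ∨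
    (2 / 3 * marginal g T j ≤ p j ∧ marginal g T j < 7 / 10)
  lost' : g T < 1 → f ≠ 0 → ∀ j ∉ T, j ∉ F → 1 ≤ p j ∨ (7 / 15 ≤ p j ∧ marginal g T j < 1) ∨
    (7 / 9 * marginal g T j ≤ p j ∧ marginal g T j < 3 / 10)

/-- The winner chose her highest bid, so her remaining marginals are controlled by `u`, except on
the steps of the bid function. The flag can be raised while she stays unsatisfied only by her first
item; from then on her bids are lower, but all items lost earlier cost at least the bid just made.
-/
theorem mmsInvariant_own {g : Finset (Fin m) → ℝ} {T : Finset (Fin m)} {f : ℕ}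
    {F : Finset (Fin m)} {p : Fin m → ℝ} {j : Fin m} (hg : IsSubmodularValuation g)
    (h : MmsInvariant g T f F p) (h1 : g T < 1) (hj : j ∈ F) (hjT : j ∉ T)
    (hmax : ∀ k ∈ F, mmsBid f (marginal g T k) ≤ mmsBid f (marginal g T j)) :
    MmsInvariant g (insert j T) (if 7 / 10 ≤ marginal g T j then 1 else f) (F.erase j)
      (Function.update p j (mmsBid f (marginal g T j))) := by
  set u := marginal g T j with hu
  have hsum : ∑ l ∈ insert j T, Function.update p j (mmsBid f u) l =
      mmsBid f u + ∑ l ∈ T, p l := by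
    rw [Finset.sum_insert hjT, Finset.sum_update_of_notMem hjT, Function.update_self]
  have hsum' : ∑ l ∈ insert j T, roundHalf (Function.update p j (mmsBid f u) l) =
      roundHalf (mmsBid f u) + ∑ l ∈ T, roundHalf (p l) := by
    rw [Finset.sum_insert hjT, Function.update_self]
    congr 1
    refine Finset.sum_congr rfl fun l hl => ?_
    rw [Function.update_of_ne (ne_of_mem_of_not_mem hl hjT)]
  have hval : g (insert j T) = g T + u := by simp [hu, marginal]
  have hT := hg.nonneg T
  have hu0 : 0 ≤ u := hg.marginal_nonneg T j
  have hanti : ∀ k, marginal g (insert j T) k ≤ marginal g T k :=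
    hg.marginal_anti (Finset.subset_insert j T)
  have hold : ∀ k, k ∉ insert j T → k ∉ F.erase j → k ≠ j ∧ k ∉ T ∧ k ∉ F := fun k hk hkF => by
    have hkj : k ≠ j := fun e => hk (e ▸ Finset.mem_insert_self j T)
    exact ⟨hkj, fun e => hk (Finset.mem_insert_of_mem e), fun e => hkF (Finset.mem_erase.2 ⟨hkj, e⟩)⟩
  have hs0 := h.sum_le h1
  have hs1 := h.sum_le' h1
  have hF0 := h.small h1
  have hF1 := h.small' h1
  have hjF1 := fun hf => (hF1 hf).1 j hj
  have hjF2 := fun hf => (hF1 hf).2.imp_right fun h => h j hj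
  have hjF0 := fun hf => (hF0 hf).imp_right fun h => h j hj
  have hTe : T = ∅ → g T = 0 ∧ ∑ j ∈ T, p j = 0 ∧ ∑ j ∈ T, roundHalf (p j) = 0 := by
    rintro rfl; simp [hg.normalized]
  -- Off the steps of `mmsBid`, a bid no larger than the winning one comes from a marginal no larger
  -- than `u`.
  have hmono : ∀ k ∈ F, marginal g T k ≤ u ∨ 7 / 10 ≤ u ∨ (f ≠ 0 ∧ 3 / 10 ≤ u) := by
    intro k hk
    have := hmax k hk
    by_contra! hc
    unfold mmsBid at this
    split_ifs at this <;> first | linarith | (have := hc.2.2 ‹_›; linarith)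
  refine ⟨?_, ?_, ?_, ?_, ?_, ?_, ?_, ?_, ?_⟩
  · rw [hsum]
    by_cases hf : f = 0
    · rcases hjF0 hf with he | hh
      -- A first item costs at most 1, whatever its value. For a later one `u < 7 / 10`, and the
      -- total is at most `2 / 3 * (3 / 2)`.
      · obtain ⟨e1, e2, e3⟩ := hTe he
        rw [e2]; unfold mmsBid; split_ifs <;> linarith
      · have := hs0 hf
        unfold mmsBid; split_ifs <;> linarith
    · have := hs1 hf
      unfold mmsBid
      rw [if_neg hf]
      -- A step bid adds `7 / 15` to at most `8 / 15`. Otherwise `g T < 1` and `u < 3 / 10` bound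
      -- everything beyond `8 / 15` by `7 / 9 * (3 / 10 + 3 / 10) = 7 / 15`.
      rcases hjF2 hf with hh | hh <;> split_ifs <;> linarith
  · rw [hsum']
    generalize ∑ l ∈ T, roundHalf (p l) = R at *
    by_cases hf : f = 0
    · rcases hjF0 hf with he | hh
      · obtain ⟨e1, e2, e3⟩ := hTe he
        rw [e3]; unfold mmsBid roundHalf; split_ifs <;> linarith
      · have := hs0 hf
        unfold mmsBid roundHalf; split_ifs <;> linarith
    · have := hs1 hf
      unfold mmsBid roundHalf
      rw [if_neg hf]
      rcases hjF2 hf with hh | hh <;> split_ifs <;> linarith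
  · intro hlt hf
    rw [hval] at hlt
    split_ifs at hf with h7
    · have := hs0 hf
      rw [hsum, hsum', hval]
      have e1 : mmsBid f u = 2 / 3 * u := by
        unfold mmsBid; rw [if_pos hf, if_neg (by linarith), if_neg h7]
      -- Below `7 / 10` the linear bid stays below `7 / 15`, so rounding does not touch it.
      have e2 : roundHalf (2 / 3 * u) = 2 / 3 * u := by
        unfold roundHalf; rw [if_neg (by push Not at h7; intro h; linarith)]
      rw [e1, e2]
      constructor <;> linarith
  · intro hlt hf
    rw [hval] at hlt
    split_ifs at hf with h7
    right
    intro k hk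
    have hk' := Finset.mem_of_mem_erase hk
    have h2 := hanti k
    have h3 := (hmono k hk').resolve_right (by rintro (h | h); exacts [h7 h, h.1 hf])
    push Not at h7
    rw [hval]
    -- After a first item both summands are below `7 / 10`. Later, `u ≤ g T` and `g T + u < 1` give
    -- `u < 1 / 2`, so one more item of marginal at most `u` keeps the total below `3 / 2`.
    rcases hjF0 hf with he | hh
    · obtain ⟨e1, -, -⟩ := hTe he
      refine ⟨?_, ?_, ?_⟩ <;> linarith
    · refine ⟨?_, ?_, ?_⟩ <;> linarith
  · intro hlt hf
    rw [hval] at hlt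
    rw [hsum, hsum', hval]
    by_cases hf0 : f = 0
    · have h7 : 7 / 10 ≤ u := by
        by_contra hc; rw [if_neg hc] at hf; exact hf hf0
      -- A nonempty bundle without flag leaves only marginals below `7 / 10`, so the flag is raised
      -- by a first item.
      rcases hjF0 hf0 with he | hh
      · obtain ⟨e1, e2, e3⟩ := hTe he
        have e4 : mmsBid f u = 8 / 15 := by
          unfold mmsBid; rw [if_pos hf0, if_neg (by linarith), if_pos h7]
        have e5 : roundHalf (8 / 15) = 1 / 2 := by unfold roundHalf; norm_num
        rw [e4, e5, e1, e2, e3]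
        refine ⟨?_, ?_, ?_⟩ <;> linarith
      · linarith
    -- With `g T ≥ 7 / 10` already, staying below 1 forces `u < 3 / 10`, so the bid was linear.
    · have := hs1 hf0
      have e4 : mmsBid f u = 7 / 9 * u := by
        unfold mmsBid; rw [if_neg hf0, if_neg (by linarith)]
      have e5 : roundHalf (7 / 9 * u) = 7 / 9 * u := by
        unfold roundHalf; rw [if_neg (by rintro ⟨h, -⟩; linarith)]
      rw [e4, e5]
      refine ⟨?_, ?_, ?_⟩ <;> linarith
  · intro hlt hf
    rw [hval] at hlt
    by_cases hf0 : f = 0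
    · have h7 : 7 / 10 ≤ u := by
        by_contra hc; rw [if_neg hc] at hf; exact hf hf0
      have e4 : mmsBid f u = 8 / 15 := by
        unfold mmsBid; rw [if_pos hf0, if_neg (by linarith), if_pos h7]
      have e5 : roundHalf (8 / 15) = 1 / 2 := by unfold roundHalf; norm_num
      refine ⟨fun k hk => (hanti k).trans_lt ?_, .inl ?_⟩
      · have := hmax k (Finset.mem_of_mem_erase hk)
        rw [e4] at this
        by_contra! hc
        unfold mmsBid at this
        rw [if_pos hf0, if_pos hc] at this
        linarith
      · rcases hjF0 hf0 with he | hh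
        · obtain ⟨e1, e2, e3⟩ := hTe he
          rw [hsum, hsum', e4, e5, e2, e3]
          constructor <;> linarith
        · linarith
    · have hh := hs1 hf0
      refine ⟨fun k hk => (hanti k).trans_lt ((hF1 hf0).1 k (Finset.mem_of_mem_erase hk)),
        .inr fun k hk => (hanti k).trans_lt ?_⟩
      have h3 := (hmono k (Finset.mem_of_mem_erase hk)).resolve_right
        (by rintro (h | h); exacts [by linarith, by linarith [h.2]])
      linarith
  · intro hlt l hl hlF k hk
    obtain ⟨a1, a2, a3⟩ := hold l hl hlF
    rw [hval] at hlt
    rw [Function.update_of_ne a1]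
    refine le_trans ?_ (h.bid_le h1 l a2 a3 j hj)
    have hk' := Finset.mem_of_mem_erase hk
    -- Raising the flag does not break the bound: the new bids are at most `7 / 15`, below the `8 /
    -- 15` just offered for `j`.
    by_cases hc : 7 / 10 ≤ u ∧ f = 0
    · rw [if_pos hc.1]
      have e4 : mmsBid f u = 8 / 15 := by
        unfold mmsBid; rw [if_pos hc.2, if_neg (by linarith), if_pos hc.1]
      rw [← hu, e4]
      unfold mmsBid
      rw [if_neg one_ne_zero]
      split_ifs <;> linarith
    · refine le_trans ?_ (hmax k hk')
      split_ifs with h7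
      · have hf : f ≠ 0 := fun e => hc ⟨h7, e⟩
        refine le_trans (mmsBid_mono 1 (hanti k)) (le_of_eq ?_)
        unfold mmsBid
        rw [if_neg one_ne_zero, if_neg hf]
      · exact mmsBid_mono f (hanti k)
  · intro hlt hf l hl hlF
    obtain ⟨a1, a2, a3⟩ := hold l hl hlF
    rw [Function.update_of_ne a1]
    split_ifs at hf with h7
    have h4 := hanti l
    rcases h.lost h1 hf l a2 a3 with h | h | h
    · exact .inl h
    · exact .inr (.inl ⟨h.1, by linarith⟩)
    · exact .inr (.inr ⟨by linarith, by linarith⟩)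
  · intro hlt hf l hl hlF
    obtain ⟨a1, a2, a3⟩ := hold l hl hlF
    rw [hval] at hlt
    rw [Function.update_of_ne a1]
    have h4 := hanti l
    by_cases hf0 : f = 0
    · have h7 : 7 / 10 ≤ u := by
        by_contra hc; rw [if_neg hc] at hf; exact hf hf0
      have e4 : mmsBid f u = 8 / 15 := by
        unfold mmsBid; rw [if_pos hf0, if_neg (by linarith), if_pos h7]
      -- All earlier losses were paid at least her current best bid `8 / 15`, which is enough for
      -- the step `7 / 15` of the raised flag.
      have h5 := h.bid_le h1 l a2 a3 j hj
      rw [← hu, e4] at h5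
      rcases h.lost h1 hf0 l a2 a3 with h | h | h
      · exact .inl h
      · exact .inr (.inl ⟨by linarith, by linarith⟩)
      · exact .inr (.inl ⟨by linarith, by linarith⟩)
    · rcases h.lost' h1 hf0 l a2 a3 with h | h | h
      · exact .inl h
      · exact .inr (.inl ⟨h.1, by linarith⟩)
      · exact .inr (.inr ⟨by linarith, by linarith⟩)

/-- When another agent wins, her own bundle is unchanged and the payment dominates her bid; the
three alternatives for a lost item mirror the pieces of `mmsBid`. -/
theorem isAgentInvariant_mms : IsAgentInvariant mmsBid (MmsInvariant (m := m)) where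
  init g hg := by constructor <;> simp [hg.normalized, roundHalf]
  own g T f F p j hg h h1 hj hjT hmax := mmsInvariant_own hg h h1 hj hjT hmax
  other g T f F p j q hg h hj hjT hq := by
    have hsum : ∑ l ∈ T, Function.update p j q l = ∑ l ∈ T, p l :=
      Finset.sum_update_of_notMem hjT _ _
    have hsum' : ∑ l ∈ T, roundHalf (Function.update p j q l) = ∑ l ∈ T, roundHalf (p l) := by
      refine Finset.sum_congr rfl fun l hl => ?_
      rw [Function.update_of_ne (ne_of_mem_of_not_mem hl hjT)]
    have hold : ∀ k, k ≠ j → k ∉ F.erase j → k ∉ F :=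
      fun k hkj hkF e => hkF (Finset.mem_erase.2 ⟨hkj, e⟩)
    refine ⟨by rw [hsum]; exact h.sum_le_one, by rw [hsum']; exact h.sum_round_le_one,
      by rw [hsum, hsum']; exact h.sum_le, fun h1 hf => (h.small h1 hf).imp_right fun h' k hk =>
        h' k (Finset.mem_of_mem_erase hk), by rw [hsum, hsum']; exact h.sum_le', fun h1 hf => ?_,
      fun h1 l hl hlF k hk => ?_, fun h1 hf l hl hlF => ?_, fun h1 hf l hl hlF => ?_⟩
    · rw [hsum, hsum']
      have := h.small' h1 hf
      exact ⟨fun k hk => this.1 k (Finset.mem_of_mem_erase hk),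
        this.2.imp_right fun h' k hk => h' k (Finset.mem_of_mem_erase hk)⟩
    · by_cases hlj : l = j
      · subst hlj
        rw [Function.update_self]
        exact hq h1 k (Finset.mem_of_mem_erase hk)
      · rw [Function.update_of_ne hlj]
        exact h.bid_le h1 l hl (hold l hlj hlF) k (Finset.mem_of_mem_erase hk)
    · by_cases hlj : l = j
      · subst hlj
        rw [Function.update_self]
        have := hq h1 l hj
        unfold mmsBid at this
        rw [if_pos hf] at this
        split_ifs at this with c1 c2
        · exact .inl this
        · exact .inr (.inl ⟨this, not_le.1 c1⟩)
        · exact .inr (.inr ⟨this, not_le.1 c2⟩)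
      · rw [Function.update_of_ne hlj]
        exact h.lost h1 hf l hl (hold l hlj hlF)
    · by_cases hlj : l = j
      · subst hlj
        rw [Function.update_self]
        have := hq h1 l hj
        unfold mmsBid at this
        rw [if_neg hf] at this
        split_ifs at this with c1
        · exact .inr (.inl ⟨this, (h.small' h1 hf).1 l hj⟩)
        · exact .inr (.inr ⟨this, not_le.1 c1⟩)
      · rw [Function.update_of_ne hlj]
        exact h.lost' h1 hf l hl (hold l hlj hlF)

/-! ### Payments for the bundles of a partition -/

/-- A sum over items each of which pays `1`, or pays `α` and has value less than `1`, or pays `β` times its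
value. -/
theorem le_sum_of_paid {D : Finset (Fin m)} {u p : Fin m → ℝ} {α β V c : ℝ}
    (hp : ∀ j ∈ D, 0 ≤ p j)
    (h : ∀ j ∈ D, 1 ≤ p j ∨ (α ≤ p j ∧ u j < 1) ∨ β * u j ≤ p j) (hβ : 0 ≤ β)
    (hV : V ≤ ∑ j ∈ D, u j) (hc : c ≤ 1) (h0 : c ≤ β * V) (h1 : c ≤ α + β * (V - 1))
    (h2 : c ≤ 2 * α) : c ≤ ∑ j ∈ D, p j := by
  -- One item paying 1 is enough, and so are two paying `α`. A single item paying `α` accounts for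
  -- value less than 1, leaving at least `V - 1` at rate `β`; with none, all of `V` is paid at rate
  -- `β`.
  by_cases hA : ∃ j ∈ D, 1 ≤ p j
  · obtain ⟨j, hj, hj1⟩ := hA
    exact hc.trans (hj1.trans (Finset.single_le_sum hp hj))
  by_cases hB : ∃ j ∈ D, α ≤ p j ∧ u j < 1
  · obtain ⟨j, hj, hj1, hj2⟩ := hB
    rw [← Finset.add_sum_erase _ _ hj] at hV ⊢
    by_cases hC : ∃ k ∈ D.erase j, α ≤ p k
    · obtain ⟨k, hk, hk1⟩ := hC
      have := Finset.single_le_sum (fun l hl => hp l (Finset.mem_of_mem_erase hl)) hk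
      linarith
    · have h3 : ∑ k ∈ D.erase j, β * u k ≤ ∑ k ∈ D.erase j, p k := by
        refine Finset.sum_le_sum fun k hk => ?_
        have hk' := Finset.mem_of_mem_erase hk
        rcases h k hk' with h | h | h
        · exact absurd ⟨k, hk', h⟩ hA
        · exact absurd ⟨k, hk, h.1⟩ hC
        · exact h
      rw [← Finset.mul_sum] at h3
      nlinarith
  · have h3 : ∑ k ∈ D, β * u k ≤ ∑ k ∈ D, p k := by
      refine Finset.sum_le_sum fun k hk => ?_
      rcases h k hk with h | h | h
      · exact absurd ⟨k, hk, h⟩ hA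
      · exact absurd ⟨k, hk, h⟩ hB
      · exact h
    rw [← Finset.mul_sum] at h3
    nlinarith

theorem roundHalf_nonneg {x : ℝ} (hx : 0 ≤ x) : 0 ≤ roundHalf x := by
  unfold roundHalf; split_ifs <;> linarith

/-- The payments of the other agents do not cover the bundles of a partition all of which have value
nearly `27 / 10`. -/
theorem not_forall_le_sum {o : Fin m → ℕ} (ho : ∀ j, o j < n) (i : Fin n) {p : Fin m → ℝ}
    (hp : ∀ k : Fin n, ∑ j ∈ held o k, p j ≤ 1) (A : Fin m → Fin n) {c : ℝ} (hc : (n : ℝ) - 1 < n * c)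
    (h : ∀ k, c ≤ ∑ j ∈ bundle A k \ held o i, p j) : False := by
  -- The bundles of the partition, with the items of `i` removed, split exactly the items of the
  -- other agents.
  have h1 : ∑ k : Fin n, ∑ j ∈ bundle A k \ held o i, p j = ∑ j ∈ (held o i)ᶜ, p j := by
    rw [← Finset.sum_fiberwise (s := (held o i)ᶜ) (g := A)]
    refine Finset.sum_congr rfl fun k _ => Finset.sum_congr ?_ fun _ _ => rfl
    ext j; simp [bundle, and_comm]
  have h2 : ∑ k ∈ Finset.univ.erase i, ∑ j ∈ held o k, p j ≤ n - 1 := by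
    refine (Finset.sum_le_sum fun k _ => hp k).trans ?_
    have hn : 1 ≤ n := by have := i.2; omega
    simp [Finset.card_erase_of_mem, Nat.cast_sub hn]
  have h3 : (n : ℝ) * c ≤ ∑ k : Fin n, ∑ j ∈ bundle A k \ held o i, p j := by
    refine le_trans (by simp) (Finset.sum_le_sum fun k (_ : k ∈ Finset.univ) => h k)
  rw [h1, sum_compl_held ho] at h3
  linarith

theorem exists_maximinShare_le (hn : 0 < n) (v : Finset (Fin m) → ℝ) :
    ∃ A : Fin m → Fin n, maximinShare n v = ⨅ k : Fin n, v (bundle A k) := by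
  have : Nonempty (Fin m → Fin n) := ⟨fun _ => ⟨0, hn⟩⟩
  obtain ⟨A, hA⟩ := exists_eq_ciSup_of_finite
    (f := fun A : Fin m → Fin n => ⨅ k : Fin n, v (bundle A k))
  exact ⟨A, hA.symm⟩

theorem maximinShare_eq (hn : 0 < n) (v : Finset (Fin m) → ℝ) :
    ∃ S, maximinShare n v = v S := by
  obtain ⟨A, hA⟩ := exists_maximinShare_le hn v
  have : Nonempty (Fin n) := ⟨⟨0, hn⟩⟩
  obtain ⟨k, hk⟩ := exists_eq_ciInf_of_finite (f := fun k : Fin n => v (bundle A k))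
  exact ⟨_, hA.trans hk.symm⟩

/-- An agent who misses her target, with the bids for the maximin share, has a maximin share of at
most `27 / 10` times the target, and less. -/
theorem maximinShare_le_of_lt {I : Instance n m} (hI : I.IsSubmodular) (heq : I.EqualEntitlements)
    {θ : Fin n → ℝ} {st : GameState n m} (hst : Reachable I mmsBid θ st)
    (hall : ∀ j, st.owner j < n) {i : Fin n} (hi : I.value i (held st.owner i) < θ i) {ε : ℝ}
    (hε : ε ≤ 1 / 8) (hεn : n * ε < 1 / 2) (hε0 : 0 ≤ ε) :
    maximinShare n (I.value i) ≤ 27 / 10 * (θ i * (1 - ε)) := by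
  have hn : 0 < n := i.pos
  have hv := hI.value_submodular i
  have hθ : 0 < θ i := (hv.nonneg _).trans_lt hi
  have hg := hv.div_const hθ
  have hb : ∀ k, I.entitlement k = 1 / n := heq
  have hb0 := hI.entitlement_pos i
  set p : Fin m → ℝ := fun j => st.pay j / I.entitlement i with hp
  have hpk : ∀ k, (fun j => st.pay j / I.entitlement k) = p := fun k => by rw [hp, hb, hb]
  have hp0 : ∀ j, 0 ≤ p j := fun j => div_nonneg (hst.pay_nonneg hI mmsBid_nonneg j) hb0.le
  have hinv : ∀ k, 0 < θ k → MmsInvariant (fun S => I.value k S / θ k) (held st.owner k)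
      (st.flag k) (free n st.owner) p := fun k hk => by
    have := isAgentInvariant_mms.of_reachable hI hst k hk
    rwa [hpk k] at this
  have hpay1 : ∀ k, ∑ j ∈ held st.owner k, p j ≤ 1 := fun k => by
    rcases le_or_gt (θ k) 0 with h | h
    · rw [hst.held_eq_empty hI h]; simp
    · exact (hinv k h).sum_le_one
  have hpay2 : ∀ k, ∑ j ∈ held st.owner k, roundHalf (p j) ≤ 1 := fun k => by
    rcases le_or_gt (θ k) 0 with h | h
    · rw [hst.held_eq_empty hI h]; simp
    · exact (hinv k h).sum_round_le_one
  have hT1 : I.value i (held st.owner i) / θ i < 1 := (div_lt_one hθ).2 hi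
  have hfree : ∀ j, j ∉ free n st.owner := fun j => by rw [mem_free, not_le]; exact hall j
  have hinvi := hinv i hθ
  by_contra! hlt
  obtain ⟨A, hA⟩ := exists_maximinShare_le hn (I.value i)
  set T := held st.owner i
  have hV : ∀ k, 27 / 10 * (1 - ε) - 1 ≤
      ∑ j ∈ bundle A k \ T, marginal (fun S => I.value i S / θ i) T j := by
    intro k
    have h1 : maximinShare n (I.value i) ≤ I.value i (bundle A k) := by
      rw [hA]; exact ciInf_le (Set.finite_range _).bddBelow k
    have h2 : 27 / 10 * (1 - ε) ≤ I.value i (bundle A k) / θ i := by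
      rw [le_div_iff₀ hθ]; linarith
    have h3 := hg.le_add_sum_marginal (bundle A k) T
    linarith
  -- The loss is `9 / 5 = 2 / 3 * (27 / 10)`: without flag the tight condition is `8 / 15 + 2 / 3 *
  -- (7 / 10 - 27 / 10 * ε) = 1 - 9 / 5 * ε`.
  have hc : (n : ℝ) - 1 < n * (1 - 9 / 5 * ε) := by nlinarith
  by_cases hf : st.flag i = 0
  · refine not_forall_le_sum hall i hpay1 A hc fun k => ?_
    refine le_sum_of_paid (α := 8 / 15) (β := 2 / 3) (fun j _ => hp0 j) (fun j hj => ?_)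
      (by norm_num) (hV k) ?_ ?_ ?_ ?_ <;> try linarith
    exact (hinvi.lost hT1 hf j (Finset.mem_sdiff.1 hj).2 (hfree j)).imp_right
      (Or.imp_right And.left)
  -- With a raised flag a lost item may pay only `7 / 15`, and two of these fall short of 1; rounded
  -- to `1 / 2` they suffice, and the other agents' rounded totals are still at most 1.
  · refine not_forall_le_sum hall i hpay2 A hc fun k => ?_
    refine le_sum_of_paid (α := 1 / 2) (β := 7 / 9) (fun j _ => roundHalf_nonneg (hp0 j))
      (fun j hj => ?_) (by norm_num) (hV k) ?_ ?_ ?_ ?_ <;> try linarith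
    have h := hinvi.lost' hT1 hf j (Finset.mem_sdiff.1 hj).2 (hfree j)
    unfold roundHalf
    rcases h with h | h | h
    · left; rw [if_neg (by rintro ⟨-, h'⟩; linarith)]; exact h
    · split_ifs with hc
      · exact .inr (.inl ⟨le_rfl, h.2⟩)
      · left; by_contra! hlt1; exact hc ⟨h.1, hlt1⟩
    · right; right; split_ifs <;> linarith

/-! ### The programs -/

/-- The memory `s'` agrees with `s`, except for the integer arrays in `A` and
the number arrays in `B`. -/
structure Memory.AgreesOff (A B : List ℕ) (s s' : Memory) : Prop where
  nat : ∀ a, a ∉ A → s'.nat a = s.nat a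
  num : ∀ a, a ∉ B → s'.num a = s.num a

namespace Memory.AgreesOff

theorem refl (A B : List ℕ) (s : Memory) : AgreesOff A B s s := ⟨fun _ _ => rfl, fun _ _ => rfl⟩

theorem trans {A B A' B' : List ℕ} {s s' s'' : Memory} (h : AgreesOff A B s s')
    (h' : AgreesOff A' B' s' s'') (hA : A' ⊆ A := by simp) (hB : B' ⊆ B := by simp) :
    AgreesOff A B s s'' :=
  ⟨fun a ha => (h'.nat a fun e => ha (hA e)).trans (h.nat a ha),
    fun a ha => (h'.num a fun e => ha (hB e)).trans (h.num a ha)⟩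

theorem setNat {A B : List ℕ} {s s' : Memory} (h : AgreesOff A B s s') (a i x : ℕ)
    (ha : a ∈ A := by simp) : AgreesOff A B s (s'.setNat a i x) :=
  ⟨fun b hb => by
    rw [← h.nat b hb]; funext j
    have : b ≠ a := fun e => hb (e ▸ ha)
    simp [this], h.num⟩

theorem setNum {A B : List ℕ} {s s' : Memory} (h : AgreesOff A B s s') (a i : ℕ) (x : ℝ)
    (ha : a ∈ B := by simp) : AgreesOff A B s (s'.setNum a i x) :=
  ⟨h.nat, fun b hb => by
    rw [← h.num b hb]; funext j
    have : b ≠ a := fun e => hb (e ▸ ha)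
    simp [this]⟩

end Memory.AgreesOff

/-- Run the programs of a list one after the other. -/
def Program.block : List Program → Program
  | [] => .skip
  | p :: l => .seq p (block l)

theorem Triple.cons {I : Instance n m} {P : ℝ → Prop} {M : ℕ} {s : Memory} {Q : Memory → Prop}
    {p : Program} {l : List Program} (h : Triple I P M p s fun s' => Triple I P M (.block l) s' Q) :
    Triple I P M (.block (p :: l)) s Q := Triple.seq h

theorem Triple.nil {I : Instance n m} {P : ℝ → Prop} {M : ℕ} {s : Memory} {Q : Memory → Prop}
    (h : Q s) : Triple I P M (.block []) s Q := Triple.skip h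

/-- The number of agents. -/
def NatExpr.agents : NatExpr := .get 0 (.const 0)

/-- The number of items. -/
def NatExpr.items : NatExpr := .get 0 (.const 1)

@[simp] theorem NatExpr.eval_agents (s : Memory) : NatExpr.agents.eval s = s.nat 0 0 := rfl
@[simp] theorem NatExpr.eval_items (s : Memory) : NatExpr.items.eval s = s.nat 0 1 := rfl
@[simp] theorem NatExpr.eval_const (s : Memory) (k : ℕ) : (NatExpr.const k).eval s = k := rfl
@[simp] theorem NatExpr.eval_get (s : Memory) (a : ℕ) (i : NatExpr) :
    (NatExpr.get a i).eval s = s.nat a (i.eval s) := rfl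

/-- The number variable `a`. -/
def NumExpr.var (a : ℕ) : NumExpr := .get a (.const 0)

@[simp] theorem NumExpr.eval_var (s : Memory) (a : ℕ) : (NumExpr.var a).eval s = s.num a 0 := rfl
@[simp] theorem NumExpr.eval_const (s : Memory) (q : ℚ) : (NumExpr.const q).eval s = q := rfl
@[simp] theorem NumExpr.eval_get (s : Memory) (a : ℕ) (i : NatExpr) :
    (NumExpr.get a i).eval s = s.num a (i.eval s) := rfl
@[simp] theorem NumExpr.eval_add (s : Memory) (e f : NumExpr) :
    (NumExpr.add e f).eval s = e.eval s + f.eval s := rfl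
@[simp] theorem NumExpr.eval_sub (s : Memory) (e f : NumExpr) :
    (NumExpr.sub e f).eval s = e.eval s - f.eval s := rfl
@[simp] theorem NumExpr.eval_mul (s : Memory) (e f : NumExpr) :
    (NumExpr.mul e f).eval s = e.eval s * f.eval s := rfl
@[simp] theorem NumExpr.eval_div (s : Memory) (e f : NumExpr) :
    (NumExpr.div e f).eval s = e.eval s / f.eval s := rfl
@[simp] theorem NumExpr.all_var (P : ℝ → Prop) (s : Memory) (a : ℕ) :
    (NumExpr.var a).All P s ↔ P (s.num a 0) := Iff.rfl

attribute [simp] NumExpr.All Test.All Test.Holds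

/-- The test `e = f` for integers. -/
def Test.natEq (e f : NatExpr) : Test := .and (.natLe e f) (.natLe f e)

@[simp] theorem Test.holds_natEq (s : Memory) (e f : NatExpr) :
    (Test.natEq e f).Holds s ↔ e.eval s = f.eval s := le_antisymm_iff.symm

@[simp] theorem Test.all_natEq (P : ℝ → Prop) (s : Memory) (e f : NatExpr) :
    (Test.natEq e f).All P s := ⟨trivial, trivial⟩

/-- The test `e < f` for numbers. -/
def Test.numLt (e f : NumExpr) : Test := .not (.numLe f e)

@[simp] theorem Test.holds_numLt (s : Memory) (e f : NumExpr) :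
    (Test.numLt e f).Holds s ↔ e.eval s < f.eval s := not_le

@[simp] theorem Test.all_numLt (P : ℝ → Prop) (s : Memory) (e f : NumExpr) :
    (Test.numLt e f).All P s ↔ f.All P s ∧ e.All P s := Iff.rfl

/-- Write the indicator function of the items of agent `nat 3` into `nat 2`. -/
def heldIndicator : Program :=
  .forLoop 12 .items (.ite (.natEq (.get 1 (.var 12)) (.var 3))
    (.setNat 2 (.var 12) (.const 1)) (.setNat 2 (.var 12) (.const 0)))

/-- Write the value of the items of agent `nat 3` into `num 4`. -/
def queryHeld : Program := .block [heldIndicator, .query 4 (.const 0) (.var 3) 2]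

/-- Compare the best bid so far with the bid of agent `nat 3` for item `nat 4`. -/
def scanItem (bidProg : Program) : Program :=
  .ite (.natLe .agents (.get 1 (.var 4)))
    (.block [.setNat 2 (.var 4) (.const 1),
      .query 5 (.const 0) (.var 3) 2,
      .setNat 2 (.var 4) (.const 0),
      .setNum 6 (.const 0) (.div (.sub (.var 5) (.var 4)) (.get 1 (.var 3))),
      bidProg,
      .setNum 8 (.const 0) (.mul (.get 0 (.var 3)) (.var 7)),
      .ite (.numLt (.var 9) (.var 8))
        (.block [.setNum 9 (.const 0) (.var 8),
          .setNat 6 (.const 0) (.var 3),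
          .setNat 7 (.const 0) (.var 4),
          .ite (.numLe (.const (7 / 10)) (.var 6))
            (.setNat 9 (.const 0) (.const 1)) (.setNat 9 (.const 0) (.const 0))])
        .skip])
    .skip

/-- Compare the best bid so far with the bids of agent `nat 3`, if she is not satisfied. -/
def scanAgent (bidProg : Program) : Program :=
  .block [queryHeld,
    .ite (.numLt (.var 4) (.get 1 (.var 3))) (.forLoop 4 .items (scanItem bidProg)) .skip]

/-- A round of the bidding game. -/
def gameRound (bidProg : Program) : Program :=
  -- Bids of unsatisfied agents are nonnegative, so `-1` means that no bid has been made.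
  .block [.setNum 9 (.const 0) (.const (-1)),
    .forLoop 3 .agents (scanAgent bidProg),
    .ite (.numLe (.const 0) (.var 9))
      (.block [.setNat 1 (.var 7) (.var 6),
        .ite (.natLe (.const 1) (.var 9)) (.setNat 8 (.var 6) (.const 1)) .skip])
      .skip]

/-- The bidding game. -/
def game (bidProg : Program) : Program :=
  .block [.forLoop 4 .items (.setNat 1 (.var 4) .agents),
    .forLoop 3 .agents (.setNat 8 (.var 3) (.const 0)),
    .forLoop 5 .items (gameRound bidProg)]

/-- Decrease the targets of the agents that miss their target, and write into `nat 10` whether there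
is such an agent. -/
def updateTargets : Program :=
  .block [.setNat 10 (.const 0) (.const 0),
    .forLoop 3 .agents (.block [queryHeld,
      .ite (.numLt (.var 4) (.get 1 (.var 3)))
        (.block [.setNat 10 (.const 0) (.const 1),
          .setNum 1 (.var 3) (.mul (.get 1 (.var 3)) (.var 3)),
          .ite (.numLt (.mul (.const 3) (.get 1 (.var 3))) (.get 2 (.var 3)))
            (.setNum 1 (.var 3) (.const 0)) .skip])
        .skip])]

/-- Write the least positive value of an item into `num 2`, for every agent. -/
def leastValues : Program :=
  .forLoop 3 .agents (.forLoop 4 .items (.block [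
    .setNat 2 (.var 4) (.const 1),
    .query 5 (.const 0) (.var 3) 2,
    .setNat 2 (.var 4) (.const 0),
    .ite (.and (.numLt (.const 0) (.var 5)) (.not (.and (.numLt (.const 0) (.get 2 (.var 3)))
        (.numLe (.get 2 (.var 3)) (.var 5)))))
      (.setNum 2 (.var 3) (.var 5)) .skip]))

/-- Write the value of the set of all items into `num 1`, for every agent. -/
def initialTargets : Program :=
  .block [.forLoop 4 .items (.setNat 2 (.var 4) (.const 1)),
    .forLoop 3 .agents (.query 1 (.var 3) (.var 3) 2)]

/-- Write the factor by which targets decrease into `num 3`. -/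
def rateProgram : Program :=
  .block [.forLoop 3 .agents (.setNum 3 (.const 0) (.add (.var 3) (.const 1))),
    .forLoop 4 .items (.setNum 3 (.const 0) (.add (.var 3) (.const 1))),
    .setNum 3 (.const 0) (.sub (.const 1) (.div (.const 1) (.mul (.const 4) (.var 3))))]

/-- Play the bidding game with decreasing targets, until all agents meet their targets. -/
def allocate (bidProg : Program) : Program :=
  .block [rateProgram, leastValues, initialTargets,
    .setNat 10 (.const 0) (.const 1),
    .loop (.natLe (.const 1) (.var 10)) (.block [game bidProg, updateTargets]),
    .forLoop 4 .items (.ite (.natLe .agents (.get 1 (.var 4)))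
      (.setNat 1 (.var 4) (.const 0)) .skip)]

/-! ### Correctness of the programs -/

/-- The factor by which targets decrease. -/
noncomputable def targetRate (n m : ℕ) : ℝ := 1 - 1 / (4 * ((n : ℝ) + m))

/-- The next target, after `t`. -/
noncomputable def nextTarget (n m : ℕ) (μ t : ℝ) : ℝ :=
  if 3 * (t * targetRate n m) < μ then 0 else t * targetRate n m

/-- The targets of an agent who has value `v` for the set of all items. -/
noncomputable def targetSeq (n m : ℕ) (v μ : ℝ) : ℕ → ℝ
  | 0 => v
  | e + 1 => nextTarget n m μ (targetSeq n m v μ e)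

/-- The value `u` is the least positive value of an item in `D`, or `0` if there is no such item. -/
def IsLeastPositive (v : Finset (Fin m) → ℝ) (D : Fin m → Prop) (u : ℝ) : Prop :=
  (u = 0 ∧ ∀ j, D j → v {j} ≤ 0) ∨ (0 < u ∧ ∀ j, D j → 0 < v {j} → u ≤ v {j})

/-- All numbers that occur in `allocate` satisfy `P`. -/
structure Admissible (I : Instance n m) (φ : ℕ → ℝ → ℝ) (P : ℝ → Prop) : Prop where
  const : ∀ q : ℚ, ratBitLength q ≤ 16 → P q
  count : ∀ k : ℕ, k ≤ n + m → P k
  rate_mul : P (4 * ((n : ℝ) + m))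
  rate_div : P (1 / (4 * ((n : ℝ) + m)))
  rate : P (targetRate n m)
  entitlement : ∀ i, P (I.entitlement i)
  value : ∀ i S, P (I.value i S)
  target : ∀ i U, IsLeastPositive (I.value i) (fun _ => True) (I.value i U) → ∀ e,
    P (targetSeq n m (I.value i Finset.univ) (I.value i U) e)
  target_mul : ∀ i U, IsLeastPositive (I.value i) (fun _ => True) (I.value i U) → ∀ e,
    P (targetSeq n m (I.value i Finset.univ) (I.value i U) e * targetRate n m)
  target_mul_mul : ∀ i U, IsLeastPositive (I.value i) (fun _ => True) (I.value i U) → ∀ e,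
    P (3 * (targetSeq n m (I.value i Finset.univ) (I.value i U) e * targetRate n m))
  sub : ∀ i S T, P (I.value i S - I.value i T)
  div : ∀ i U, IsLeastPositive (I.value i) (fun _ => True) (I.value i U) → ∀ S T e,
    P ((I.value i S - I.value i T) / targetSeq n m (I.value i Finset.univ) (I.value i U) e)
  mul : ∀ i U, IsLeastPositive (I.value i) (fun _ => True) (I.value i U) → ∀ S T e (q : ℚ),
    ratBitLength q ≤ 16 →
    P (q * ((I.value i S - I.value i T) / targetSeq n m (I.value i Finset.univ) (I.value i U) e))
  rel : ∀ i U, IsLeastPositive (I.value i) (fun _ => True) (I.value i U) → ∀ S T e f,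
    P (φ f ((I.value i S - I.value i T) / targetSeq n m (I.value i Finset.univ) (I.value i U) e))
  bid : ∀ i U, IsLeastPositive (I.value i) (fun _ => True) (I.value i U) → ∀ S T e f,
    P (I.entitlement i * φ f ((I.value i S - I.value i T) /
      targetSeq n m (I.value i Finset.univ) (I.value i U) e))

/-- The program `p` writes the relative bid for an item into `num 7`. -/
def ComputesBid (φ : ℕ → ℝ → ℝ) (p : Program) : Prop :=
  ∀ {n m : ℕ} (I : Instance n m) (P : ℝ → Prop) (M : ℕ) (s : Memory) (Q : Memory → Prop),
    (∀ q : ℚ, ratBitLength q ≤ 16 → P q) → P (s.num 6 0) →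
    (∀ q : ℚ, ratBitLength q ≤ 16 → P (q * s.num 6 0)) →
    Q (s.setNum 7 0 (φ (s.nat 8 (s.nat 3 0)) (s.num 6 0))) → Triple I P M p s Q

/-- The memory holds the data that do not change in the bidding game. -/
structure HoldsData (I : Instance n m) (θ μ : Fin n → ℝ) (s : Memory) : Prop where
  agents : s.nat 0 0 = n
  items : s.nat 0 1 = m
  entitlement : ∀ i : Fin n, s.num 0 i = I.entitlement i
  target : ∀ i : Fin n, s.num 1 i = θ i
  least : ∀ i : Fin n, s.num 2 i = μ i
  rate : s.num 3 0 = targetRate n m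

theorem HoldsData.of_agreesOff {I : Instance n m} {θ μ : Fin n → ℝ} {s s' : Memory}
    (h : HoldsData I θ μ s) {A B : List ℕ} (hs : s.AgreesOff A B s') (hA : 0 ∉ A := by simp)
    (hB : 0 ∉ B ∧ 1 ∉ B ∧ 2 ∉ B ∧ 3 ∉ B := by simp) : HoldsData I θ μ s' := by
  obtain ⟨h0, h1, h2, h3⟩ := hB
  constructor
  · rw [hs.nat 0 hA, h.agents]
  · rw [hs.nat 0 hA, h.items]
  · rw [hs.num 0 h0]; exact h.entitlement
  · rw [hs.num 1 h1]; exact h.target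
  · rw [hs.num 2 h2]; exact h.least
  · rw [hs.num 3 h3, h.rate]

/-- The memory holds the owners of the items. -/
def HoldsOwner (o : Fin m → ℕ) (s : Memory) : Prop := ∀ j : Fin m, s.nat 1 j = o j

/-! ### Querying bundles and recording the best bid -/

section Specs

variable {I : Instance n m} {P : ℝ → Prop} {M : ℕ} {s : Memory} {Q : Memory → Prop}
  {o : Fin m → ℕ}

theorem heldIndicator_spec (hM : m ≤ M) (hm : s.nat 0 1 = m)
    (h : ∀ s', s.AgreesOff [2, 12] [] s' →
      (∀ j < m, s'.nat 2 j = if s.nat 1 j = s.nat 3 0 then 1 else 0) → Q s') :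
    Triple I P M heldIndicator s Q := by
  refine Triple.forLoop (fun k s' => s.AgreesOff [2, 12] [] s' ∧ s'.nat 12 0 = k ∧
    ∀ j < k, s'.nat 2 j = if s.nat 1 j = s.nat 3 0 then 1 else 0) (B := m) hM
    ⟨(Memory.AgreesOff.refl _ _ s).setNat _ _ _, by simp, by simp⟩ ?_ ?_ ?_
  · rintro k s' ⟨h1, h2, -⟩
    exact ⟨h2, by simp [h1.nat 0, hm]⟩
  · rintro k s' hk ⟨h1, h2, h3⟩
    have e1 : s'.nat 1 = s.nat 1 := h1.nat 1 (by simp)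
    have e3 : s'.nat 3 = s.nat 3 := h1.nat 3 (by simp)
    refine Triple.ite (by simp) (fun ht => Triple.setNat ?_) (fun ht => Triple.setNat ?_)
    all_goals
      refine ⟨by simp [h2], (h1.setNat _ _ _).setNat _ _ _, by simp, fun j hj => ?_⟩
      simp only [Test.holds_natEq, NatExpr.eval_get, NatExpr.eval_var, h2, e1, e3] at ht
      by_cases hjk : j = k
      · subst hjk; simp [h2, ht]
      · simp [h2, hjk, h3 j (by omega)]
  · rintro s' ⟨h1, -, h3⟩
    exact h s' h1 h3

theorem oracle_eq (i : Fin n) (c : ℕ → ℕ) (S : Finset (Fin m)) (hc : ∀ j : Fin m, c j ≠ 0 ↔ j ∈ S) :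
    I.oracle i c = I.value i S := by
  rw [Instance.oracle, dif_pos i.2]
  congr 1
  ext j; simp [hc]

theorem queryHeld_spec (hM : m ≤ M) (hm : s.nat 0 1 = m) (ho : HoldsOwner o s) (i : Fin n)
    (hi : s.nat 3 0 = i)
    (h : ∀ s', s.AgreesOff [2, 12] [4] s' → (∀ j : Fin m, s'.nat 2 j ≠ 0 ↔ j ∈ held o i) →
      s'.num 4 0 = I.value i (held o i) → Q s') :
    Triple I P M queryHeld s Q := by
  refine Triple.cons (heldIndicator_spec hM hm fun s' h1 h2 => Triple.cons (Triple.query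
    (Triple.nil (h _ ?_ ?_ ?_))))
  · exact (Memory.AgreesOff.trans (Memory.AgreesOff.refl _ _ s) h1).setNum _ _ _
  · intro j
    simp [h2 j j.2, ho j, hi, mem_held]
  · have e3 : s'.nat 3 = s.nat 3 := h1.nat 3 (by simp)
    simp only [NatExpr.eval_const, NatExpr.eval_var, Memory.setNum_num, and_self, if_true, e3, hi]
    refine oracle_eq i _ _ fun j => ?_
    simp [h2 j j.2, ho j, hi, mem_held]

/-- The memory holds the best bid of an unsatisfied agent for an item that is not yet allocated, among
the pairs in `D`. -/
def HoldsBest (I : Instance n m) (φ : ℕ → ℝ → ℝ) (θ : Fin n → ℝ) (o : Fin m → ℕ) (f : Fin n → ℕ)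
    (D : Fin n → Fin m → Prop) (s : Memory) : Prop :=
  (s.num 9 0 = -1 ∨ ∃ i j, n ≤ o j ∧ I.value i (held o i) < θ i ∧
    s.num 9 0 = I.bid φ θ o f i j ∧ s.nat 6 0 = i ∧ s.nat 7 0 = j ∧
    s.nat 9 0 = if 7 / 10 ≤ I.relMarginal θ o i j then 1 else 0) ∧
  ∀ i j, D i j → n ≤ o j → I.value i (held o i) < θ i → I.bid φ θ o f i j ≤ s.num 9 0

theorem HoldsBest.congr {φ : ℕ → ℝ → ℝ} {θ : Fin n → ℝ} {f : Fin n → ℕ}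
    {D D' : Fin n → Fin m → Prop} {s' : Memory}
    (h : HoldsBest I φ θ o f D s) (h9 : s'.num 9 0 = s.num 9 0) (h6 : s'.nat 6 0 = s.nat 6 0)
    (h7 : s'.nat 7 0 = s.nat 7 0) (h9' : s'.nat 9 0 = s.nat 9 0)
    (hD : ∀ i j, D' i j → n ≤ o j → I.value i (held o i) < θ i → D i j) :
    HoldsBest I φ θ o f D' s' := by
  unfold HoldsBest
  rw [h9, h6, h7, h9']
  exact ⟨h.1, fun i j hij h1 h2 => h.2 i j (hD i j hij h1 h2) h1 h2⟩

end Specs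

/-- The rational constants of the programs have numerator and denominator below `2 ^ 8`, which is
where the bound 16 comes from. -/
theorem ratBitLength_le {q : ℚ} (h : q.num.natAbs < 2 ^ 8) (h' : q.den < 2 ^ 8) :
    ratBitLength q ≤ 16 :=
  Nat.add_le_add (Nat.size_le.2 h) (Nat.size_le.2 h')

/-- The targets of all agents, after `e i` decreases of the target of agent `i`, when `U i` is a bundle
of least positive value. -/
noncomputable def Instance.targets (I : Instance n m) (U : Fin n → Finset (Fin m)) (e : Fin n → ℕ)
    (i : Fin n) : ℝ :=
  targetSeq n m (I.value i Finset.univ) (I.value i (U i)) (e i)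

/-! ### Correctness of the bidding game -/

section Game

variable {I : Instance n m} {φ : ℕ → ℝ → ℝ} {bidProg : Program} {P : ℝ → Prop} {M : ℕ}
  {s : Memory} {U : Fin n → Finset (Fin m)} {e : Fin n → ℕ} {o : Fin m → ℕ} {f : Fin n → ℕ}

theorem HoldsBest.admissible {D : Fin n → Fin m → Prop} (hP : Admissible I φ P)
    (hU : ∀ i, IsLeastPositive (I.value i) (fun _ => True) (I.value i (U i)))
    (h : HoldsBest I φ (I.targets U e) o f D s) : P (s.num 9 0) := by
  rcases h.1 with h | ⟨i, j, -, -, h, -⟩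
  · rw [h]
    have := hP.const (-1) (ratBitLength_le (by norm_num) (by norm_num))
    simpa using this
  · rw [h]
    exact hP.bid i _ (hU _) _ _ _ _

theorem scanItem_spec (hφ : ComputesBid φ bidProg) (hP : Admissible I φ P)
    (hU : ∀ i, IsLeastPositive (I.value i) (fun _ => True) (I.value i (U i)))
    (hs : HoldsData I (I.targets U e) (fun i => I.value i (U i)) s) (ho : HoldsOwner o s)
    (hf : ∀ i : Fin n, s.nat 8 i = f i) {i : Fin n} {j : Fin m} (hi : s.nat 3 0 = i)
    (hj : s.nat 4 0 = j) (hc : ∀ j : Fin m, s.nat 2 j ≠ 0 ↔ j ∈ held o i)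
    (hx : s.num 4 0 = I.value i (held o i)) (hlt : I.value i (held o i) < I.targets U e i)
    {D : Fin n → Fin m → Prop} (hD : HoldsBest I φ (I.targets U e) o f D s) :
    Triple I P M (scanItem bidProg) s fun s' => s.AgreesOff [2, 6, 7, 9] [5, 6, 7, 8, 9] s' ∧
      (∀ j : Fin m, s'.nat 2 j ≠ 0 ↔ j ∈ held o i) ∧
      HoldsBest I φ (I.targets U e) o f (fun i' j' => D i' j' ∨ i' = i ∧ j' = j) s' := by
  refine Triple.ite (by simp) (fun ht => ?_) (fun ht => Triple.skip ?_)
  · simp only [Test.Holds, NatExpr.eval_agents, NatExpr.eval_get, NatExpr.eval_var, hs.agents, hj,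
      ho j] at ht
    have hjo : j ∉ held o i := by rw [mem_held]; have := i.2; omega
    have hc' : ∀ k : Fin m, (s.setNat 2 j 1).nat 2 k ≠ 0 ↔ k ∈ insert j (held o i) := by
      intro k
      by_cases hk : k = j
      · simp [hk]
      · have : (k : ℕ) ≠ j := fun h => hk (Fin.ext h)
        simp [this, hk, ← hc k]
    have hq := oracle_eq (I := I) i _ _ hc'
    have hrel : (I.value i (insert j (held o i)) - I.value i (held o i)) / I.targets U e i =
        I.relMarginal (I.targets U e) o i j := rfl
    -- The indicator of the held bundle is switched on at `j` for the query and restored afterwards,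
    -- so it need not be rebuilt for the next item.
    refine Triple.cons (Triple.setNat (Triple.cons (Triple.query (Triple.cons (Triple.setNat ?_)))))
    simp only [NatExpr.eval_var, NatExpr.eval_const, hj, Memory.setNat_nat, Memory.setNum_nat, hi,
      show (3 : ℕ) ≠ 2 by decide, show (4 : ℕ) ≠ 2 by decide, false_and,
      if_false, hq]
    set s1 := ((s.setNat 2 j 1).setNum 5 0 (I.value i (insert j (held o i)))).setNat 2 j 0 with hs1
    have h1 : s.AgreesOff [2] [5] s1 := (((Memory.AgreesOff.refl _ _ s).setNat 2 j 1).setNum 5 0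
      (I.value i (insert j (held o i)))).setNat 2 j 0
    have hc1 : ∀ k : Fin m, s1.nat 2 k ≠ 0 ↔ k ∈ held o i := by
      intro k
      by_cases hk : k = j
      · subst hk; simp [hs1, hjo]
      · have : (k : ℕ) ≠ j := fun h => hk (Fin.ext h)
        simp [hs1, this, ← hc k]
    have h15 : s1.num 5 0 = I.value i (insert j (held o i)) := by simp [hs1]
    have h14 : s1.num 4 0 = I.value i (held o i) := by simp [hs1, hx]
    have hd1 := hs.of_agreesOff h1
    have h13 : s1.nat 3 0 = i := by rw [h1.nat 3 (by simp), hi]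
    have h14' : s1.nat 4 0 = j := by rw [h1.nat 4 (by simp), hj]
    have hb1 : HoldsBest I φ (I.targets U e) o f D s1 :=
      hD.congr (by rw [h1.num 9 (by simp)]) (by rw [h1.nat 6 (by simp)]) (by rw [h1.nat 7 (by simp)])
        (by rw [h1.nat 9 (by simp)]) fun _ _ h _ _ => h
    have hf1 : ∀ i : Fin n, s1.nat 8 i = f i := by rw [h1.nat 8 (by simp)]; exact hf
    clear_value s1
    refine Triple.cons (Triple.setNum ?_ ?_)
    · simp only [NumExpr.All, NumExpr.all_var, NumExpr.eval_sub, NumExpr.eval_var, NumExpr.eval_get,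
        NatExpr.eval_var, h15, h14, h13, hd1.target]
      exact ⟨⟨hP.value _ _, hP.value _ _, hP.sub _ _ _⟩, hP.target _ _ (hU _) _, hP.div _ _ (hU _) _ _ _⟩
    simp only [NatExpr.eval_const, NumExpr.eval_sub, NumExpr.eval_div, NumExpr.eval_var,
      NumExpr.eval_get, NatExpr.eval_var, h15, h14, h13, hd1.target, hrel]
    refine Triple.cons (hφ I P M _ _ hP.const ?_ (fun q hq => ?_) ?_)
    · simp only [Memory.setNum_num, and_self, if_true]
      exact hP.div _ _ (hU _) _ _ _
    · simp only [Memory.setNum_num, and_self, if_true]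
      exact hP.mul _ _ (hU _) _ _ _ _ hq
    simp only [Memory.setNum_num, and_self, if_true, Memory.setNum_nat, h13, hf1]
    set r := I.relMarginal (I.targets U e) o i j with hr
    refine Triple.cons (Triple.setNum ?_ ?_)
    · simp only [NumExpr.All, NumExpr.all_var, NumExpr.eval_var, NumExpr.eval_get,
        NatExpr.eval_var, Memory.setNum_nat, h13, Memory.setNum_num, and_self, if_true,
        show (0 : ℕ) ≠ 7 by decide, show (0 : ℕ) ≠ 6 by decide, false_and, if_false, hd1.entitlement]
      exact ⟨hP.entitlement _, hP.rel _ _ (hU _) _ _ _ _, hP.bid _ _ (hU _) _ _ _ _⟩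
    simp only [NumExpr.eval_mul, NumExpr.eval_var, NumExpr.eval_get, NatExpr.eval_const,
      NatExpr.eval_var, Memory.setNum_nat, h13, Memory.setNum_num, and_self, if_true,
      show (0 : ℕ) ≠ 7 by decide, show (0 : ℕ) ≠ 6 by decide, false_and, if_false, hd1.entitlement]
    set s2 := ((s1.setNum 6 0 r).setNum 7 0 (φ (f i) r)).setNum 8 0
      (I.entitlement i * φ (f i) r) with hs2
    have h2 : s.AgreesOff [2, 6, 7, 9] [5, 6, 7, 8, 9] s2 :=
      ((((Memory.AgreesOff.refl _ _ s).trans h1).setNum 6 0 r).setNum 7 0 (φ (f i) r)).setNum 8 0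
        (I.entitlement i * φ (f i) r)
    have h26 : s2.num 6 0 = r := by simp [hs2]
    have h28 : s2.num 8 0 = I.bid φ (I.targets U e) o f i j := by simp [hs2, Instance.bid, hr]
    have hc2 : ∀ k : Fin m, s2.nat 2 k ≠ 0 ↔ k ∈ held o i := hc1
    have h23 : s2.nat 3 0 = i := h13
    have h24 : s2.nat 4 0 = j := h14'
    have hb2 : HoldsBest I φ (I.targets U e) o f D s2 :=
      hb1.congr (by simp [hs2]) rfl rfl rfl fun _ _ h _ _ => h
    clear_value s2
    have hP8 : P (s2.num 8 0) := by rw [h28]; exact hP.bid i _ (hU _) _ _ _ _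
    refine Triple.cons (Triple.ite ?_ (fun hb => ?_) (fun hb => Triple.skip (Triple.nil ?_)))
    · exact ⟨hP8, hb2.admissible hP hU⟩
    · rw [Test.holds_numLt, NumExpr.eval_var, NumExpr.eval_var] at hb
      have hnew : ∀ s3 : Memory, s3.num 9 0 = s2.num 8 0 → s3.nat 6 0 = i → s3.nat 7 0 = j →
          s3.nat 9 0 = (if 7 / 10 ≤ r then 1 else 0) →
          HoldsBest I φ (I.targets U e) o f (fun i' j' => D i' j' ∨ i' = i ∧ j' = j) s3 := by
        intro s3 h39 h36 h37 h39'
        refine ⟨.inr ⟨i, j, ht, hlt, by rw [h39, h28], h36, h37, h39'⟩, ?_⟩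
        rintro i' j' (hD' | ⟨rfl, rfl⟩) hj' hi'
        · rw [h39]; exact (hb2.2 i' j' hD' hj' hi').trans hb.le
        · rw [h39, h28]
      have hconst : P ((7 / 10 : ℚ) : ℝ) := hP.const _ (ratBitLength_le (by norm_num) (by norm_num))
      refine Triple.cons (Triple.setNum hP8 (Triple.cons (Triple.setNat (Triple.cons
        (Triple.setNat (Triple.cons (Triple.ite ?_ (fun h7 => Triple.setNat (Triple.nil (Triple.nil ?_)))
          (fun h7 => Triple.setNat (Triple.nil (Triple.nil ?_))))))))))
      · refine ⟨hconst, ?_⟩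
        simp only [NumExpr.all_var, Memory.setNat_num, Memory.setNum_num,
          show (6 : ℕ) ≠ 9 by decide, false_and, if_false, h26]
        exact hP.div _ _ (hU _) _ _ _
      all_goals
        simp [h26] at h7
        refine ⟨(((h2.setNum _ _ _).setNat _ _ _).setNat _ _ _).setNat _ _ _, hc2, hnew _ ?_ ?_ ?_ ?_⟩
        · simp
        · simp [h23]
        · simp [h24]
        · simp [h7]
    · rw [Test.holds_numLt, NumExpr.eval_var, NumExpr.eval_var, not_lt] at hb
      refine ⟨h2, hc2, hb2.1, ?_⟩
      rintro i' j' (hD' | ⟨rfl, rfl⟩) hj' hi'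
      · exact hb2.2 i' j' hD' hj' hi'
      · rw [← h28]; exact hb
  · simp only [Test.Holds, NatExpr.eval_agents, NatExpr.eval_get, NatExpr.eval_var, hs.agents, hj,
      ho j] at ht
    refine ⟨Memory.AgreesOff.refl _ _ s, hc, hD.congr rfl rfl rfl rfl ?_⟩
    rintro i' j' (hD' | ⟨rfl, rfl⟩) hj' -
    · exact hD'
    · exact absurd hj' ht

theorem scanAgent_spec (hφ : ComputesBid φ bidProg) (hP : Admissible I φ P)
    (hU : ∀ i, IsLeastPositive (I.value i) (fun _ => True) (I.value i (U i))) (hM : m ≤ M)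
    (hs : HoldsData I (I.targets U e) (fun i => I.value i (U i)) s) (ho : HoldsOwner o s)
    (hf : ∀ i : Fin n, s.nat 8 i = f i) {i : Fin n} (hi : s.nat 3 0 = i)
    {D : Fin n → Fin m → Prop} (hD : HoldsBest I φ (I.targets U e) o f D s) :
    Triple I P M (scanAgent bidProg) s fun s' =>
      s.AgreesOff [2, 4, 6, 7, 9, 12] [4, 5, 6, 7, 8, 9] s' ∧
      HoldsBest I φ (I.targets U e) o f (fun i' j' => D i' j' ∨ i' = i) s' := by
  refine Triple.cons (queryHeld_spec hM hs.items ho i hi fun s1 h1 hc1 hx1 => ?_)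
  have hd1 := hs.of_agreesOff h1
  have h13 : s1.nat 3 0 = i := by rw [h1.nat 3 (by simp), hi]
  have hb1 : HoldsBest I φ (I.targets U e) o f D s1 :=
    hD.congr (by rw [h1.num 9 (by simp)]) (by rw [h1.nat 6 (by simp)]) (by rw [h1.nat 7 (by simp)])
      (by rw [h1.nat 9 (by simp)]) fun _ _ h _ _ => h
  refine Triple.cons (Triple.ite ?_ (fun ht => ?_) (fun ht => Triple.skip (Triple.nil ?_)))
  · simp only [Test.all_numLt, NumExpr.All, NumExpr.all_var, NatExpr.eval_var, h13, hd1.target, hx1]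
    exact ⟨hP.target _ _ (hU _) _, hP.value _ _⟩
  · simp only [Test.holds_numLt, NumExpr.eval_var, NumExpr.eval_get, NatExpr.eval_var, h13,
      hd1.target, hx1] at ht
    refine Triple.forLoop (fun k s' => s.AgreesOff [2, 4, 6, 7, 9, 12] [4, 5, 6, 7, 8, 9] s' ∧
      s'.nat 4 0 = k ∧ s'.num 4 0 = I.value i (held o i) ∧
      (∀ j : Fin m, s'.nat 2 j ≠ 0 ↔ j ∈ held o i) ∧
      HoldsBest I φ (I.targets U e) o f (fun i' j' => D i' j' ∨ i' = i ∧ (j' : ℕ) < k) s')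
      (B := m) hM ?_ ?_ ?_ ?_
    · refine ⟨((Memory.AgreesOff.refl _ _ s).trans h1).setNat _ _ _, by simp, by simp [hx1],
        by simpa using hc1, hb1.congr (by simp) (by simp) (by simp) (by simp) ?_⟩
      rintro i' j' (h | ⟨-, h⟩) - -
      · exact h
      · exact absurd h (Nat.not_lt_zero _)
    · rintro k s' ⟨h2, h3, -⟩
      exact ⟨h3, (hs.of_agreesOff h2).items⟩
    · rintro k s' hk ⟨h2, h3, h4, h5, h6⟩
      have hd := hs.of_agreesOff h2
      have ho' : HoldsOwner o s' := by unfold HoldsOwner; rw [h2.nat 1 (by simp)]; exact ho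
      refine (scanItem_spec hφ hP hU hd ho' (by rw [h2.nat 8 (by simp)]; exact hf)
        (by rw [h2.nat 3 (by simp), hi]) (j := ⟨k, hk⟩) h3 h5 h4 ht h6).mono ?_
      rintro s'' ⟨h7, h8, h9⟩
      refine ⟨by rw [h7.nat 4 (by simp), h3], (h2.trans h7).setNat _ _ _, by simp, ?_, by simpa using h8,
        h9.congr (by simp) (by simp) (by simp) (by simp) ?_⟩
      · rw [Memory.setNat_num, h7.num 4 (by simp), h4]
      · rintro i' j' (h | ⟨h, h'⟩) - -
        · exact .inl (.inl h)
        · rcases Nat.lt_succ_iff_lt_or_eq.1 h' with h' | h'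
          · exact .inl (.inr ⟨h, h'⟩)
          · exact .inr ⟨h, Fin.ext h'⟩
    · rintro s' ⟨h2, h3, h4, h5, h6⟩
      refine Triple.nil ⟨h2, h6.congr rfl rfl rfl rfl ?_⟩
      rintro i' j' (h | h) - -
      · exact .inl h
      · exact .inr ⟨h, j'.2⟩
  · simp only [Test.holds_numLt, NumExpr.eval_var, NumExpr.eval_get, NatExpr.eval_var, h13,
      hd1.target, hx1] at ht
    refine ⟨(Memory.AgreesOff.refl _ _ s).trans h1, hb1.congr rfl rfl rfl rfl ?_⟩
    rintro i' j' (h | rfl) - h'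
    · exact h
    · exact absurd h' ht

/-- The memory holds a state of the bidding game. -/
structure HoldsState (st : GameState n m) (s : Memory) : Prop where
  owner : HoldsOwner st.owner s
  flag : ∀ i : Fin n, s.nat 8 i = st.flag i

theorem HoldsState.of_agreesOff {st : GameState n m} {s s' : Memory} (h : HoldsState st s)
    {A B : List ℕ} (hs : s.AgreesOff A B s') (hA : 1 ∉ A ∧ 8 ∉ A := by simp) :
    HoldsState st s' := by
  refine ⟨?_, ?_⟩
  · unfold HoldsOwner; rw [hs.nat 1 hA.1]; exact h.owner
  · rw [hs.nat 8 hA.2]; exact h.flag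

/-- The final alternative measures progress. Its clause about an unsatisfied agent in the old state
ensures that a state in which everyone is satisfied is never left. -/
theorem gameRound_spec (hI : I.IsSubmodular) (hφ0 : ∀ f r, 0 ≤ r → 0 ≤ φ f r)
    (hφ : ComputesBid φ bidProg) (hP : Admissible I φ P)
    (hU : ∀ i, IsLeastPositive (I.value i) (fun _ => True) (I.value i (U i))) (hM : n + m ≤ M)
    (hs : HoldsData I (I.targets U e) (fun i => I.value i (U i)) s) {st : GameState n m}
    (hst : HoldsState st s) (hr : Reachable I φ (I.targets U e) st) :
    Triple I P M (gameRound bidProg) s fun s' =>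
      s.AgreesOff [1, 2, 3, 4, 6, 7, 8, 9, 12] [4, 5, 6, 7, 8, 9] s' ∧
      ∃ st', HoldsState st' s' ∧ Reachable I φ (I.targets U e) st' ∧
        ((∀ i, I.targets U e i ≤ I.value i (held st'.owner i)) ∨
          (free n st'.owner).card ≤ (free n st.owner).card - 1 ∧
            ∃ i, I.value i (held st.owner i) < I.targets U e i) := by
  have hm1 := hP.const (-1) (ratBitLength_le (by norm_num) (by norm_num))
  refine Triple.cons (Triple.setNum hm1 ?_)
  refine Triple.cons (Triple.forLoop (fun k s' =>
    s.AgreesOff [2, 3, 4, 6, 7, 9, 12] [4, 5, 6, 7, 8, 9] s' ∧ s'.nat 3 0 = k ∧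
      HoldsBest I φ (I.targets U e) st.owner st.flag (fun i' _ => (i' : ℕ) < k) s')
    (B := n) (by omega) ?_ ?_ ?_ ?_)
  · refine ⟨((Memory.AgreesOff.refl _ _ s).setNum _ _ _).setNat _ _ _, by simp, .inl ?_, ?_⟩
    · simp
    · intro i j h; exact absurd h (Nat.not_lt_zero _)
  · rintro k s' ⟨h1, h2, -⟩
    exact ⟨h2, (hs.of_agreesOff h1).agents⟩
  · rintro k s' hk ⟨h1, h2, h3⟩
    have hst' := hst.of_agreesOff h1
    refine (scanAgent_spec hφ hP hU (by omega) (hs.of_agreesOff h1) hst'.owner hst'.flag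
      (i := ⟨k, hk⟩) h2 h3).mono ?_
    rintro s'' ⟨h4, h5⟩
    refine ⟨by rw [h4.nat 3 (by simp), h2], (h1.trans h4).setNat _ _ _, by simp,
      h5.congr (by simp) (by simp) (by simp) (by simp) ?_⟩
    rintro i' j' h' - -
    rcases Nat.lt_succ_iff_lt_or_eq.1 h' with h' | h'
    · exact .inl h'
    · exact .inr (Fin.ext h')
  rintro s1 ⟨h1, -, hb⟩
  have hst1 := hst.of_agreesOff h1
  have hP0 : P ((0 : ℚ) : ℝ) := hP.const 0 (ratBitLength_le (by norm_num) (by norm_num))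
  have hbid : ∀ i j, I.value i (held st.owner i) < I.targets U e i →
      0 ≤ I.bid φ (I.targets U e) st.owner st.flag i j := fun i j h => by
    have hv := hI.value_submodular i
    refine mul_nonneg (hI.entitlement_pos i).le (hφ0 _ _ (div_nonneg (hv.marginal_nonneg _ _) ?_))
    exact (hv.nonneg _).trans h.le
  refine Triple.cons (Triple.ite ⟨hP0, hb.admissible hP hU⟩ (fun ht => ?_)
    (fun ht => Triple.skip (Triple.nil ?_)))
  · simp only [Test.Holds, NumExpr.eval_const, NumExpr.eval_var, Rat.cast_zero] at ht
    rcases hb.1 with hb1 | ⟨i, j, hj, hi, hbv, h6, h7, h9⟩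
    · rw [hb1] at ht; norm_num at ht
    have hstep : Reachable I φ (I.targets U e) (I.award φ (I.targets U e) st i j) :=
      hr.step hj hi fun i' j' hj' hi' => by rw [← hbv]; exact hb.2 i' j' i'.2 hj' hi'
    have hcard : (free n (I.award φ (I.targets U e) st i j).owner).card ≤
        (free n st.owner).card - 1 := by
      simp only [Instance.award, free_update]
      rw [Finset.card_erase_of_mem (mem_free.2 hj)]
    have howner : HoldsOwner (Function.update st.owner j i) (s1.setNat 1 j i) := by
      intro k
      by_cases hk : k = j
      · subst hk; simp
      · have : (k : ℕ) ≠ j := fun h => hk (Fin.ext h)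
        simp [this, hk, hst1.owner k]
    refine Triple.cons (Triple.setNat (Triple.cons (Triple.ite trivial
      (fun h7' => Triple.setNat (Triple.nil (Triple.nil ?_)))
      (fun h7' => Triple.skip (Triple.nil (Triple.nil ?_))))))
    all_goals
      simp only [NatExpr.eval_var, h6, h7, Memory.setNat_nat, show (6 : ℕ) ≠ 1 by decide, false_and,
        if_false, NatExpr.eval_const]
      simp only [Test.Holds, NatExpr.eval_var, NatExpr.eval_const, h9, h7, h6, Memory.setNat_nat,
        show (9 : ℕ) ≠ 1 by decide, false_and, if_false] at h7'
      split_ifs at h7' with hc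
    · refine ⟨(((Memory.AgreesOff.refl _ _ s).trans h1).setNat _ _ _).setNat _ _ _, _, ⟨?_, ?_⟩, hstep,
        .inr ⟨hcard, i, hi⟩⟩
      · intro k
        simpa [Instance.award] using howner k
      · intro k
        by_cases hk : k = i
        · subst hk; simp [Instance.award, hc]
        · have : (k : ℕ) ≠ i := fun h => hk (Fin.ext h)
          simp [Instance.award, hc, hk, this, hst1.flag k]
    · exact absurd h7' (by norm_num)
    · exact absurd le_rfl h7'
    · refine ⟨((Memory.AgreesOff.refl _ _ s).trans h1).setNat _ _ _, _, ⟨howner, ?_⟩, hstep,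
        .inr ⟨hcard, i, hi⟩⟩
      intro k
      simp [Instance.award, hc, hst1.flag k]
  · simp only [Test.Holds, NumExpr.eval_const, NumExpr.eval_var, Rat.cast_zero] at ht
    refine ⟨(Memory.AgreesOff.refl _ _ s).trans h1, st, hst1, hr, ?_⟩
    by_contra! hc
    obtain ⟨⟨i, hi⟩, hc⟩ := hc
    -- If no item is free, truncated subtraction makes the decrease of the cardinality hold
    -- trivially. Hence there is a free item and an unsatisfied agent, whose nonnegative bid
    -- contradicts the sentinel.
    obtain ⟨j, hj⟩ := Finset.card_pos.1 (show 0 < (free n st.owner).card by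
      by_contra h0
      exact (hc (by omega) i).not_gt hi)
    exact ht ((hbid i j hi).trans (hb.2 i j i.2 (mem_free.1 hj) hi))

/-- As long as someone is unsatisfied, each round allocates an item, so `m` rounds suffice. A missed
target therefore implies that all items are allocated, as the share bounds require. -/
theorem game_spec (hI : I.IsSubmodular) (hφ0 : ∀ f r, 0 ≤ r → 0 ≤ φ f r)
    (hφ : ComputesBid φ bidProg) (hP : Admissible I φ P)
    (hU : ∀ i, IsLeastPositive (I.value i) (fun _ => True) (I.value i (U i))) (hM : n + m ≤ M)
    (hs : HoldsData I (I.targets U e) (fun i => I.value i (U i)) s) :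
    Triple I P M (game bidProg) s fun s' =>
      s.AgreesOff [1, 2, 3, 4, 5, 6, 7, 8, 9, 12] [4, 5, 6, 7, 8, 9] s' ∧
      ∃ st', HoldsState st' s' ∧ Reachable I φ (I.targets U e) st' ∧
        ((∀ i, I.targets U e i ≤ I.value i (held st'.owner i)) ∨ ∀ j, st'.owner j < n) := by
  refine Triple.cons (Triple.forLoop (fun k s' => s.AgreesOff [1, 4] [] s' ∧ s'.nat 4 0 = k ∧
    ∀ j < k, s'.nat 1 j = n) (B := m) (by omega)
    ⟨(Memory.AgreesOff.refl _ _ s).setNat _ _ _, by simp, by simp⟩ ?_ ?_ ?_)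
  · rintro k s' ⟨h1, h2, -⟩
    exact ⟨h2, (hs.of_agreesOff h1).items⟩
  · rintro k s' hk ⟨h1, h2, h3⟩
    refine Triple.setNat ⟨by simp [h2], (h1.setNat _ _ _).setNat _ _ _, by simp, fun j hj => ?_⟩
    by_cases hjk : j = k
    · simp [hjk, h2, (hs.of_agreesOff h1).agents]
    · simp [hjk, h2, h3 j (by omega)]
  rintro s1 ⟨h1, -, ho1⟩
  refine Triple.cons (Triple.forLoop (fun k s' => s.AgreesOff [1, 3, 4, 8] [] s' ∧ s'.nat 3 0 = k ∧
    (∀ j < m, s'.nat 1 j = n) ∧ ∀ i < k, s'.nat 8 i = 0) (B := n) (by omega)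
    ⟨((Memory.AgreesOff.refl _ _ s).trans h1).setNat _ _ _, by simp, by simpa using ho1, by simp⟩ ?_ ?_ ?_)
  · rintro k s' ⟨h1, h2, -⟩
    exact ⟨h2, (hs.of_agreesOff h1).agents⟩
  · rintro k s' hk ⟨h1, h2, h3, h4⟩
    refine Triple.setNat ⟨by simp [h2], (h1.setNat _ _ _).setNat _ _ _, by simp, by simpa using h3,
      fun j hj => ?_⟩
    by_cases hjk : j = k
    · simp [hjk, h2]
    · simp [hjk, h2, h4 j (by omega)]
  rintro s2 ⟨h2, -, ho2, hf2⟩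
  refine Triple.cons (Triple.forLoop (fun k s' =>
    s.AgreesOff [1, 2, 3, 4, 5, 6, 7, 8, 9, 12] [4, 5, 6, 7, 8, 9] s' ∧ s'.nat 5 0 = k ∧
      ∃ st', HoldsState st' s' ∧ Reachable I φ (I.targets U e) st' ∧
        ((∀ i, I.targets U e i ≤ I.value i (held st'.owner i)) ∨
          (free n st'.owner).card ≤ m - k)) (B := m) (by omega) ?_ ?_ ?_ ?_)
  · refine ⟨((Memory.AgreesOff.refl _ _ s).trans h2).setNat _ _ _, by simp,
      ⟨fun _ => n, fun _ => 0, fun _ => 0⟩, ⟨fun j => ?_, fun i => ?_⟩, .init, .inr ?_⟩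
    · simpa using ho2 j j.2
    · simpa using hf2 i i.2
    · exact (Finset.card_le_univ _).trans (by simp)
  · rintro k s' ⟨h1, h2, -⟩
    exact ⟨h2, (hs.of_agreesOff h1).items⟩
  · rintro k s' hk ⟨h3, h4, st, hst, hr, hprog⟩
    refine (gameRound_spec hI hφ0 hφ hP hU hM (hs.of_agreesOff h3) hst hr).mono ?_
    rintro s'' ⟨h5, st', hst', hr', hprog'⟩
    have h6 : s''.AgreesOff [5] [] (s''.setNat 5 0 (k + 1)) :=
      (Memory.AgreesOff.refl _ _ s'').setNat _ _ _
    have h7 := hst'.of_agreesOff h6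
    refine ⟨by rw [h5.nat 5 (by simp), h4], (h3.trans h5).setNat _ _ _, by simp, ?_⟩
    by_cases hsat : ∀ i, I.targets U e i ≤ I.value i (held st'.owner i)
    · exact ⟨st', h7, hr', .inl hsat⟩
    · refine ⟨st', h7, hr', .inr ?_⟩
      have h8 := hprog'.resolve_left hsat
      rcases hprog with hprog | hprog
      · obtain ⟨-, i, hi⟩ := h8
        exact absurd (hprog i) hi.not_ge
      · omega
  · rintro s' ⟨h1, -, st, hst, hr, hprog⟩
    refine Triple.nil ⟨h1, st, hst, hr, hprog.imp_right fun h j => ?_⟩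
    by_contra! hj
    have := Finset.card_pos.2 ⟨j, mem_free.2 hj⟩
    omega

end Game

/-! ### Lowering the targets, and the whole algorithm -/

section Main

variable {I : Instance n m} {φ : ℕ → ℝ → ℝ} {bidProg : Program} {P : ℝ → Prop} {M : ℕ}
  {s : Memory} {U : Fin n → Finset (Fin m)} {e : Fin n → ℕ} {o : Fin m → ℕ}

open Classical in
/-- The numbers of decreases of the targets, after those agents among the first `k` that miss their
target have decreased it. -/
noncomputable def Instance.decreases (I : Instance n m) (U : Fin n → Finset (Fin m))
    (e : Fin n → ℕ) (o : Fin m → ℕ) (k : ℕ) (i : Fin n) : ℕ :=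
  if (i : ℕ) < k ∧ I.value i (held o i) < I.targets U e i then e i + 1 else e i

open Classical in
theorem updateTargets_spec (hP : Admissible I φ P)
    (hU : ∀ i, IsLeastPositive (I.value i) (fun _ => True) (I.value i (U i))) (hM : n + m ≤ M)
    (hs : HoldsData I (I.targets U e) (fun i => I.value i (U i)) s) (ho : HoldsOwner o s) :
    Triple I P M updateTargets s fun s' => s.AgreesOff [2, 3, 10, 12] [1, 4] s' ∧
      HoldsData I (I.targets U (I.decreases U e o n)) (fun i => I.value i (U i)) s' ∧
      s'.nat 10 0 = if ∃ i, I.value i (held o i) < I.targets U e i then 1 else 0 := by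
  refine Triple.cons (Triple.setNat (Triple.cons (Triple.forLoop (fun k s' =>
    s.AgreesOff [2, 3, 10, 12] [1, 4] s' ∧ s'.nat 3 0 = k ∧
      HoldsData I (I.targets U (I.decreases U e o k)) (fun i => I.value i (U i)) s' ∧
      s'.nat 10 0 = if ∃ i : Fin n, (i : ℕ) < k ∧ I.value i (held o i) < I.targets U e i
        then 1 else 0) (B := n) (by omega) ?_ ?_ ?_ ?_)))
  · refine ⟨((Memory.AgreesOff.refl _ _ s).setNat _ _ _).setNat _ _ _, by simp, ?_, by simp⟩
    have : I.decreases U e o 0 = e := by funext i; simp [Instance.decreases]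
    rw [this]
    exact hs.of_agreesOff (A := [10, 3]) (B := [])
      (((Memory.AgreesOff.refl _ _ s).setNat _ _ _).setNat _ _ _)
  · rintro k s' ⟨-, h2, h3, -⟩
    exact ⟨h2, h3.agents⟩
  · rintro k s' hk ⟨h1, h2, h3, h4⟩
    have ho' : HoldsOwner o s' := by unfold HoldsOwner; rw [h1.nat 1 (by simp)]; exact ho
    set i : Fin n := ⟨k, hk⟩ with hi
    have hlast : ∀ i' : Fin n, (i' : ℕ) < k + 1 ↔ (i' : ℕ) < k ∨ i' = i := fun i' => by
      rw [Nat.lt_succ_iff_lt_or_eq, hi, Fin.ext_iff]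
    -- Targets are updated agent by agent; agent `k` still has her old target when her turn comes.
    have hcur : I.targets U (I.decreases U e o k) i = I.targets U e i := by
      simp [Instance.targets, Instance.decreases, hi]
    have hold : ∀ i', i' ≠ i → I.targets U (I.decreases U e o (k + 1)) i' =
        I.targets U (I.decreases U e o k) i' := fun i' hi' => by
      have : I.decreases U e o (k + 1) i' = I.decreases U e o k i' := by
        simp only [Instance.decreases, hlast, hi', or_false]
      rw [Instance.targets, this]; rfl
    refine Triple.cons (queryHeld_spec (by omega) h3.items ho' i h2 fun s1 h5 _ hx => ?_)
    have hd := h3.of_agreesOff h5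
    have h13 : s1.nat 3 0 = i := by rw [h5.nat 3 (by simp), h2]
    have h10 : s1.nat 10 0 = s'.nat 10 0 := by rw [h5.nat 10 (by simp)]
    have h1' := h1.trans h5
    refine Triple.cons (Triple.ite ?_ (fun ht => ?_) (fun ht => Triple.skip (Triple.nil ?_)))
    · simp only [Test.all_numLt, NumExpr.All, NumExpr.all_var, NatExpr.eval_var, h13, hd.target, hx]
      exact ⟨hP.target _ _ (hU _) _, hP.value _ _⟩
    · simp only [Test.holds_numLt, NumExpr.eval_var, NumExpr.eval_get, NatExpr.eval_var, h13,
        hd.target, hx, hcur] at ht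
      have hnew : I.targets U (I.decreases U e o (k + 1)) i = nextTarget n m (I.value i (U i))
          (I.targets U e i) := by
        have : I.decreases U e o (k + 1) i = e i + 1 := by
          rw [Instance.decreases, if_pos ⟨(hlast i).2 (.inr rfl), ht⟩]
        rw [Instance.targets, this]; rfl
      have hany : ∃ i' : Fin n, (i' : ℕ) < k + 1 ∧ I.value i' (held o i') < I.targets U e i' :=
        ⟨i, (hlast i).2 (.inr rfl), ht⟩
      have h3P : P ((3 : ℚ) : ℝ) := hP.const 3 (ratBitLength_le (by norm_num) (by norm_num))
      have h0P : P ((0 : ℚ) : ℝ) := hP.const 0 (ratBitLength_le (by norm_num) (by norm_num))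
      have hmul := hP.target_mul i (U i) (hU i) (e i)
      have hmul3 := hP.target_mul_mul i (U i) (hU i) (e i)
      change P (I.targets U e i * targetRate n m) at hmul
      change P (3 * (I.targets U e i * targetRate n m)) at hmul3
      -- the memory in which the target of agent `i` is `t`
      have hfin : ∀ (s2 : Memory) (t : ℝ), s1.AgreesOff [10] [1] s2 → s2.nat 10 0 = 1 →
          (∀ l, s2.num 1 l = if l = i then t else s1.num 1 l) →
          t = nextTarget n m (I.value i (U i)) (I.targets U e i) →
          s2.nat 3 0 = k ∧ s.AgreesOff [2, 3, 10, 12] [1, 4] (s2.setNat 3 0 (k + 1)) ∧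
          (s2.setNat 3 0 (k + 1)).nat 3 0 = k + 1 ∧
          HoldsData I (I.targets U (I.decreases U e o (k + 1))) (fun i => I.value i (U i))
            (s2.setNat 3 0 (k + 1)) ∧
          (s2.setNat 3 0 (k + 1)).nat 10 0 =
            if ∃ i : Fin n, (i : ℕ) < k + 1 ∧ I.value i (held o i) < I.targets U e i
              then 1 else 0 := by
        intro s2 t h6 h7 h8 h9
        refine ⟨by rw [h6.nat 3 (by simp), h13], (h1'.trans h6).setNat _ _ _, by simp, ?_,
          by rw [Memory.setNat_nat, if_neg (by simp), h7, if_pos hany]⟩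
        constructor
        · simpa [h6.nat 0] using hd.agents
        · simpa [h6.nat 0] using hd.items
        · simpa [h6.num 0] using hd.entitlement
        · intro i'
          rw [Memory.setNat_num, h8]
          by_cases hi' : i' = i
          · rw [hi', if_pos rfl, hnew, h9]
          · rw [if_neg (fun h => hi' (Fin.ext h)), hold i' hi', hd.target]
        · simpa [h6.num 2] using hd.least
        · simpa [h6.num 3] using hd.rate
      refine Triple.cons (Triple.setNat (Triple.cons (Triple.setNum ?_ (Triple.cons (Triple.ite ?_
        (fun hlt => Triple.setNum h0P (Triple.nil (Triple.nil (hfin _ 0 ?_ ?_ ?_ ?_))))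
        (fun hlt => Triple.skip (Triple.nil (Triple.nil
          (hfin _ (I.targets U e i * targetRate n m) ?_ ?_ ?_ ?_)))))))))
      · simp only [NumExpr.All, NumExpr.all_var, NumExpr.eval_var, NumExpr.eval_get,
          NatExpr.eval_var, Memory.setNat_nat, show (3 : ℕ) ≠ 10 by decide, false_and, if_false, h13,
          Memory.setNat_num, hd.target, hcur, hd.rate]
        exact ⟨hP.target _ _ (hU _) _, hP.rate, hmul⟩
      · simp only [Test.all_numLt, NumExpr.All, NumExpr.eval_mul, NumExpr.eval_const,
          NumExpr.eval_var, NumExpr.eval_get,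
          NatExpr.eval_var, Memory.setNat_nat, show (3 : ℕ) ≠ 10 by decide, false_and, if_false, h13,
          Memory.setNat_num, hd.target, hcur, hd.rate, Memory.setNum_num, Memory.setNum_nat,
          and_self, if_true, show (2 : ℕ) ≠ 1 by decide, hd.least, Rat.cast_ofNat]
        exact ⟨hP.value _ _, by simpa using h3P, hmul, hmul3⟩
      · exact (((Memory.AgreesOff.refl _ _ s1).setNat _ _ _).setNum _ _ _).setNum _ _ _
      · simp
      · intro l
        simp [h13]
        by_cases hl : l = i <;> simp [hl]
      · simp [h13, hd.target, hcur, hd.rate, hd.least] at hlt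
        rw [nextTarget, if_pos hlt]
      · exact ((Memory.AgreesOff.refl _ _ s1).setNat _ _ _).setNum _ _ _
      · simp
      · intro l
        simp [h13, hd.target, hcur, hd.rate]
      · simp [h13, hd.target, hcur, hd.rate, hd.least] at hlt
        rw [nextTarget, if_neg hlt.not_gt]
    · simp only [Test.holds_numLt, NumExpr.eval_var, NumExpr.eval_get, NatExpr.eval_var, h13,
        hd.target, hx, hcur] at ht
      have hsame : I.decreases U e o (k + 1) = I.decreases U e o k := by
        funext i'
        by_cases hi' : i' = i
        · subst hi'; simp [Instance.decreases, ht]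
        · simp only [Instance.decreases, hlast, hi', or_false]
      refine ⟨h13, h1'.setNat _ _ _, by simp, ?_, ?_⟩
      · rw [hsame]
        exact hd.of_agreesOff (A := [3]) (B := []) ((Memory.AgreesOff.refl _ _ s1).setNat _ _ _)
      · simp only [Memory.setNat_nat, show (10 : ℕ) ≠ 3 by decide, false_and, if_false, h10, h4]
        congr 1
        rw [eq_iff_iff]
        refine ⟨fun ⟨i', h, h'⟩ => ⟨i', h.trans (Nat.lt_succ_self k), h'⟩, fun ⟨i', h, h'⟩ => ?_⟩
        rcases (hlast i').1 h with h | rfl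
        · exact ⟨i', h, h'⟩
        · exact absurd h' ht
  · rintro s' ⟨h1, -, h3, h4⟩
    refine Triple.nil ⟨h1, h3, ?_⟩
    simpa using h4

/-- The recorded number is always the value of a bundle, a single item or the empty one, so its bit
length is that of an input value. The initial 0 stands for having met no item of positive value. -/
theorem leastValues_spec (hI : I.IsSubmodular) (hP : Admissible I φ P) (hM : n + m ≤ M)
    (hn : s.nat 0 0 = n) (hm : s.nat 0 1 = m) (h2 : ∀ j, s.nat 2 j = 0) (h2' : ∀ i, s.num 2 i = 0) :
    Triple I P M leastValues s fun s' => s.AgreesOff [2, 3, 4] [2, 5] s' ∧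
      ∃ U : Fin n → Finset (Fin m), ∀ i : Fin n, s'.num 2 i = I.value i (U i) ∧
        IsLeastPositive (I.value i) (fun _ => True) (I.value i (U i)) := by
  have h0P : P ((0 : ℚ) : ℝ) := hP.const 0 (ratBitLength_le (by norm_num) (by norm_num))
  refine Triple.forLoop (fun k s' => s.AgreesOff [2, 3, 4] [2, 5] s' ∧ s'.nat 3 0 = k ∧
    (∀ j < m, s'.nat 2 j = 0) ∧ (∀ i, k ≤ i → s'.num 2 i = 0) ∧
    ∀ i : Fin n, (i : ℕ) < k → ∃ U, s'.num 2 i = I.value i U ∧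
        IsLeastPositive (I.value i) (fun _ => True) (I.value i U)) (B := n) (by omega) ?_ ?_ ?_ ?_
  · exact ⟨(Memory.AgreesOff.refl _ _ s).setNat _ _ _, by simp, by simp [h2], by simp [h2'],
      by simp⟩
  · rintro k s' ⟨h1, h2, -⟩
    exact ⟨h2, by simp [h1.nat 0, hn]⟩
  · rintro k s' hk ⟨h3, h4, h5, h6, h7⟩
    set i : Fin n := ⟨k, hk⟩ with hi
    have hv := hI.value_submodular i
    refine Triple.forLoop (fun l s1 => s'.AgreesOff [2, 4] [2, 5] s1 ∧ s1.nat 4 0 = l ∧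
      (∀ j < m, s1.nat 2 j = 0) ∧ (∀ i', i' ≠ k → s1.num 2 i' = s'.num 2 i') ∧
      ∃ U, s1.num 2 i = I.value i U ∧
        IsLeastPositive (I.value i) (fun j => (j : ℕ) < l) (I.value i U)) (B := m) (by omega) ?_ ?_ ?_ ?_
    · refine ⟨(Memory.AgreesOff.refl _ _ s').setNat _ _ _, by simp, by simpa using h5, by simp, ∅, ?_,
        .inl ⟨hv.normalized, by simp⟩⟩
      rw [Memory.setNat_num, hv.normalized]; exact h6 k le_rfl
    · rintro l s1 ⟨h8, h9, -⟩
      exact ⟨h9, by simp [(h3.trans h8 (by simp) (by simp)).nat 0, hm]⟩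
    · rintro l s1 hl ⟨h8, h9, h10, h11, U, hU, hleast⟩
      have h13 : s1.nat 3 0 = i := by rw [h8.nat 3 (by simp), h4]
      set j : Fin m := ⟨l, hl⟩ with hj
      have hlast : ∀ j' : Fin m, (j' : ℕ) < l + 1 ↔ (j' : ℕ) < l ∨ j' = j := fun j' => by
        rw [Nat.lt_succ_iff_lt_or_eq, hj, Fin.ext_iff]
      refine Triple.cons (Triple.setNat (Triple.cons (Triple.query (Triple.cons (Triple.setNat ?_)))))
      have hq : I.oracle i ((s1.setNat 2 l 1).nat 2) = I.value i {j} := by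
        refine oracle_eq i _ _ fun j' => ?_
        by_cases hjj : j' = j
        · simp [hjj, hj]
        · have : (j' : ℕ) ≠ l := fun h => hjj (Fin.ext h)
          simp [hjj, this, h10 j' j'.2]
      simp only [NatExpr.eval_var, NatExpr.eval_const, h9, Memory.setNat_nat, Memory.setNum_nat, h13,
        show (3 : ℕ) ≠ 2 by decide, show (4 : ℕ) ≠ 2 by decide, false_and, if_false, hq]
      set s2 := ((s1.setNat 2 l 1).setNum 5 0 (I.value i {j})).setNat 2 l 0 with hs2
      have h14 : s1.AgreesOff [2, 4] [2, 5] s2 :=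
        (((Memory.AgreesOff.refl _ _ s1).setNat _ _ _).setNum _ _ _).setNat _ _ _
      have h15 : s2.num 5 0 = I.value i {j} := by simp [hs2]
      have h16 : ∀ j < m, s2.nat 2 j = 0 := fun j hj' => by simp [hs2, h10 j hj']
      have h17 : s2.num 2 = s1.num 2 := by funext j; simp [hs2]
      have h18 : s2.nat 3 0 = i := by rw [h14.nat 3 (by simp), h13]
      have h19 : s2.nat 4 0 = l := by simpa [hs2] using h9
      clear_value s2
      have h20 : s2.num 2 i = I.value i U := by rw [h17, hU]
      refine Triple.cons (Triple.ite ?_ (fun ht => Triple.setNum ?_ (Triple.nil ?_))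
        (fun ht => Triple.skip (Triple.nil ?_)))
      · simp only [Test.All, Test.all_numLt, NumExpr.All, NumExpr.all_var, NatExpr.eval_var, h18, h15,
          h20]
        exact ⟨⟨hP.value _ _, h0P⟩, ⟨hP.value _ _, h0P⟩, hP.value _ _, hP.value _ _⟩
      · rw [NumExpr.all_var, h15]; exact hP.value _ _
      · simp only [Test.Holds, Test.holds_numLt, NumExpr.eval_const, NumExpr.eval_var,
          NumExpr.eval_get, NatExpr.eval_var, h18, h15, h20, Rat.cast_zero, not_and, not_le] at ht
        refine ⟨by simpa using h19, ((h8.trans h14).setNum _ _ _).setNat _ _ _, by simp,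
          by simpa using h16, fun i' hi' => ?_, {j}, ?_, .inr ⟨ht.1, fun j' hj' hpos => ?_⟩⟩
        · simp [h18, hi, hi', h17, h11 i' hi']
        · simp [h18, h15]
        · rcases (hlast j').1 hj' with h | rfl
          · rcases hleast with ⟨-, hz⟩ | ⟨hz, hz'⟩
            · exact absurd hpos (hz j' h).not_gt
            · exact (ht.2 hz).le.trans (hz' j' h hpos)
          · exact le_rfl
      · simp only [Test.Holds, Test.holds_numLt, NumExpr.eval_const, NumExpr.eval_var,
          NumExpr.eval_get, NatExpr.eval_var, h18, h15, h20, Rat.cast_zero, not_and, not_le,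
          not_lt, Classical.not_imp] at ht
        refine ⟨h19, (h8.trans h14).setNat _ _ _, by simp, by simpa using h16,
          fun i' hi' => by simp [h17, h11 i' hi'], U, by simp [h20], ?_⟩
        rcases hleast with ⟨hz, hz'⟩ | ⟨hz, hz'⟩
        · refine .inl ⟨hz, fun j' hj' => ?_⟩
          rcases (hlast j').1 hj' with h | rfl
          · exact hz' j' h
          · by_contra! hc
            exact (ht hc).1.ne' hz
        · refine .inr ⟨hz, fun j' hj' hpos => ?_⟩
          rcases (hlast j').1 hj' with h | rfl
          · exact hz' j' h hpos
          · exact (ht hpos).2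
    · rintro s1 ⟨h8, h9, h10, h11, U, hU, hleast⟩
      refine ⟨by rw [h8.nat 3 (by simp), h4], (h3.trans h8).setNat _ _ _, by simp,
        by simpa using h10, fun i' hi' => ?_, fun i' hi' => ?_⟩
      · rw [Memory.setNat_num, h11 i' (by omega), h6 i' (by omega)]
      · by_cases hii : i' = i
        · subst hii
          refine ⟨U, by simpa using hU, ?_⟩
          simpa [IsLeastPositive] using hleast
        · have : (i' : ℕ) ≠ k := fun h => hii (Fin.ext h)
          obtain ⟨U', hU', hl'⟩ := h7 i' (by omega)
          exact ⟨U', by rw [Memory.setNat_num, h11 i' this, hU'], hl'⟩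
  · rintro s' ⟨h1, -, -, -, h4⟩
    choose U hU using fun i => h4 i i.2
    exact ⟨h1, U, hU⟩

theorem initialTargets_spec (hM : n + m ≤ M) (hn : s.nat 0 0 = n) (hm : s.nat 0 1 = m) :
    Triple I P M initialTargets s fun s' => s.AgreesOff [2, 3, 4] [1] s' ∧
      ∀ i : Fin n, s'.num 1 i = I.value i Finset.univ := by
  refine Triple.cons (Triple.forLoop (fun k s' => s.AgreesOff [2, 4] [] s' ∧ s'.nat 4 0 = k ∧
    ∀ j < k, s'.nat 2 j = 1) (B := m) (by omega)
    ⟨(Memory.AgreesOff.refl _ _ s).setNat _ _ _, by simp, by simp⟩ ?_ ?_ ?_)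
  · rintro k s' ⟨h1, h2, -⟩
    exact ⟨h2, by simp [h1.nat 0, hm]⟩
  · rintro k s' hk ⟨h1, h2, h3⟩
    refine Triple.setNat ⟨by simp [h2], (h1.setNat _ _ _).setNat _ _ _, by simp, fun j hj => ?_⟩
    by_cases hjk : j = k
    · simp [hjk, h2]
    · simp [hjk, h2, h3 j (by omega)]
  rintro s1 ⟨h1, -, h2⟩
  refine Triple.cons (Triple.forLoop (fun k s' => s.AgreesOff [2, 3, 4] [1] s' ∧ s'.nat 3 0 = k ∧
    (∀ j < m, s'.nat 2 j = 1) ∧ ∀ i : Fin n, (i : ℕ) < k → s'.num 1 i = I.value i Finset.univ)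
    (B := n) (by omega)
    ⟨((Memory.AgreesOff.refl _ _ s).trans h1).setNat _ _ _, by simp, by simpa using h2, by simp⟩ ?_ ?_ ?_)
  · rintro k s' ⟨h1, h2, -⟩
    exact ⟨h2, by simp [h1.nat 0, hn]⟩
  · rintro k s' hk ⟨h3, h4, h5, h6⟩
    have hq := oracle_eq (I := I) ⟨k, hk⟩ (s'.nat 2) Finset.univ fun j => by simp [h5 j j.2]
    refine Triple.query ⟨by simp [h4], (h3.setNum _ _ _).setNat _ _ _, by simp, by simpa using h5,
      fun i hi => ?_⟩
    by_cases hik : (i : ℕ) = k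
    · obtain rfl : i = ⟨k, hk⟩ := Fin.ext hik
      simpa [h4] using hq
    · simp [h4, hik, h6 i (by omega)]
  · rintro s' ⟨h3, -, -, h6⟩
    exact Triple.nil ⟨h3, fun i => h6 i i.2⟩

theorem rateProgram_spec (hP : Admissible I φ P) (hM : n + m ≤ M) (hn : s.nat 0 0 = n)
    (hm : s.nat 0 1 = m) (h3 : s.num 3 0 = 0) :
    Triple I P M rateProgram s fun s' => s.AgreesOff [3, 4] [3] s' ∧
      s'.num 3 0 = targetRate n m := by
  have h1P : P ((1 : ℚ) : ℝ) := hP.const 1 (ratBitLength_le (by norm_num) (by norm_num))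
  have h4P : P ((4 : ℚ) : ℝ) := hP.const 4 (ratBitLength_le (by norm_num) (by norm_num))
  refine Triple.cons (Triple.forLoop (fun k s' => s.AgreesOff [3, 4] [3] s' ∧ s'.nat 3 0 = k ∧
    s'.num 3 0 = (k : ℕ)) (B := n) (by omega)
    ⟨(Memory.AgreesOff.refl _ _ s).setNat _ _ _, by simp, by simp [h3]⟩ ?_ ?_ ?_)
  · rintro k s' ⟨h1, h2, -⟩
    exact ⟨h2, by simp [h1.nat 0, hn]⟩
  · rintro k s' hk ⟨h1, h2, h3⟩
    refine Triple.setNum ⟨?_, h1P, ?_⟩ ⟨by simp [h2], (h1.setNum _ _ _).setNat _ _ _, by simp,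
      by simp [h3]⟩
    · rw [NumExpr.all_var, h3]; exact hP.count k (by omega)
    · have := hP.count (k + 1) (by omega)
      simpa [h3] using this
  rintro s1 ⟨h1, -, h2⟩
  refine Triple.cons (Triple.forLoop (fun k s' => s.AgreesOff [3, 4] [3] s' ∧ s'.nat 4 0 = k ∧
    s'.num 3 0 = ((n + k : ℕ) : ℝ)) (B := m) (by omega)
    ⟨h1.setNat _ _ _, by simp, by simp [h2]⟩ ?_ ?_ ?_)
  · rintro k s' ⟨h1, h2, -⟩
    exact ⟨h2, by simp [h1.nat 0, hm]⟩
  · rintro k s' hk ⟨h1, h2, h3⟩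
    refine Triple.setNum ⟨?_, h1P, ?_⟩ ⟨by simp [h2], (h1.setNum _ _ _).setNat _ _ _, by simp,
      by simp [h3, add_assoc]⟩
    · rw [NumExpr.all_var, h3]; exact hP.count (n + k) (by omega)
    · have := hP.count (n + k + 1) (by omega)
      push_cast at this
      simpa [h3] using this
  rintro s2 ⟨h4, -, h5⟩
  push_cast at h5
  refine Triple.cons (Triple.setNum ?_ (Triple.nil ⟨h4.setNum _ _ _, ?_⟩))
  · have hN := hP.count (n + m) le_rfl
    push_cast at hN
    have h6 := hP.rate_mul
    have h7 := hP.rate_div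
    have h8 := hP.rate
    rw [targetRate] at h8
    simp only [NumExpr.All, NumExpr.all_var, NumExpr.eval_const, NumExpr.eval_mul,
      NumExpr.eval_div, NumExpr.eval_var, h5, Rat.cast_one, Rat.cast_ofNat]
    rw [Rat.cast_one] at h1P
    rw [Rat.cast_ofNat] at h4P
    exact ⟨h1P, ⟨h1P, ⟨h4P, hN, h6⟩, h7⟩, h8⟩
  · simp [h5, targetRate]

/-- If a bundle has positive value, then so has an item, and no bundle of positive value has a value
less than the least positive value of an item. -/
theorem IsLeastPositive.le {v : Finset (Fin m) → ℝ} (hv : IsSubmodularValuation v) {u : ℝ}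
    (hu : IsLeastPositive v (fun _ => True) u) {S : Finset (Fin m)} (hS : 0 < v S) :
    0 < u ∧ u ≤ v S := by
  have h1 := hv.le_add_sum_marginal S ∅
  rw [hv.normalized, Finset.sdiff_empty, zero_add] at h1
  obtain ⟨j, hj, hpos⟩ := Finset.exists_lt_of_sum_lt (f := fun _ => (0 : ℝ)) (s := S)
    (g := fun j => marginal v ∅ j) (by simpa using hS.trans_le h1)
  rw [hv.marginal_empty] at hpos
  have hle : v {j} ≤ v S := hv.monotone (Finset.singleton_subset_iff.2 hj)
  rcases hu with ⟨-, hz⟩ | ⟨hz, hz'⟩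
  · exact absurd hpos (hz j trivial).not_gt
  · exact ⟨hz, (hz' j trivial hpos).trans hle⟩

/-- The program `allocate` gives to every agent a fraction `1 / c` of her share. -/
theorem allocate_spec (hI : I.IsSubmodular) (hφ0 : ∀ f r, 0 ≤ r → 0 ≤ φ f r)
    (hφ : ComputesBid φ bidProg) (hP : Admissible I φ P) {c : ℝ} (hc0 : 0 ≤ c) (hc : c ≤ 3)
    {share : Fin n → ℝ}
    (hfail : ∀ θ st, Reachable I φ θ st → (∀ j, st.owner j < n) →
      ∀ i, I.value i (held st.owner i) < θ i → share i ≤ c * (θ i * targetRate n m))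
    (hshare : ∀ i, share i ≤ c * I.value i Finset.univ)
    (hvalue : ∀ i, share i = 0 ∨ ∃ S, share i = I.value i S) {D : ℕ}
    (hD : ∀ i S, IsLeastPositive (I.value i) (fun _ => True) (I.value i S) →
      targetSeq n m (I.value i Finset.univ) (I.value i S) D = 0)
    (hM : n + m + (n * D + 1) ≤ M) :
    Triple I P M (allocate bidProg) I.input fun s' => ∃ A : Fin m → Fin n, s'.Outputs A ∧
      ∀ i, share i ≤ c * I.value i (bundle A i) := by
  have hn : 0 < n := by
    rcases Nat.eq_zero_or_pos n with h | h
    · subst h; have := hI.sum_entitlement; simp at this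
    · exact h
  have hin : I.input.nat 0 0 = n := by simp [Instance.input]
  have him : I.input.nat 0 1 = m := by simp [Instance.input]
  refine Triple.cons ((rateProgram_spec hP (by omega) hin him (by simp [Instance.input])).mono ?_)
  rintro s1 ⟨h1, h1r⟩
  refine Triple.cons ((leastValues_spec hI hP (by omega) (by rw [h1.nat 0 (by simp), hin])
    (by rw [h1.nat 0 (by simp), him]) (by rw [h1.nat 2 (by simp)]; simp [Instance.input])
    (by rw [h1.num 2 (by simp)]; simp [Instance.input])).mono ?_)
  rintro s2 ⟨h2, U, hU⟩
  have h12 := ((Memory.AgreesOff.refl [2, 3, 4] [1, 2, 3, 5] _).trans h1).trans h2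
  refine Triple.cons ((initialTargets_spec (by omega) (by rw [h12.nat 0 (by simp), hin])
    (by rw [h12.nat 0 (by simp), him])).mono ?_)
  rintro s3 ⟨h3, h3v⟩
  have h13 := h12.trans h3
  have hd3 : HoldsData I (I.targets U fun _ => 0) (fun i => I.value i (U i)) s3 := by
    constructor
    · rw [h13.nat 0 (by simp), hin]
    · rw [h13.nat 0 (by simp), him]
    · intro i; rw [h13.num 0 (by simp)]; simp [Instance.input]
    · exact h3v
    · intro i; rw [h3.num 2 (by simp)]; exact (hU i).1
    · rw [h3.num 3 (by simp), h2.num 3 (by simp), h1r]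
  refine Triple.cons (Triple.setNat (Triple.cons (Triple.loop
    -- The termination measure counts the decreases still possible, plus the continuation flag: each
    -- pass lowers some target or clears the flag.
    (fun r s => ∃ e : Fin n → ℕ, (∀ i, e i ≤ D) ∧
      HoldsData I (I.targets U e) (fun i => I.value i (U i)) s ∧
      (∀ i, share i ≤ c * I.targets U e i) ∧ r = ∑ i, (D - e i) + s.nat 10 0 ∧
      (s.nat 10 0 = 1 ∨ (s.nat 10 0 = 0 ∧ ∃ o : Fin m → ℕ, HoldsOwner o s ∧
        ∀ i, I.targets U e i ≤ I.value i (held o i))))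
    (r := n * D + 1) (by omega) ?_ ?_ ?_ ?_)))
  · refine ⟨fun _ => 0, fun _ => Nat.zero_le _, ?_, hshare, by simp, .inl (by simp)⟩
    exact hd3.of_agreesOff (A := [10]) (B := []) ((Memory.AgreesOff.refl _ _ _).setNat _ _ _)
  · intros; trivial
  · rintro r s ⟨e, he, hd, hsh, rfl, h10⟩ ht
    have h10 : s.nat 10 0 = 1 := h10.resolve_right fun h => by
      simp [Test.Holds, h.1] at ht
    refine Triple.cons ((game_spec hI hφ0 hφ hP (fun i => (hU i).2) (by omega) hd).mono ?_)
    rintro s4 ⟨h4, st, hst, hr, hprog⟩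
    refine Triple.cons ((updateTargets_spec hP (fun i => (hU i).2) (by omega) (hd.of_agreesOff h4) hst.owner).mono ?_)
    rintro s5 ⟨h5, hd5, h5'⟩
    set e' := I.decreases U e st.owner n with he'
    -- After `D` decreases the target is 0, which no nonnegative value misses.
    have hlt : ∀ i, I.value i (held st.owner i) < I.targets U e i → e' i = e i + 1 ∧ e i < D := by
      intro i hi
      refine ⟨by rw [he', Instance.decreases, if_pos ⟨i.2, hi⟩], lt_of_le_of_ne (he i) fun h => ?_⟩
      have h0 : I.targets U e i = 0 := by rw [Instance.targets, h]; exact hD i _ (hU i).2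
      exact (((hI.value_submodular i).nonneg _).trans_lt hi).ne' h0
    have hge : ∀ i, ¬ I.value i (held st.owner i) < I.targets U e i → e' i = e i := by
      intro i hi
      rw [he', Instance.decreases, if_neg fun h => hi h.2]
    have he'D : ∀ i, e' i ≤ D := fun i => by
      by_cases hi : I.value i (held st.owner i) < I.targets U e i
      · rw [(hlt i hi).1]; exact (hlt i hi).2
      · rw [hge i hi]; exact he i
    have hsh' : ∀ i, share i ≤ c * I.targets U e' i := fun i => by
      by_cases hi : I.value i (held st.owner i) < I.targets U e i
      · have hall := hprog.resolve_left fun h => (h i).not_gt hi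
        have h6 := hfail _ st hr hall i hi
        have h7 : I.targets U e' i = nextTarget n m (I.value i (U i)) (I.targets U e i) := by
          rw [Instance.targets, (hlt i hi).1]; rfl
        rw [h7, nextTarget]
        split_ifs with h8
        · rw [mul_zero]
          by_contra! hpos
          obtain ⟨S, hS⟩ := (hvalue i).resolve_left hpos.ne'
          have h9 := ((hU i).2.le (hI.value_submodular i) (S := S) (by rw [← hS]; exact hpos)).2
          generalize I.targets U e i * targetRate n m = t at h6 h8
          have ht0 : 0 < t := by by_contra! ht0; nlinarith
          nlinarith
        · exact h6
      · rw [Instance.targets, hge i hi]; exact hsh i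
    refine Triple.nil ⟨_, ?_, e', he'D, hd5, hsh', rfl, ?_⟩
    · have hmono : ∀ i ∈ Finset.univ, D - e' i ≤ D - e i := fun i _ => by
        by_cases hi : I.value i (held st.owner i) < I.targets U e i
        · rw [(hlt i hi).1]; omega
        · rw [hge i hi]
      rw [h5', h10]
      split_ifs with hany
      · obtain ⟨i, hi⟩ := hany
        refine Nat.add_lt_add_right (Finset.sum_lt_sum hmono ⟨i, Finset.mem_univ i, ?_⟩) 1
        have := hlt i hi
        omega
      · exact Nat.lt_succ_of_le (Finset.sum_le_sum hmono)
    · rw [h5']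
      split_ifs with hany
      · exact .inl rfl
      · push Not at hany
        refine .inr ⟨rfl, st.owner, ?_, fun i => ?_⟩
        · unfold HoldsOwner; rw [h5.nat 1 (by simp)]; exact hst.owner
        · rw [Instance.targets, hge i (hany i).not_gt]; exact hany i
  · rintro r s ⟨e, he, hd, hsh, -, h10⟩ ht
    obtain ⟨-, o, ho, hsat⟩ := h10.resolve_left fun h => ht (by simp [Test.Holds, h])
    refine Triple.cons (Triple.forLoop (fun k s' => s.AgreesOff [1, 4] [] s' ∧ s'.nat 4 0 = k ∧
      ∀ j : Fin m, s'.nat 1 j = if (j : ℕ) < k ∧ n ≤ o j then 0 else o j) (B := m) (by omega)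
      ⟨(Memory.AgreesOff.refl _ _ s).setNat _ _ _, by simp,
        by simpa [HoldsOwner] using ho⟩ ?_ ?_ ?_)
    · rintro k s' ⟨h4, h5, -⟩
      exact ⟨h5, (hd.of_agreesOff h4).items⟩
    · rintro k s' hk ⟨h4, h5, h6⟩
      have hk' : s'.nat 1 k = o ⟨k, hk⟩ := by simpa using h6 ⟨k, hk⟩
      have hlast : ∀ j' : Fin m, (j' : ℕ) < k + 1 ↔ (j' : ℕ) < k ∨ (j' : ℕ) = k := fun j' =>
        Nat.lt_succ_iff_lt_or_eq
      refine Triple.ite trivial (fun ht => Triple.setNat ?_) (fun ht => Triple.skip ?_)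
      all_goals
        simp only [Test.Holds, NatExpr.eval_agents, NatExpr.eval_get, NatExpr.eval_var, h5,
          (hd.of_agreesOff h4).agents, hk'] at ht
      · refine ⟨by simp [h5], (h4.setNat _ _ _).setNat _ _ _, by simp, fun j => ?_⟩
        by_cases hjk : (j : ℕ) = k
        · obtain rfl : j = ⟨k, hk⟩ := Fin.ext hjk
          simp [h5, ht]
        · simp [h5, hjk, h6 j, hlast]
      · refine ⟨h5, h4.setNat _ _ _, by simp, fun j => ?_⟩
        by_cases hjk : (j : ℕ) = k
        · obtain rfl : j = ⟨k, hk⟩ := Fin.ext hjk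
          simp [ht, hk']
        · simp [hjk, h6 j, hlast]
    · rintro s' ⟨h4, -, h6⟩
      have hlt : ∀ j : Fin m, s'.nat 1 j < n := fun j => by
        rw [h6]; split_ifs with h
        · exact hn
        · have := j.2; omega
      -- Leftover items went to agent 0; by monotonicity this harms nobody.
      refine Triple.nil ⟨fun j => ⟨s'.nat 1 j, hlt j⟩, fun j => rfl, fun i => (hsh i).trans ?_⟩
      refine mul_le_mul_of_nonneg_left ((hsat i).trans ((hI.value_submodular i).monotone ?_)) hc0
      intro j hj
      rw [mem_held] at hj
      simp [bundle, Fin.ext_iff, h6, hj]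

end Main

/-! ### Bit lengths -/

/-- The number `x` is rational, of bit length at most `B`. -/
def HasBits (B : ℕ) (x : ℝ) : Prop := ∃ q : ℚ, x = q ∧ ratBitLength q ≤ B

theorem size_add_le {a b k : ℕ} (ha : a.size ≤ k) (hb : b.size ≤ k) : (a + b).size ≤ k + 1 := by
  rw [Nat.size_le] at *
  rw [pow_succ]; omega

theorem size_mul_le (a b : ℕ) : (a * b).size ≤ a.size + b.size := by
  rw [Nat.size_le, pow_add]
  exact Nat.mul_lt_mul'' (Nat.lt_size_self a) (Nat.lt_size_self b)

theorem ratBitLength_neg (q : ℚ) : ratBitLength (-q) = ratBitLength q := by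
  simp [ratBitLength]

theorem ratBitLength_mul_le (q r : ℚ) : ratBitLength (q * r) ≤ ratBitLength q + ratBitLength r := by
  have h1 : (q * r).num.natAbs ≤ q.num.natAbs * r.num.natAbs := by
    rw [Rat.mul_num, ← Int.natAbs_mul]
    exact (Int.natAbs_ediv_le_natAbs _ _)
  have h2 : (q * r).den ≤ q.den * r.den := by
    rw [Rat.mul_den]; exact Nat.div_le_self _ _
  have h3 := (Nat.size_le_size h1).trans (size_mul_le _ _)
  have h4 := (Nat.size_le_size h2).trans (size_mul_le _ _)
  unfold ratBitLength; omega

/-- The unreduced sum has numerator and denominator of the stated sizes, and reduction to lowest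
terms only shrinks them. -/
theorem ratBitLength_add_le (q r : ℚ) :
    ratBitLength (q + r) ≤ 2 * (ratBitLength q + ratBitLength r) + 1 := by
  have h1 : (q + r).num.natAbs ≤ q.num.natAbs * r.den + q.den * r.num.natAbs := by
    rw [Rat.num_add]
    refine (Int.natAbs_ediv_le_natAbs _ _).trans ((Int.natAbs_add_le _ _).trans (le_of_eq ?_))
    rw [Int.natAbs_mul, Int.natAbs_mul, Int.natAbs_natCast, Int.natAbs_natCast, mul_comm q.den]
  have h2 : (q + r).den ≤ q.den * r.den :=
    Nat.le_of_dvd (Nat.mul_pos q.pos r.pos) (Rat.add_den_dvd q r)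
  have h3 : (q.num.natAbs * r.den + q.den * r.num.natAbs).size ≤
      ratBitLength q + ratBitLength r + 1 := by
    refine size_add_le ((size_mul_le _ _).trans ?_) ((size_mul_le _ _).trans ?_) <;>
      (unfold ratBitLength; omega)
  have h4 := (Nat.size_le_size h1).trans h3
  have h5 := (Nat.size_le_size h2).trans (size_mul_le _ _)
  have h6 : ratBitLength (q + r) = (q + r).num.natAbs.size + (q + r).den.size := rfl
  have h7 : q.den.size ≤ ratBitLength q := Nat.le_add_left _ _
  have h8 : r.den.size ≤ ratBitLength r := Nat.le_add_left _ _
  omega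

theorem ratBitLength_inv (q : ℚ) : ratBitLength q⁻¹ = ratBitLength q := by
  rcases eq_or_ne q 0 with rfl | hq
  · simp
  · have h0 : q.num ≠ 0 := Rat.num_ne_zero.2 hq
    rw [ratBitLength, ratBitLength, Rat.num_inv, Rat.den_inv, if_neg h0, Int.natAbs_mul,
      Int.natAbs_sign_of_ne_zero h0, one_mul, Int.natAbs_natCast, add_comm]

namespace HasBits

variable {a b : ℕ} {x y : ℝ}

theorem mono (h : HasBits a x) (hab : a ≤ b) : HasBits b x := by
  obtain ⟨q, h1, h2⟩ := h
  exact ⟨q, h1, h2.trans hab⟩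

theorem mul (hx : HasBits a x) (hy : HasBits b y) : HasBits (a + b) (x * y) := by
  obtain ⟨q, rfl, hq⟩ := hx
  obtain ⟨r, rfl, hr⟩ := hy
  exact ⟨q * r, by push_cast; rfl, (ratBitLength_mul_le q r).trans (Nat.add_le_add hq hr)⟩

theorem div (hx : HasBits a x) (hy : HasBits b y) : HasBits (a + b) (x / y) := by
  obtain ⟨r, rfl, hr⟩ := hy
  exact hx.mul ⟨r⁻¹, by push_cast; rfl, (ratBitLength_inv r).trans_le hr⟩

theorem add (hx : HasBits a x) (hy : HasBits b y) : HasBits (2 * (a + b) + 1) (x + y) := by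
  obtain ⟨q, rfl, hq⟩ := hx
  obtain ⟨r, rfl, hr⟩ := hy
  exact ⟨q + r, by push_cast; rfl, (ratBitLength_add_le q r).trans (by omega)⟩

theorem sub (hx : HasBits a x) (hy : HasBits b y) : HasBits (2 * (a + b) + 1) (x - y) := by
  obtain ⟨r, rfl, hr⟩ := hy
  rw [sub_eq_add_neg]
  exact hx.add ⟨-r, by push_cast; rfl, (ratBitLength_neg r).trans_le hr⟩

theorem pow (hx : HasBits a x) (k : ℕ) : HasBits (2 + k * a) (x ^ k) := by
  induction k with
  | zero => exact ⟨1, by simp, by norm_num [ratBitLength]⟩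
  | succ k ih =>
    rw [pow_succ]
    exact (ih.mul hx).mono (by rw [Nat.succ_mul]; omega)

/-- A bound linear in `k` instead of `log k` is enough, since running times may be polynomial in `n`
and `m` themselves. -/
theorem natCast (k : ℕ) : HasBits (k + 1) (k : ℝ) := by
  refine ⟨k, by simp, ?_⟩
  have : k.size ≤ k := Nat.size_le.2 Nat.lt_two_pow_self
  simpa [ratBitLength] using this

theorem zero : HasBits 1 (0 : ℝ) := by simpa using natCast 0

end HasBits

/-! ### The sequence of targets -/

theorem targetRate_nonneg (h : 0 < n + m) : 0 ≤ targetRate n m := by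
  have : (1 : ℝ) ≤ n + m := by exact_mod_cast h
  rw [targetRate, sub_nonneg, div_le_one (by linarith)]; linarith

theorem hasBits_four_mul (n m : ℕ) : HasBits (n + m + 6) (4 * ((n : ℝ) + m)) := by
  have h := (HasBits.natCast 4).mul (HasBits.natCast (n + m))
  push_cast at h
  exact h.mono (by omega)

theorem hasBits_one_div (n m : ℕ) : HasBits (n + m + 8) (1 / (4 * ((n : ℝ) + m))) := by
  have h := (HasBits.natCast 1).div (hasBits_four_mul n m)
  rw [Nat.cast_one] at h
  exact h.mono (by omega)

theorem hasBits_targetRate (n m : ℕ) : HasBits (2 * (n + m) + 21) (targetRate n m) := by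
  have h := (HasBits.natCast 1).sub (hasBits_one_div n m)
  rw [Nat.cast_one] at h
  exact h.mono (by omega)

theorem targetSeq_eq (n m : ℕ) (v μ : ℝ) (e : ℕ) :
    targetSeq n m v μ e = 0 ∨ targetSeq n m v μ e = v * targetRate n m ^ e := by
  induction e with
  | zero => right; simp [targetSeq]
  | succ e ih =>
    rw [targetSeq, nextTarget]
    split_ifs
    · exact .inl rfl
    · rcases ih with h | h
      · left; rw [h, zero_mul]
      · right; rw [h, pow_succ]; ring

theorem targetSeq_eq_zero_of_le {v μ : ℝ} {d e : ℕ} (hd : targetSeq n m v μ d = 0) (h : d ≤ e) :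
    targetSeq n m v μ e = 0 := by
  induction e, h using Nat.le_induction with
  | base => exact hd
  | succ e _ ih => rw [targetSeq, nextTarget, ih]; simp

/-- With `N = 4 * (n + m)`, `(1 - 1 / N) ^ N ≤ exp (-1) < 1 / 2`: a block of `N` decreases at least
halves a target. -/
theorem targetRate_pow_le (h : 0 < n + m) (r : ℕ) :
    targetRate n m ^ (4 * (n + m) * r) ≤ (1 / 2) ^ r := by
  rw [pow_mul]
  refine pow_le_pow_left₀ (pow_nonneg (targetRate_nonneg h) _) ?_ r
  have h1 := Real.one_sub_div_pow_le_exp_neg (n := 4 * (n + m)) (t := 1)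
    (by exact_mod_cast (by omega : 1 ≤ 4 * (n + m)))
  have h2 := Real.exp_neg_one_lt_d9
  have h3 : targetRate n m = 1 - 1 / ((4 * (n + m) : ℕ) : ℝ) := by rw [targetRate]; push_cast; rfl
  rw [h3]; linarith

/-- A bound for the number of decreases of a target. -/
def maxDecreases (n m l : ℕ) : ℕ := 4 * (n + m) * (l + 3)

/-- Let `l = Nat.log 2 K`. After `l + 3` halvings a target that has not been reset is at most `K * v
S / 2 ^ (l + 3) ≤ v S / 4`, as `K < 2 ^ (l + 1)`. Three times this is below `v S`, so the last
decrease resets it to 0. -/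
theorem targetSeq_maxDecreases {v : Finset (Fin m) → ℝ} (hv : IsSubmodularValuation v) (h : 0 < n + m)
    {K : ℕ} (hK : ∀ S, 0 < v S → v Finset.univ ≤ K * v S) {S : Finset (Fin m)}
    (hS : IsLeastPositive v (fun _ => True) (v S)) :
    targetSeq n m (v Finset.univ) (v S) (maxDecreases n m (Nat.log 2 K)) = 0 := by
  have hrate := targetRate_nonneg h
  rcases (targetSeq_eq n m (v Finset.univ) (v S) (maxDecreases n m (Nat.log 2 K))) with h0 | h0
  · exact h0
  rcases (hv.nonneg Finset.univ).eq_or_lt with hz | hpos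
  · rw [h0, ← hz, zero_mul]
  have hSpos : 0 < v S := (hS.le hv hpos).1
  have hle : targetRate n m ^ maxDecreases n m (Nat.log 2 K) ≤ (1 / 2) ^ (Nat.log 2 K + 3) :=
    targetRate_pow_le h _
  have hK2 : (K : ℝ) < 2 ^ (Nat.log 2 K + 1) := by
    exact_mod_cast Nat.lt_pow_succ_log_self (by norm_num) K
  have hd : maxDecreases n m (Nat.log 2 K) ≠ 0 := by unfold maxDecreases; positivity
  obtain ⟨d, hd⟩ := Nat.exists_eq_succ_of_ne_zero hd
  have hsmall : v Finset.univ * targetRate n m ^ maxDecreases n m (Nat.log 2 K) ≤ v S / 4 := by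
    calc v Finset.univ * targetRate n m ^ maxDecreases n m (Nat.log 2 K)
        ≤ (K * v S) * (1 / 2) ^ (Nat.log 2 K + 3) :=
          mul_le_mul (hK S hSpos) hle (pow_nonneg hrate _) (by positivity)
      _ ≤ (2 ^ (Nat.log 2 K + 1) * v S) * (1 / 2) ^ (Nat.log 2 K + 3) := by gcongr
      _ = v S / 4 := by
        rw [one_div, inv_pow, pow_succ, pow_add]; field_simp; norm_num
  rw [← h0, hd, targetSeq, nextTarget] at hsmall
  rw [hd, targetSeq, nextTarget]
  split_ifs at hsmall ⊢ with hc
  · rfl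
  · linarith

/-! ### The bids -/

/-- The program for the bids for the AnyPrice share. -/
def apsBidProgram : Program :=
  .ite (.numLe (.const 1) (.var 6)) (.setNum 7 (.const 0) (.const 1))
    (.setNum 7 (.const 0) (.mul (.const (1 / 2)) (.var 6)))

/-- The program for the bids for the maximin share. -/
def mmsBidProgram : Program :=
  .ite (.natLe (.get 8 (.var 3)) (.const 0))
    (.ite (.numLe (.const 1) (.var 6)) (.setNum 7 (.const 0) (.const 1))
      (.ite (.numLe (.const (7 / 10)) (.var 6)) (.setNum 7 (.const 0) (.const (8 / 15)))
        (.setNum 7 (.const 0) (.mul (.const (2 / 3)) (.var 6)))))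
    (.ite (.numLe (.const (3 / 10)) (.var 6)) (.setNum 7 (.const 0) (.const (7 / 15)))
      (.setNum 7 (.const 0) (.mul (.const (7 / 9)) (.var 6))))

theorem computesBid_aps : ComputesBid apsBid apsBidProgram := by
  intro n m I P M s Q hconst hr hmul h
  have h1 := hconst 1 (ratBitLength_le (by norm_num) (by norm_num))
  have h2 := hconst (1 / 2) (ratBitLength_le (by norm_num) (by norm_num))
  have h2' := hmul (1 / 2) (ratBitLength_le (by norm_num) (by norm_num))
  refine Triple.ite ⟨h1, hr⟩ (fun ht => Triple.setNum h1 ?_)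
    (fun ht => Triple.setNum ⟨h2, hr, h2'⟩ ?_)
  all_goals
    simp only [Test.Holds, NumExpr.eval_const, NumExpr.eval_var, Rat.cast_one] at ht
    simpa [apsBid, ht] using h

theorem computesBid_mms : ComputesBid mmsBid mmsBidProgram := by
  intro n m I P M s Q hconst hr hmul h
  have h1 := hconst 1 (ratBitLength_le (by norm_num) (by norm_num))
  have h2 := hconst (7 / 10) (ratBitLength_le (by norm_num) (by norm_num))
  have h3 := hconst (8 / 15) (ratBitLength_le (by norm_num) (by norm_num))
  have h4 := hconst (2 / 3) (ratBitLength_le (by norm_num) (by norm_num))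
  have h4' := hmul (2 / 3) (ratBitLength_le (by norm_num) (by norm_num))
  have h5 := hconst (3 / 10) (ratBitLength_le (by norm_num) (by norm_num))
  have h6 := hconst (7 / 15) (ratBitLength_le (by norm_num) (by norm_num))
  have h7 := hconst (7 / 9) (ratBitLength_le (by norm_num) (by norm_num))
  have h7' := hmul (7 / 9) (ratBitLength_le (by norm_num) (by norm_num))
  refine Triple.ite trivial
    (fun hf => Triple.ite ⟨h1, hr⟩ (fun ht => Triple.setNum h1 ?_)
      (fun ht => Triple.ite ⟨h2, hr⟩ (fun ht' => Triple.setNum h3 ?_)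
        (fun ht' => Triple.setNum ⟨h4, hr, h4'⟩ ?_)))
    (fun hf => Triple.ite ⟨h5, hr⟩ (fun ht => Triple.setNum h6 ?_)
      (fun ht => Triple.setNum ⟨h7, hr, h7'⟩ ?_))
  all_goals
    simp [Test.Holds] at hf ht
    try simp [Test.Holds] at ht'
    have h' := h
    unfold mmsBid at h'
  · simpa [hf, ht] using h'
  · simpa [hf, ht.not_ge, ht'] using h'
  · simpa [hf, ht.not_ge, ht'.not_ge] using h'
  · simpa [hf, ht] using h'
  · simpa [hf, ht.not_ge] using h'

/-- Every bid is a constant or a constant multiple of the value. -/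
def IsPiecewiseLinear (φ : ℕ → ℝ → ℝ) : Prop :=
  ∀ f r, ∃ q : ℚ, ratBitLength q ≤ 16 ∧ (φ f r = q ∨ φ f r = q * r)

theorem isPiecewiseLinear_aps : IsPiecewiseLinear apsBid := by
  intro f r
  unfold apsBid
  split_ifs
  · exact ⟨1, ratBitLength_le (by norm_num) (by norm_num), .inl (by simp)⟩
  · exact ⟨1 / 2, ratBitLength_le (by norm_num) (by norm_num), .inr (by simp)⟩

theorem isPiecewiseLinear_mms : IsPiecewiseLinear mmsBid := by
  intro f r
  unfold mmsBid
  split_ifs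
  · exact ⟨1, ratBitLength_le (by norm_num) (by norm_num), .inl (by simp)⟩
  · exact ⟨8 / 15, ratBitLength_le (by norm_num) (by norm_num), .inl (by simp)⟩
  · exact ⟨2 / 3, ratBitLength_le (by norm_num) (by norm_num), .inr (by simp)⟩
  · exact ⟨7 / 15, ratBitLength_le (by norm_num) (by norm_num), .inl (by simp)⟩
  · exact ⟨7 / 9, ratBitLength_le (by norm_num) (by norm_num), .inr (by simp)⟩

/-- A bound for the bit length of the targets. -/
def targetBits (n m d L : ℕ) : ℕ := (d + 1) * (2 * (n + m) + 21) + L + 16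

/-- A nonzero target has undergone at most `d` decreases, so it is an input value times at most the
`d`-th power of the rate. Every other number arises from targets and inputs by boundedly many
operations, which the factor 8 absorbs. The predicate quantifies over `L`, so that it makes sense
for real data too, where it may be vacuous. -/
theorem admissible_of_hasBits {I : Instance n m} {φ : ℕ → ℝ → ℝ} (hφ : IsPiecewiseLinear φ) {d : ℕ}
    (hd : ∀ i S, IsLeastPositive (I.value i) (fun _ => True) (I.value i S) →
      targetSeq n m (I.value i Finset.univ) (I.value i S) d = 0) :
    Admissible I φ fun x => ∀ L, I.RationalOfBitLength L → HasBits (8 * targetBits n m d L) x := by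
  have hconst : ∀ L (q : ℚ), ratBitLength q ≤ 16 → HasBits (targetBits n m d L) (q : ℝ) :=
    fun L q hq => ⟨q, rfl, hq.trans (by unfold targetBits; omega)⟩
  have hS : ∀ L, d * (2 * (n + m) + 21) + (2 * (n + m) + 21) + L + 16 = targetBits n m d L :=
    fun L => by unfold targetBits; ring
  have hent : ∀ L, I.RationalOfBitLength L → ∀ i, HasBits (targetBits n m d L) (I.entitlement i) :=
    fun L hL i => by
      obtain ⟨q, h1, h2⟩ := hL.1 i
      exact ⟨q, h1, h2.trans (by unfold targetBits; omega)⟩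
  have hval : ∀ L, I.RationalOfBitLength L → ∀ i S, HasBits L (I.value i S) :=
    fun L hL i S => hL.2 i S
  have hval' : ∀ L, I.RationalOfBitLength L → ∀ i S, HasBits (targetBits n m d L) (I.value i S) :=
    fun L hL i S => (hval L hL i S).mono (by unfold targetBits; omega)
  have htar : ∀ L, I.RationalOfBitLength L → ∀ i U,
      IsLeastPositive (I.value i) (fun _ => True) (I.value i U) → ∀ e,
      HasBits (L + 2 + d * (2 * (n + m) + 21))
        (targetSeq n m (I.value i Finset.univ) (I.value i U) e) := by
    intro L hL i U hU e
    rcases le_total d e with hde | hde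
    · rw [targetSeq_eq_zero_of_le (hd i U hU) hde]
      exact HasBits.zero.mono (by omega)
    · rcases targetSeq_eq n m (I.value i Finset.univ) (I.value i U) e with h | h
      · rw [h]; exact HasBits.zero.mono (by omega)
      · rw [h]
        refine ((hval L hL i _).mul ((hasBits_targetRate n m).pow e)).mono ?_
        have := Nat.mul_le_mul_right (2 * (n + m) + 21) hde
        omega
  have htar' : ∀ L, I.RationalOfBitLength L → ∀ i U,
      IsLeastPositive (I.value i) (fun _ => True) (I.value i U) → ∀ e,
      HasBits (targetBits n m d L) (targetSeq n m (I.value i Finset.univ) (I.value i U) e) :=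
    fun L hL i U hU e => (htar L hL i U hU e).mono (by have := hS L; omega)
  have hsub : ∀ L, I.RationalOfBitLength L → ∀ i S T,
      HasBits (5 * targetBits n m d L) (I.value i S - I.value i T) := fun L hL i S T =>
    ((hval' L hL i S).sub (hval' L hL i T)).mono (by have := hS L; omega)
  have hdiv : ∀ L, I.RationalOfBitLength L → ∀ i U,
      IsLeastPositive (I.value i) (fun _ => True) (I.value i U) → ∀ S T e,
      HasBits (6 * targetBits n m d L) ((I.value i S - I.value i T) /
        targetSeq n m (I.value i Finset.univ) (I.value i U) e) := fun L hL i U hU S T e =>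
    ((hsub L hL i S T).div (htar' L hL i U hU e)).mono (by omega)
  have hmul : ∀ L, I.RationalOfBitLength L → ∀ i U,
      IsLeastPositive (I.value i) (fun _ => True) (I.value i U) → ∀ S T e (q : ℚ),
      ratBitLength q ≤ 16 → HasBits (7 * targetBits n m d L) (q * ((I.value i S - I.value i T) /
        targetSeq n m (I.value i Finset.univ) (I.value i U) e)) := fun L hL i U hU S T e q hq =>
    ((hconst L q hq).mul (hdiv L hL i U hU S T e)).mono (by omega)
  have hrel : ∀ L, I.RationalOfBitLength L → ∀ i U,
      IsLeastPositive (I.value i) (fun _ => True) (I.value i U) → ∀ S T e f,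
      HasBits (7 * targetBits n m d L) (φ f ((I.value i S - I.value i T) /
        targetSeq n m (I.value i Finset.univ) (I.value i U) e)) := fun L hL i U hU S T e f => by
    obtain ⟨q, hq, h | h⟩ := hφ f ((I.value i S - I.value i T) /
        targetSeq n m (I.value i Finset.univ) (I.value i U) e)
    · rw [h]; exact (hconst L q hq).mono (by omega)
    · rw [h]; exact hmul L hL i U hU S T e q hq
  constructor
  · exact fun q hq L _ => (hconst L q hq).mono (by omega)
  · exact fun k hk L _ => (HasBits.natCast k).mono (by have := hS L; omega)
  · exact fun L _ => (hasBits_four_mul n m).mono (by have := hS L; omega)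
  · exact fun L _ => (hasBits_one_div n m).mono (by have := hS L; omega)
  · exact fun L _ => (hasBits_targetRate n m).mono (by have := hS L; omega)
  · exact fun i L hL => (hent L hL i).mono (by omega)
  · exact fun i S L hL => (hval' L hL i S).mono (by omega)
  · exact fun i U hU e L hL => (htar' L hL i U hU e).mono (by omega)
  · exact fun i U hU e L hL => ((htar L hL i U hU e).mul (hasBits_targetRate n m)).mono
      (by have := hS L; omega)
  · refine fun i U hU e L hL => HasBits.mono ((HasBits.natCast 3).mul
      ((htar L hL i U hU e).mul (hasBits_targetRate n m))) ?_
    have := hS L; omega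
  · exact fun i S T L hL => (hsub L hL i S T).mono (by omega)
  · exact fun i U hU S T e L hL => (hdiv L hL i U hU S T e).mono (by omega)
  · exact fun i U hU S T e q hq L hL => (hmul L hL i U hU S T e q hq).mono (by omega)
  · exact fun i U hU S T e f L hL => (hrel L hL i U hU S T e f).mono (by omega)
  · exact fun i U hU S T e f L hL => ((hent L hL i).mul (hrel L hL i U hU S T e f)).mono (by omega)

/-! ### Ratio bounds -/

theorem Instance.exists_isRatioBound (I : Instance n m) : ∃ K, I.IsRatioBound K := by
  obtain ⟨K, hK⟩ := Finite.exists_le fun x : Fin n × Finset (Fin m) =>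
    ⌈I.value x.1 Finset.univ / I.value x.1 x.2⌉₊
  refine ⟨K, fun i S hS => ?_⟩
  rw [← div_le_iff₀ hS]
  exact (Nat.le_ceil _).trans (by exact_mod_cast hK (i, S))

/-- A value is at most its numerator, hence at most `2 ^ L`; a positive one is at least the
reciprocal of its denominator, hence at least `2 ^ (-L)`. Thus `log K` may be taken linear in `L`.
-/
theorem Instance.RationalOfBitLength.isRatioBound {I : Instance n m} {L : ℕ}
    (hL : I.RationalOfBitLength L) : I.IsRatioBound (2 ^ (2 * L)) := by
  intro i S hS
  obtain ⟨q, hq, hqL⟩ := hL.2 i Finset.univ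
  obtain ⟨r, hr, hrL⟩ := hL.2 i S
  have hr0 : 0 < r := by rw [hr] at hS; exact_mod_cast hS
  have h1 : q ≤ 2 ^ L := by
    have h2 : q.num.natAbs < 2 ^ L := Nat.size_le.1 (le_trans (Nat.le_add_right _ _) hqL)
    have h3 : q ≤ q.num.natAbs := by
      have h4 : q * q.den = q.num := Rat.mul_den_eq_num q
      have h5 : (1 : ℚ) ≤ q.den := by exact_mod_cast q.pos
      have h6 : (q.num : ℚ) ≤ q.num.natAbs := by
        rw [Nat.cast_natAbs]; exact_mod_cast le_abs_self q.num
      rcases le_total q 0 with h | h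
      · exact h.trans (Nat.cast_nonneg _)
      · nlinarith
    exact h3.trans (by exact_mod_cast h2.le)
  have h2 : 1 ≤ 2 ^ L * r := by
    have h3 : r.den < 2 ^ L := Nat.size_le.1 (le_trans (Nat.le_add_left _ _) hrL)
    have h4 : (1 : ℚ) ≤ r.den * r := by
      rw [mul_comm, Rat.mul_den_eq_num]
      exact_mod_cast Rat.num_pos.2 hr0
    refine h4.trans (mul_le_mul_of_nonneg_right ?_ hr0.le)
    exact_mod_cast h3.le
  rw [hq, hr]
  have h3 : q ≤ 2 ^ (2 * L) * r := by
    rw [two_mul, pow_add, mul_assoc]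
    exact h1.trans (le_mul_of_one_le_right (by positivity) h2)
  push_cast
  exact_mod_cast h3

/-! ### The algorithm -/

/-- A bound for the number of iterations of the loops, in terms of the input size. -/
noncomputable def iterationPoly : Polynomial ℕ :=
  .X + .X * (4 * .X * (2 * .X + 3)) + 1

/-- A bound for the bit length of the numbers, in terms of the input size. -/
noncomputable def bitPoly : Polynomial ℕ :=
  8 * ((4 * .X * (2 * .X + 3) + 1) * (2 * .X + 21) + .X + 16)

/-- The program never sees `K`. The analysis uses the least ratio bound, so one execution meets the
operation bound for every valid `K`, and the ratio bound derived from bit lengths gives the same for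
bit cost. -/
theorem hasPolyTimeAlgorithm_of_bids {φ : ℕ → ℝ → ℝ} {bidProg : Program}
    (hφ0 : ∀ f r, 0 ≤ r → 0 ≤ φ f r) (hφ : ComputesBid φ bidProg) (hlin : IsPiecewiseLinear φ)
    {C : ∀ {n m : ℕ}, Instance n m → Prop} {c : ℝ} (hc0 : 0 ≤ c) (hc : c ≤ 3)
    (share : ∀ {n m : ℕ}, Instance n m → Fin n → ℝ)
    (hC : ∀ {n m : ℕ} {I : Instance n m}, C I → I.IsSubmodular)
    (hfail : ∀ {n m : ℕ} {I : Instance n m}, C I → ∀ θ st, Reachable I φ θ st →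
      (∀ j, st.owner j < n) → ∀ i, I.value i (held st.owner i) < θ i →
      share I i ≤ c * (θ i * targetRate n m))
    (hshare : ∀ {n m : ℕ} {I : Instance n m}, C I → ∀ i, share I i ≤ c * I.value i Finset.univ)
    (hvalue : ∀ {n m : ℕ} {I : Instance n m}, C I → ∀ i, share I i = 0 ∨
      ∃ S, share I i = I.value i S)
    {Good : ∀ {n m : ℕ}, Instance n m → (Fin m → Fin n) → Prop}
    (hGood : ∀ {n m : ℕ} {I : Instance n m} {A : Fin m → Fin n}, C I →
      (∀ i, share I i ≤ c * I.value i (bundle A i)) → Good I A) :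
    HasPolyTimeAlgorithm C Good := by
  refine ⟨allocate bidProg, (allocate bidProg).bound.comp iterationPoly * (1 + 2 * bitPoly), ?_⟩
  intro n m I hCI
  have hI := hC hCI
  classical
  have hN : 0 < n + m := by
    rcases Nat.eq_zero_or_pos n with h | h
    · subst h; have := hI.sum_entitlement; simp at this
    · omega
  set K := Nat.find I.exists_isRatioBound
  have hK : I.IsRatioBound K := Nat.find_spec I.exists_isRatioBound
  have hKle : ∀ K', I.IsRatioBound K' → Nat.log 2 K ≤ Nat.log 2 K' := fun K' hK' =>
    Nat.log_mono_right (Nat.find_min' _ hK')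
  set d := maxDecreases n m (Nat.log 2 K) with hd
  have hD : ∀ i S, IsLeastPositive (I.value i) (fun _ => True) (I.value i S) →
      targetSeq n m (I.value i Finset.univ) (I.value i S) d = 0 := fun i S hS =>
    targetSeq_maxDecreases (hI.value_submodular i) hN (hK i) hS
  obtain ⟨s, ⟨A, hA, hA'⟩, hrun⟩ := allocate_spec hI hφ0 hφ (admissible_of_hasBits hlin hD) hc0 hc
    (hfail hCI) (hshare hCI) (hvalue hCI) hD le_rfl
  -- The factor 2 accommodates `Nat.log 2 (2 ^ (2 * L)) = 2 * L`, so that one polynomial serves both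
  -- costs.
  have hdle : ∀ y, n + m ≤ y → Nat.log 2 K ≤ 2 * y → d ≤ 4 * y * (2 * y + 3) := fun y h1 h2 => by
    rw [hd, maxDecreases]; gcongr
  clear_value d
  have hM : ∀ y, n + m ≤ y → Nat.log 2 K ≤ 2 * y →
      n + m + (n * d + 1) ≤ iterationPoly.eval y := fun y h1 h2 => by
    have h3 : n * d ≤ y * (4 * y * (2 * y + 3)) := Nat.mul_le_mul (by omega) (hdle y h1 h2)
    simp only [iterationPoly, Polynomial.eval_add, Polynomial.eval_mul, Polynomial.eval_X,
      Polynomial.eval_one, Polynomial.eval_ofNat]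
    omega
  refine ⟨s, A, hA, hGood hCI hA', fun K' hK' => ?_, fun L hL => ?_⟩
  · obtain ⟨t, ht, ht'⟩ := hrun unitCost 0 fun _ _ => le_rfl
    refine ⟨t, ht, ht'.trans ?_⟩
    have h1 := hKle K' hK'
    rw [Polynomial.eval_mul, Polynomial.eval_comp, Polynomial.eval_add, Polynomial.eval_one]
    exact Nat.mul_le_mul (polynomial_eval_mono _ (hM _ (by omega) (by omega))) (by omega)
  · obtain ⟨t, ht, ht'⟩ := hrun bitCost (8 * targetBits n m d L) fun x hx => by
      obtain ⟨q, rfl, hq⟩ := hx L hL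
      rw [bitCost_ratCast]; exact hq
    refine ⟨t, ht, ht'.trans ?_⟩
    have h1 := hKle _ hL.isRatioBound
    rw [Nat.log_pow (by norm_num)] at h1
    have h2 := hdle (n + m + L) (by omega) (by omega)
    have h3 : 8 * targetBits n m d L ≤ bitPoly.eval (n + m + L) := by
      simp only [bitPoly, targetBits, Polynomial.eval_add, Polynomial.eval_mul, Polynomial.eval_X,
        Polynomial.eval_one, Polynomial.eval_ofNat]
      have h4 : (d + 1) * (2 * (n + m) + 21) ≤
          (4 * (n + m + L) * (2 * (n + m + L) + 3) + 1) * (2 * (n + m + L) + 21) :=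
        Nat.mul_le_mul (by omega) (by omega)
      exact Nat.mul_le_mul_left 8 (Nat.add_le_add_right (Nat.add_le_add h4 (by omega)) 16)
    rw [Polynomial.eval_mul, Polynomial.eval_comp, Polynomial.eval_add, Polynomial.eval_one,
      Polynomial.eval_mul, Polynomial.eval_ofNat]
    exact Nat.mul_le_mul (polynomial_eval_mono _ (hM _ (by omega) (by omega))) (by omega)

theorem hasPolyTimeAlgorithm_aps :
    HasPolyTimeAlgorithm (fun {n m} (I : Instance n m) => I.IsSubmodular)
      (fun {n m} (I : Instance n m) A => I.IsAPSFair (1 / 3) A) := by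
  refine hasPolyTimeAlgorithm_of_bids (c := 3)
    (fun f r hr => by unfold apsBid; split_ifs <;> linarith) computesBid_aps isPiecewiseLinear_aps
    (by norm_num) le_rfl (fun I i => anyPriceShare (I.entitlement i) (I.value i)) (fun h => h) ?_ ?_ ?_ ?_
  · intro n m I hI θ st hst hall i hi
    have h1 : (1 : ℝ) ≤ n := by exact_mod_cast i.pos
    have h0 : (0 : ℝ) ≤ m := by positivity
    refine anyPriceShare_le_of_lt hI hst hall hi ?_ ?_
    · rw [div_le_div_iff₀ (by linarith) (by norm_num)]; linarith
    · rw [mul_one_div, div_le_div_iff₀ (by linarith) (by norm_num)]; linarith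
  · intro n m I hI i
    have h1 := (hI.value_submodular i).nonneg Finset.univ
    have h2 := anyPriceShare_le_univ (hI.value_submodular i) (hI.entitlement_pos i).le
    linarith
  · intro n m I hI i
    exact anyPriceShare_eq (hI.entitlement_pos i).le
  · intro n m I A _ h i
    linarith [h i]

theorem hasPolyTimeAlgorithm_mms :
    HasPolyTimeAlgorithm (fun {n m} (I : Instance n m) => I.IsSubmodular ∧ I.EqualEntitlements)
      (fun {n m} (I : Instance n m) A => I.IsMMSFair (10 / 27) A) := by
  refine hasPolyTimeAlgorithm_of_bids (c := 27 / 10) mmsBid_nonneg computesBid_mms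
    isPiecewiseLinear_mms (by norm_num) (by norm_num) (fun {n m} I i => maximinShare n (I.value i))
    (fun h => h.1) ?_ ?_ ?_ ?_
  · intro n m I hI θ st hst hall i hi
    have h1 : (1 : ℝ) ≤ n := by exact_mod_cast i.pos
    have h0 : (0 : ℝ) ≤ m := by positivity
    have hv := hI.1.value_submodular i
    -- Without items and with one agent `ε = 1 / 4` exceeds `1 / 8`; but then the share is 0.
    rcases Nat.eq_zero_or_pos m with rfl | hm
    · obtain ⟨S, hS⟩ := maximinShare_eq i.pos (I.value i)
      have hθ : 0 ≤ θ i := (hv.nonneg _).trans hi.le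
      rw [hS, Finset.eq_empty_of_isEmpty S, hv.normalized]
      exact mul_nonneg (by norm_num) (mul_nonneg hθ (targetRate_nonneg (by have := i.pos; omega)))
    · have h2 : (1 : ℝ) ≤ m := by exact_mod_cast hm
      refine maximinShare_le_of_lt hI.1 hI.2 hst hall hi ?_ ?_ (by positivity)
      · rw [div_le_div_iff₀ (by linarith) (by norm_num)]; linarith
      · rw [mul_one_div, div_lt_div_iff₀ (by linarith) (by norm_num)]; linarith
  · intro n m I hI i
    obtain ⟨S, hS⟩ := maximinShare_eq i.pos (I.value i)
    have h1 := (hI.1.value_submodular i).nonneg Finset.univ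
    have h2 := (hI.1.value_submodular i).monotone (Finset.subset_univ S)
    rw [hS]
    linarith
  · intro n m I hI i
    exact .inr (maximinShare_eq i.pos (I.value i))
  · intro n m I A _ h i
    linarith [h i]

end FairAllocation

theorem corollary3 :
    FairAllocation.HasPolyTimeAlgorithm
      (fun {n m} (I : FairAllocation.Instance n m) => I.IsSubmodular)
      (fun {n m} (I : FairAllocation.Instance n m) A => I.IsAPSFair (1 / 3) A) ∧
    FairAllocation.HasPolyTimeAlgorithm
      (fun {n m} (I : FairAllocation.Instance n m) => I.IsSubmodular ∧ I.EqualEntitlements)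
      (fun {n m} (I : FairAllocation.Instance n m) A => I.IsMMSFair (10 / 27) A) :=
  ⟨FairAllocation.hasPolyTimeAlgorithm_aps, FairAllocation.hasPolyTimeAlgorithm_mms⟩
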